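/- Let $b$ be a prime power, $F/\mathbb{F}_b$ an algebraic function field with full constant field $\mathbb{F}_b$ and genus $g$; write $\mathcal{L}(D)$ for the Riemann–Roch space of a divisor $D$ and $\nu_P$ for the normalized discrete valuation at a place $P$. Let $P_\infty$ be a rational place, let $P_1,\dots,P_s$ be distinct places different from $P_\infty$, put $e_i=\deg P_i$, and let $G\ge 0$ be a divisor with $\deg G=2g$ and $P_\infty\notin\operatorname{supp} G$. Let $P_0$ be a place with $P_0\notin\{P_1,\dots,P_s,P_\infty\}$ and $P_0\notin\operatorname{supp} G$. Let $w_0,\dots,w_g$ be a basis of $\mathcal{L}(G)$ over $\mathbb{F}_b$ with $\nu_{P_\infty}(w_u)=n_u$ for $0\le u\le g$, where $0=n_0<n_1<\dots<n_g\le 2g$. For $1\le i\le s$ let $k^{(i)}_1,k^{(i)}_2,\dots\in F$ be such that for every $n\ge 1$ the elements $w_0,\dots,w_g,k^{(i)}_1,\dots,k^{(i)}_{ne_i}$ form a basis of $\mathcal{L}(G+nP_i)$. Let $$z\in\mathcal{L}((2g+1)P_0-P_\infty)\setminus\mathcal{L}((2g+1)P_0-2P_\infty)$$ (so $z$ is a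 local parameter at $P_\infty$). For $r\ge 0$ put $z_r=w_u$ if $r=n_u$ for some $u$, and $z_r=z^r$ otherwise, and let $k^{(i)}_j=\sum_{r\ge 0}a^{(i)}_{j,r}z_r$ with $a^{(i)}_{j,r}\in\mathbb{F}_b$ be the local expansion of $k^{(i)}_j$ at $P_\infty$. Let $h(0)<h(1)<\cdots$ be the elements of $\mathbb{N}_0\setminus\{n_0,\dots,n_g\}$ and put $c^{(i)}_{j,r}=a^{(i)}_{j,h(r)}$ for $1\le i\le s$, $j\ge 1$, $r\ge 0$. Let $\phi:\{0,\dots,b-1\}\to\mathbb{F}_b$ be a bijection with $\phi(0)=0$. For $n\ge 0$ with $b$-adic expansion $n=\sum_{r\ge 0}a_r(n)b^r$ let $$x^{(i)}_n=\sum_{j\ge 1}\phi^{-1}\Big(\sum_{r\ge 0}\phi(a_r(n))\,c^{(i)}_{j,r}\Big)b^{-j},\qquad \mathbf{x}_n=(x^{(1)}_n,\dots,x^{(s)}_n)$$ (the Xing–Niederreiter sequence). Let $\gamma_1,\dots,\gamma_s\in(0,1)$. Then the box $S=[0,\gamma_1)\times\dots\times[0,\gamma_s)$ is a bounded remainder set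 for $(\mathbf{x}_n)_{n\ge 0}$, that is, $\sum_{n=0}^{N-1}(\mathbf{1}_S(\mathbf{x}_n)-\gamma_1\cdots\gamma_s)$ is bounded in $N$, if and only if every $\gamma_i$ has a finite $b$-adic expansion. -/

import Mathlib

noncomputable section

namespace FnField

/-! ### Places of an algebraic function field -/

/-- A place of `F/K`, given by its valuation ring `O_P` (`K ⊆ O_P ≠ F`, and `x ∈ O_P` or
`x⁻¹ ∈ O_P` for every `x ∈ F`).  The place itself is the maximal ideal of `O_P`, which determines
`O_P` and is determined by it. -/
structure Place (K F : Type*) [Field K] [Field F] [Algebra K F] where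
  /-- the valuation ring `O_P` -/
  integers : ValuationSubring F
  algebraMap_mem : ∀ c : K, algebraMap K F c ∈ integers
  ne_top : integers ≠ ⊤

namespace Place

variable {K F : Type*} [Field K] [Field F] [Algebra K F] (P : Place K F)

instance : Algebra K P.integers :=
  RingHom.toAlgebra ((algebraMap K F).codRestrict P.integers P.algebraMap_mem)

instance : IsScalarTower K P.integers F := IsScalarTower.of_algebraMap_eq fun _ => rfl

/-- `F` is finite over `K(y)` for every `y` that is transcendental over `K`. -/
theorem finite_adjoin [Algebra (RatFunc K) F] [IsScalarTower K (RatFunc K) F] [FunctionField K F]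
    {y : F} (hy : Transcendental K y) : FiniteDimensional (IntermediateField.adjoin K {y}) F := by
  have h1 : Algebra.trdeg K (RatFunc K) = 1 := by
    have := Polynomial.trdeg_of_isDomain (R := K)
    rw [← trdeg_add_eq K (Polynomial K) (A := RatFunc K), this, 
      trdeg_eq_zero_iff.2 (IsLocalization.isAlgebraic _ (nonZeroDivisors (Polynomial K))), add_zero]
  have h2 : Algebra.trdeg K F = 1 := by
    have := lift_trdeg_add_eq K (RatFunc K) F
    rw [trdeg_eq_zero (R := RatFunc K) (A := F), h1] at this
    simpa using this.symm
  have hI : AlgebraicIndependent K (fun _ : Unit => y) :=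
    algebraicIndependent_unique_type_iff.2 hy
  have hb : IsTranscendenceBasis K (fun _ : Unit => y) :=
    hI.isTranscendenceBasis_of_lift_trdeg_le_of_finite (by rw [h2]; simp)
  have alg := hb.isAlgebraic_field
  rw [Set.range_const] at alg
  have e0 : Algebra.EssFiniteType K (RatFunc K) := by
    have : Algebra.EssFiniteType (Polynomial K) (RatFunc K) := .of_isLocalization _ (nonZeroDivisors _)
    exact .comp K (Polynomial K) _
  have e1 : Algebra.EssFiniteType K F := .comp K (RatFunc K) F
  have e2 : Algebra.EssFiniteType (IntermediateField.adjoin K {y}) F := .of_comp K _ F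
  exact Algebra.finite_of_essFiniteType_of_isAlgebraic


/-- A nonzero element of the maximal ideal of a place is transcendental over the constants. -/
theorem transcendental_of_not_isUnit {y : P.integers} (hy0 : y ≠ 0) (hy : ¬ IsUnit y) :
    Transcendental K (y : F) := by
  intro hal
  apply hy
  have hy0' : (y : F) ≠ 0 := by simpa using hy0
  have h1 : (y : F)⁻¹ ∈ Algebra.adjoin K {(y : F)} :=
    (Subalgebra.inv_mem_of_algebraic (A := Algebra.adjoin K {(y : F)})
      (x := ⟨y, Algebra.self_mem_adjoin_singleton K _⟩) hal)
  let B : Subalgebra K F := { P.integers.toSubring with algebraMap_mem' := P.algebraMap_mem }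
  have h2 : Algebra.adjoin K {(y : F)} ≤ B := by
    rw [Algebra.adjoin_le_iff, Set.singleton_subset_iff]
    exact y.2
  have h3 : (y : F)⁻¹ ∈ P.integers := h2 h1
  refine IsUnit.of_mul_eq_one ⟨_, h3⟩ (Subtype.ext ?_)
  exact mul_inv_cancel₀ hy0'

/-- Elements that are independent modulo `y` satisfy no nontrivial relation over `K[y]`. -/
theorem poly_indep {y : P.integers} (hy0 : y ≠ 0) {ι : Type*} [Fintype ι] (a : ι → P.integers)
    (ha : LinearIndependent K (fun i => Ideal.Quotient.mk (Ideal.span {y}) (a i))) (n : ℕ) :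
    ∀ p : ι → Polynomial K, ∑ i, Polynomial.aeval y (p i) * a i = 0 →
      ∀ i, Polynomial.X ^ n ∣ p i := by
  induction n with
  | zero => intro p _ i; simp
  | succ n ih =>
    intro p hp
    have hq (i) : p i = Polynomial.X * (p i).divX + Polynomial.C ((p i).coeff 0) :=
      (Polynomial.X_mul_divX_add _).symm
    have h0 : ∀ i, (p i).coeff 0 = 0 := by
      refine Fintype.linearIndependent_iff.1 ha (fun i => (p i).coeff 0) ?_
      have h := congrArg (Ideal.Quotient.mk (Ideal.span {y})) hp
      rw [map_zero, map_sum] at h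
      rw [← h]
      refine Finset.sum_congr rfl fun i _ => ?_
      have hy' : Ideal.Quotient.mk (Ideal.span {y}) y = 0 :=
        Ideal.Quotient.eq_zero_iff_mem.2 (Ideal.mem_span_singleton_self y)
      conv_rhs => rw [hq i]
      simp only [map_add, map_mul, Polynomial.aeval_X, Polynomial.aeval_C, hy', zero_mul, zero_add]
      rw [Algebra.smul_def]
      rfl
    have hX (i) : p i = Polynomial.X * (p i).divX := by
      conv_lhs => rw [hq i, h0 i]
      simp
    have h1 : ∑ i, Polynomial.aeval y (p i).divX * a i = 0 := by
      have : y * ∑ i, Polynomial.aeval y (p i).divX * a i = 0 := by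
        rw [← hp, Finset.mul_sum]
        refine Finset.sum_congr rfl fun i _ => ?_
        conv_rhs => rw [hX i]
        rw [map_mul, Polynomial.aeval_X, mul_assoc]
      exact (mul_eq_zero.1 this).resolve_left hy0
    intro i
    rw [hX i, pow_succ']
    exact mul_dvd_mul_left _ (ih _ h1 i)

/-- `O_P / (y)` is finite-dimensional over `K` for nonzero `y` in the maximal ideal. -/
theorem finite_quotient [Algebra (RatFunc K) F] [IsScalarTower K (RatFunc K) F]
    [FunctionField K F] {y : P.integers} (hy0 : y ≠ 0) (hy : ¬ IsUnit y) :
    Module.Finite K (P.integers ⧸ Ideal.span {y}) := by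
  have hfin := finite_adjoin (P.transcendental_of_not_isUnit hy0 hy)
  have key : Module.rank K (P.integers ⧸ Ideal.span {y}) ≤
      Module.finrank (IntermediateField.adjoin K {(y : F)}) F := by
    refine rank_le fun s hs => ?_
    have hsurj : Function.Surjective (Ideal.Quotient.mk (Ideal.span {y})) :=
      Ideal.Quotient.mk_surjective
    let a : s → P.integers := fun i => Function.surjInv hsurj i.1
    have ha : LinearIndependent K (fun i => Ideal.Quotient.mk (Ideal.span {y}) (a i)) := by
      convert hs using 2 with i
      exact Function.surjInv_eq hsurj _
    open scoped IntermediateField.algebraAdjoinAdjoin in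
    have hli : LinearIndependent (IntermediateField.adjoin K {(y : F)}) (fun i => (a i : F)) := by
      rw [← LinearIndependent.iff_fractionRing (Algebra.adjoin K {(y : F)}),
        Fintype.linearIndependent_iff]
      intro g hg
      have hex (i) : ∃ p : Polynomial K, Polynomial.aeval (y : F) p = g i := by
        have h := Algebra.adjoin_singleton_eq_range_aeval K (y : F)
        exact (h ▸ (g i).2 : (g i : F) ∈ (Polynomial.aeval (R := K) (y : F)).range)
      choose p hp using hex
      have hrel : ∑ i, Polynomial.aeval y (p i) * a i = 0 := by
        apply Subtype.ext
        have : ∀ q : Polynomial K, ((Polynomial.aeval y q : P.integers) : F) =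
            Polynomial.aeval (y : F) q := fun q =>
          (Polynomial.aeval_algebraMap_apply F y q).symm
        push_cast
        simp only [this, hp]
        exact hg
      have hz : ∀ i, p i = 0 := by
        intro i
        by_contra hne
        have := P.poly_indep hy0 a ha ((p i).natDegree + 1) p hrel i
        have := Polynomial.natDegree_le_of_dvd this hne
        simp at this
      intro i
      apply Subtype.ext
      rw [← hp i, hz i]
      simp
    have := hli.fintype_card_le_finrank
    simpa using this
  exact Module.rank_lt_aleph0_iff.1 (key.trans_lt (Cardinal.natCast_lt_aleph0))

/-- The valuation ring of a place of a function field is a discrete valuation ring. -/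
instance [Algebra (RatFunc K) F] [IsScalarTower K (RatFunc K) F]
    [FunctionField K F] : IsDiscreteValuationRing P.integers := by
  have hN : IsNoetherianRing P.integers := by
    rw [isNoetherianRing_iff_ideal_fg]
    intro I
    by_cases hI : I = ⊥
    · exact hI ▸ Submodule.fg_bot
    obtain ⟨y, hyI, hy0⟩ := Submodule.exists_mem_ne_zero_of_ne_bot hI
    by_cases hu : IsUnit y
    · rw [Ideal.eq_top_of_isUnit_mem I hyI hu]
      exact ⟨{1}, by simp⟩
    have := P.finite_quotient hy0 hu
    have : IsNoetherianRing (P.integers ⧸ Ideal.span {y}) := IsNoetherianRing.of_finite K _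
    have hN : IsNoetherian P.integers (P.integers ⧸ Ideal.span {y}) :=
      isNoetherian_of_tower K inferInstance
    refine Submodule.fg_of_fg_map_of_fg_inf_ker (Ideal.span {y}).mkQ (hN.noetherian _) ?_
    rw [Submodule.ker_mkQ, inf_eq_right.2 ((Ideal.span_singleton_le_iff_mem I).2 hyI)]
    exact ⟨{y}, by simp⟩
  have hF : ¬ IsField P.integers := by
    intro h
    apply P.ne_top
    rw [eq_top_iff]
    intro x _
    rcases P.integers.mem_or_inv_mem x with hx | hx
    · exact hx
    by_cases h0 : x = 0
    · exact h0 ▸ P.integers.zero_mem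
    obtain ⟨c, hc⟩ := h.mul_inv_cancel (a := ⟨x⁻¹, hx⟩) (by simpa [Subtype.ext_iff] using h0)
    have hc' : x⁻¹ * (c : F) = 1 := congrArg Subtype.val hc
    have : (c : F) = x := by
      rw [inv_mul_eq_one₀ h0] at hc'
      exact hc'.symm
    exact this ▸ c.2
  have hV : ValuationRing P.integers := inferInstance
  exact ((IsDiscreteValuationRing.TFAE P.integers hF).out 0 1 :
    IsDiscreteValuationRing P.integers ↔ ValuationRing P.integers).2 hV

/-- The degree of a place: the dimension over `K` of its residue field. -/
def degree : ℕ := Module.finrank K (IsLocalRing.ResidueField P.integers)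

variable [Algebra (RatFunc K) F] [IsScalarTower K (RatFunc K) F] [FunctionField K F]

/-- The normalized discrete valuation of `F` at `P`, in multiplicative notation. -/
def valuation : Valuation F (WithZero (Multiplicative ℤ)) :=
  (IsDiscreteValuationRing.maximalIdeal P.integers).valuation F

/-- The normalized discrete valuation `ν_P` of `F`, in additive notation, with `ν_P(0) = ∞`. -/
def ord (x : F) : WithTop ℤ :=
  open scoped Classical in
  if x = 0 then ⊤ else ((-WithZero.log (P.valuation x) : ℤ) : WithTop ℤ)

theorem le_ord_iff (n : ℤ) (x : F) :
    (n : WithTop ℤ) ≤ P.ord x ↔ P.valuation x ≤ WithZero.exp (-n) := by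
  unfold ord
  split_ifs with h
  · simp [h]
  · have h0 : P.valuation x ≠ 0 := (Valuation.ne_zero_iff _).2 h
    rw [WithTop.coe_le_coe, ← WithZero.log_le_iff_le_exp h0]
    omega

theorem valuation_algebraMap_le_one (c : K) : P.valuation (algebraMap K F c) ≤ 1 :=
  (IsDiscreteValuationRing.maximalIdeal P.integers).valuation_le_one (algebraMap K P.integers c)

end Place

/-! ### Divisors, Riemann-Roch spaces, genus -/

/-- A divisor of `F/K`: a formal finite integer combination of places. -/
abbrev Divisor (K F : Type*) [Field K] [Field F] [Algebra K F] := Place K F →₀ ℤ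

/-- The degree of a divisor, `deg D = ∑_P D(P) deg(P)`. -/
def Divisor.degree {K F : Type*} [Field K] [Field F] [Algebra K F] (D : Divisor K F) : ℤ :=
  D.sum fun P n => n * (P.degree : ℤ)

section

variable {K F : Type*} [Field K] [Field F] [Algebra K F]
  [Algebra (RatFunc K) F] [IsScalarTower K (RatFunc K) F] [FunctionField K F]

/-- The Riemann-Roch space `L(D) = {y ≠ 0 | div(y) + D ≥ 0} ∪ {0}`. -/
def riemannRochSpace (D : Divisor K F) : Submodule K F where
  carrier := {y | ∀ P : Place K F, ((-D P : ℤ) : WithTop ℤ) ≤ P.ord y}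
  zero_mem' P := by simp [Place.ord]
  add_mem' {x y} hx hy P := by
    have h1 := (P.le_ord_iff _ _).1 (hx P)
    have h2 := (P.le_ord_iff _ _).1 (hy P)
    exact (P.le_ord_iff _ _).2 ((Valuation.map_add _ _ _).trans (max_le h1 h2))
  smul_mem' c x hx P := by
    have h1 := (P.le_ord_iff _ _).1 (hx P)
    refine (P.le_ord_iff _ _).2 ?_
    rw [Algebra.smul_def, map_mul]
    exact (mul_le_of_le_one_left zero_le (P.valuation_algebraMap_le_one c)).trans h1

variable (K F) in
/-- The genus of `F/K`: the maximum of `deg D - ℓ(D) + 1` over all divisors `D`. -/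
def genus : ℕ :=
  (sSup (Set.range fun D : Divisor K F =>
    D.degree - (Module.finrank K (riemannRochSpace D) : ℤ) + 1)).toNat

/-! ### Local expansions -/

/-- `x = ∑_{r ≥ 0} a_r ζ_r` in the completion of `F` at `P`.  Here `(ζ_r)` is a sequence with
`ν_P(ζ_r) = r`, so that this convergence means `ν_P(x - ∑_{r < N} a_r ζ_r) ≥ N` for all `N`. -/
def HasLocalExpansion (P : Place K F) (ζ : ℕ → F) (x : F) (a : ℕ → K) : Prop :=
  ∀ N : ℕ, ((N : ℤ) : WithTop ℤ) ≤ P.ord (x - ∑ r ∈ Finset.range N, a r • ζ r)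

/-- The coefficients `(a_r)` of the local expansion `x = ∑_{r ≥ 0} a_r ζ_r` at `P`.
(They exist and are unique if `P` is rational, `ν_P(ζ_r) = r` for all `r` and `ν_P(x) ≥ 0`.) -/
def localCoeff (P : Place K F) (ζ : ℕ → F) (x : F) : ℕ → K :=
  Classical.epsilon (HasLocalExpansion P ζ x)

end

/-- The family `v` is a basis of the subspace `V`. -/
def IsBasisOf {K F : Type*} [Field K] [Field F] [Algebra K F] {ι : Type*} (v : ι → F)
    (V : Submodule K F) : Prop :=
  LinearIndependent K v ∧ Submodule.span K (Set.range v) = V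

/-! ### Digital sequences and bounded remainder sets -/

/-- The digital sequence over `K` (a field with `b` elements) with generating matrices
`C^{(1)}, …, C^{(s)}` and the bijection `φ` between digits and field elements.  Rows and columns
are indexed from `0`: `C i j r` is the entry in the row of the `(j+1)`-st output digit of the
`i`-th coordinate and in the column of the digit `a_r(n) = ⌊n / b^r⌋ mod b`. -/
def digitalSequence {K : Type*} [Field K] (b : ℕ) [NeZero b] (φ : Fin b ≃ K) {s : ℕ}
    (C : Fin s → ℕ → ℕ → K) (n : ℕ) : Fin s → ℝ := fun i =>
  Real.ofDigits fun j => φ.symm (∑ᶠ r : ℕ, φ (Fin.ofNat b (n / b ^ r)) * C i j r)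

/-- `S` is a bounded remainder set for `(x_n)`: the sums `∑_{n < N} (1_S(x_n) - λ(S))` are bounded
in `N`. -/
def IsBoundedRemainderSet {s : ℕ} (S : Set (Fin s → ℝ)) (x : ℕ → Fin s → ℝ) : Prop :=
  ∃ C : ℝ, ∀ N : ℕ,
    |∑ n ∈ Finset.range N, (S.indicator (fun _ => (1 : ℝ)) (x n) - MeasureTheory.volume.real S)|
      ≤ C

/-! ### The Xing-Niederreiter construction -/

/-- The sequence `z_r`: `z_r = w_u` if `r = n_u` for some `u`, and `z_r = z^r` otherwise. -/
def expansionSeq {F : Type*} [Field F] {g : ℕ} (m : Fin (g + 1) → ℕ) (w : Fin (g + 1) → F)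
    (z : F) (r : ℕ) : F :=
  open scoped Classical in
  if h : ∃ u, r = m u then w h.choose else z ^ r

/-- The Xing-Niederreiter generating matrices: the row `j` (from `0`) of `C^{(i)}` consists of the
coefficients of the expansion of `k^{(i)}_j` at `P_∞` along the sequence `z_r`, with the
coefficients of index `n_0, …, n_g` deleted. -/
def xnMatrix {K F : Type*} [Field K] [Field F] [Algebra K F]
    [Algebra (RatFunc K) F] [IsScalarTower K (RatFunc K) F] [FunctionField K F]
    (Pinf : Place K F) {g : ℕ} (m : Fin (g + 1) → ℕ) (w : Fin (g + 1) → F) (z : F) {s : ℕ}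
    (k : Fin s → ℕ → F) : Fin s → ℕ → ℕ → K := fun i j r =>
  localCoeff Pinf (expansionSeq m w z) (k i j) (Nat.nth (fun n => n ∉ Set.range m) r)

end FnField

end

open FnField

/-! The geometry enters only through three properties of the generating matrices, proved for the
entries with the columns n_0, …, n_g removed. Rows (`xnMatrix_rows_independent`): if a combination
of finitely many rows vanishes in all but finitely many columns, then the same combination x of the
k^{(i)}_j has a terminating expansion, so x is a finite sum of multiples of the z_r in F itself.
Beyond G, the z_r have poles only at P_0 and the k^{(i)}_j only at the P_i. Hence x ∈ L(G), and all
coefficients vanish. Columns (`xnMatrix_columns_independent`): L(G + nP_i) contains functions of any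
prescribed order at P_∞, which gives triangular combinations of rows. Relations
(`xnMatrix_exists_row_relation`): up to a constant κ, row d can be cancelled in its first d columns
by earlier rows. The last two properties rest on Riemann's theorem, which is deduced from the
dimensions of L(G + nP_i) supplied by the bases.

If all γ_i have finite expansions, membership in the box is decided by D digits per coordinate,
apart from points whose digits end in b−1 forever; column independence allows at most finitely many
such points. By row independence the D leading digits are equidistributed over every aligned block
of some length b^L, so the sums are bounded.

For the converse let γ_i have an infinite expansion. There are infinitely many d for which γ_i b^d
stays away from the integers, and the box then correlates with the value of a linear functional of
the digits 0, …, d whose coefficient at d is 1. Take the functional from the row relation: on the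
sequence it first reacts to an input digit of index t ≥ d − κ. For sparse d_0 < … < d_{R−1} and N =
∑ b^{d_q − κ}, the discrepancy of N consecutive points, as a function of a random digit vector Y
added to them, has correlation at least a fixed ε with some bounded mean-zero function ρ_q of each
functional (`exists_correlation`). Row independence beyond any column realizes all Y by starting
indices k b^c (`le_sum_discrepancy`). Functions attached to different d_q are orthogonal, so their
sum has mean absolute value at most √R, whereas the total correlation is at least Rε. A bounded
discrepancy is impossible for large R. -/

noncomputable section

namespace FnField

/-! ### Valuations, filtrations and weak approximation. -/

namespace Place

variable {K F : Type*} [Field K] [Field F] [Algebra K F]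
  [Algebra (RatFunc K) F] [IsScalarTower K (RatFunc K) F] [FunctionField K F] (P : Place K F)

/-- The normalized valuation of a place with values in `ℤ` (and value `0` at `0`). -/
def val (x : F) : ℤ := -WithZero.log (P.valuation x)

theorem ord_of_ne_zero {x : F} (hx : x ≠ 0) : P.ord x = (P.val x : WithTop ℤ) := by
  simp [ord, hx, val]

theorem valuation_ne_zero {x : F} (hx : x ≠ 0) : P.valuation x ≠ 0 :=
  (Valuation.ne_zero_iff _).2 hx

theorem valuation_le_exp_iff {x : F} (hx : x ≠ 0) (n : ℤ) :
    P.valuation x ≤ WithZero.exp (-n) ↔ n ≤ P.val x := by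
  rw [← WithZero.log_le_iff_le_exp (P.valuation_ne_zero hx), val]
  omega

theorem val_mul {x y : F} (hx : x ≠ 0) (hy : y ≠ 0) : P.val (x * y) = P.val x + P.val y := by
  simp only [val, map_mul]
  rw [WithZero.log_mul (P.valuation_ne_zero hx) (P.valuation_ne_zero hy)]
  ring

@[simp] theorem val_inv (x : F) : P.val x⁻¹ = -P.val x := by
  simp [val, WithZero.log_inv]

@[simp] theorem val_one : P.val 1 = 0 := by simp [val]

@[simp] theorem val_pow (x : F) (n : ℕ) : P.val (x ^ n) = n * P.val x := by
  simp [val, WithZero.log_pow]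

variable (n : ℤ)

/-- The `K`-subspace of all `x` with `ν_P(x) ≥ n`. -/
def filtration : Submodule K F where
  carrier := {x | (n : WithTop ℤ) ≤ P.ord x}
  zero_mem' := by simp [ord]
  add_mem' {x y} hx hy :=
    (P.le_ord_iff _ _).2 ((Valuation.map_add _ _ _).trans
      (max_le ((P.le_ord_iff _ _).1 hx) ((P.le_ord_iff _ _).1 hy)))
  smul_mem' c x hx := by
    refine (P.le_ord_iff _ _).2 ?_
    rw [Algebra.smul_def, map_mul]
    exact (mul_le_of_le_one_left zero_le (P.valuation_algebraMap_le_one c)).trans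
      ((P.le_ord_iff _ _).1 hx)

variable {n}

theorem mem_filtration {x : F} : x ∈ P.filtration n ↔ (n : WithTop ℤ) ≤ P.ord x := Iff.rfl

theorem mem_filtration_iff_valuation {x : F} :
    x ∈ P.filtration n ↔ P.valuation x ≤ WithZero.exp (-n) := P.le_ord_iff _ _

theorem mem_filtration_iff {x : F} : x ∈ P.filtration n ↔ x = 0 ∨ n ≤ P.val x := by
  rw [mem_filtration_iff_valuation]
  by_cases hx : x = 0
  · simp [hx]
  · rw [P.valuation_le_exp_iff hx, or_iff_right hx]

theorem mem_filtration_of_ne_zero {x : F} (hx : x ≠ 0) : x ∈ P.filtration n ↔ n ≤ P.val x := by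
  simp [mem_filtration_iff, hx]

theorem filtration_anti {k n : ℤ} (h : k ≤ n) : P.filtration n ≤ P.filtration k := by
  intro x hx
  rw [mem_filtration_iff] at hx ⊢
  exact hx.imp_right h.trans

theorem mul_mem_filtration {k n : ℤ} {x y : F} (hx : x ∈ P.filtration k)
    (hy : y ∈ P.filtration n) : x * y ∈ P.filtration (k + n) := by
  by_cases hx0 : x = 0
  · simp [hx0]
  by_cases hy0 : y = 0
  · simp [hy0]
  rw [mem_filtration_of_ne_zero _ (by assumption)] at hx hy
  rw [mem_filtration_of_ne_zero _ (mul_ne_zero hx0 hy0), P.val_mul hx0 hy0]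
  omega

theorem pow_mem_filtration {x : F} (hx : x ∈ P.filtration n) (k : ℕ) :
    x ^ k ∈ P.filtration (k * n) := by
  by_cases hx0 : x = 0
  · rcases k with _ | k
    · simp [mem_filtration_iff]
    · simp [hx0]
  · rw [mem_filtration_of_ne_zero _ hx0] at hx
    rw [mem_filtration_of_ne_zero _ (pow_ne_zero k hx0), val_pow]
    gcongr

theorem mem_filtration_zero {x : F} : x ∈ P.filtration 0 ↔ x ∈ P.integers := by
  rw [mem_filtration_iff_valuation, neg_zero, WithZero.exp_zero]
  constructor
  · intro h
    obtain ⟨y, rfl⟩ := IsDedekindDomain.HeightOneSpectrum.mem_integers_of_valuation_le_one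
      (R := P.integers) F x (fun v => by
      have : v = IsDiscreteValuationRing.maximalIdeal P.integers := by
        ext1
        exact IsLocalRing.eq_maximalIdeal (v.isPrime.isMaximal v.ne_bot)
      rw [this]
      exact h)
    exact y.2
  · intro h
    exact (IsDiscreteValuationRing.maximalIdeal P.integers).valuation_le_one (⟨x, h⟩ : P.integers)

theorem mem_filtration_one (x : P.integers) :
    (x : F) ∈ P.filtration 1 ↔ x ∈ IsLocalRing.maximalIdeal P.integers := by
  rw [mem_filtration_iff_valuation]
  have h := (IsDiscreteValuationRing.maximalIdeal P.integers).valuation_lt_one_iff_mem (K := F) x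
  refine Iff.trans ?_ h
  change P.valuation (x : F) ≤ _ ↔ P.valuation (x : F) < 1
  by_cases hx : (x : F) = 0
  · simp [hx]
  · have h0 := P.valuation_ne_zero hx
    rw [← WithZero.log_le_iff_le_exp h0, ← WithZero.exp_zero, ← WithZero.log_lt_iff_lt_exp h0]
    omega

theorem exists_val_eq_one : ∃ t : F, t ≠ 0 ∧ P.val t = 1 := by
  obtain ⟨t, ht⟩ := (IsDiscreteValuationRing.maximalIdeal P.integers).valuation_exists_uniformizer F
  have ht' : P.valuation t = WithZero.exp (-1 : ℤ) := ht
  refine ⟨t, ?_, by simp [val, ht']⟩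
  rintro rfl
  rw [map_zero] at ht'
  exact WithZero.exp_ne_zero ht'.symm

/-- A local parameter. -/
def unif : F := P.exists_val_eq_one.choose

theorem unif_ne_zero : P.unif ≠ 0 := P.exists_val_eq_one.choose_spec.1

@[simp] theorem val_unif : P.val P.unif = 1 := P.exists_val_eq_one.choose_spec.2

@[simp] theorem val_zpow (x : F) (k : ℤ) : P.val (x ^ k) = k * P.val x := by
  simp [val, map_zpow₀, WithZero.log_zpow]

theorem mul_unif_mem {k : ℤ} {x : F} (hx : x ∈ P.filtration n) :
    x * P.unif ^ k ∈ P.filtration (n + k) :=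
  P.mul_mem_filtration hx (by
    rw [mem_filtration_of_ne_zero _ (zpow_ne_zero _ P.unif_ne_zero)]; simp)

theorem mul_unif_mem_iff {k : ℤ} {x : F} :
    x * P.unif ^ k ∈ P.filtration (n + k) ↔ x ∈ P.filtration n := by
  refine ⟨fun h => ?_, P.mul_unif_mem⟩
  have := P.mul_unif_mem (k := -k) h
  rwa [mul_assoc, ← zpow_add₀ P.unif_ne_zero, add_neg_cancel, zpow_zero, mul_one,
    add_neg_cancel_right] at this

variable (n)

/-- The leading coefficient map of the `n`-th step of the filtration: its values lie in the
residue field and its kernel is the next step. -/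
def lead : P.filtration n →ₗ[K] IsLocalRing.ResidueField P.integers where
  toFun x := IsLocalRing.residue P.integers ⟨x * P.unif ^ (-n),
    P.mem_filtration_zero.1 (by simpa using P.mul_unif_mem (k := -n) x.2)⟩
  map_add' x y := by
    rw [← map_add]
    congr 1
    ext
    simp [add_mul]
  map_smul' c x := by
    rw [RingHom.id_apply, Algebra.smul_def, IsScalarTower.algebraMap_apply K P.integers]
    rw [IsLocalRing.ResidueField.algebraMap_eq, ← map_mul]
    congr 1
    ext
    change (c • (x : F)) * P.unif ^ (-n) = algebraMap K F c * (x * P.unif ^ (-n))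
    rw [Algebra.smul_def, mul_assoc]

theorem lead_eq_zero_iff (x : P.filtration n) : P.lead n x = 0 ↔ (x : F) ∈ P.filtration (n + 1) := by
  simp only [lead, LinearMap.coe_mk, AddHom.coe_mk]
  rw [IsLocalRing.residue_eq_zero_iff, ← mem_filtration_one]
  have := P.mul_unif_mem_iff (n := n + 1) (k := -n) (x := (x : F))
  rwa [show n + 1 + -n = 1 by ring] at this

theorem lead_surjective : Function.Surjective (P.lead n) := by
  intro y
  obtain ⟨a, rfl⟩ := IsLocalRing.residue_surjective y
  refine ⟨⟨a * P.unif ^ n, ?_⟩, ?_⟩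
  · simpa using P.mul_unif_mem (k := n) (P.mem_filtration_zero.2 a.2)
  · simp only [lead, LinearMap.coe_mk, AddHom.coe_mk]
    congr 1
    ext
    simp [mul_assoc, mul_inv_cancel₀ (zpow_ne_zero n P.unif_ne_zero)]

instance : Module.Finite K (IsLocalRing.ResidueField P.integers) := by
  have h := P.mem_filtration_one
  obtain ⟨t, ht⟩ := IsDiscreteValuationRing.exists_irreducible P.integers
  have := P.finite_quotient ht.ne_zero ht.not_isUnit
  rw [← ht.maximalIdeal_eq] at this
  exact this

theorem degree_pos : 0 < P.degree := Module.finrank_pos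

theorem filtration_smul_mem_iff {c : K} (hc : c ≠ 0) {x : F} :
    c • x ∈ P.filtration n ↔ x ∈ P.filtration n := by
  refine ⟨fun h => ?_, Submodule.smul_mem _ c⟩
  simpa [smul_smul, hc] using (P.filtration n).smul_mem c⁻¹ h

variable {n}

theorem val_add_eq_left {x y : F} (hx : x ≠ 0) (hy : y ∈ P.filtration (P.val x + 1)) :
    x + y ≠ 0 ∧ P.val (x + y) = P.val x := by
  have hxy : x + y ∉ P.filtration (P.val x + 1) := by
    intro h
    have := (P.filtration _).sub_mem h hy
    rw [add_sub_cancel_right, mem_filtration_of_ne_zero _ hx] at this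
    omega
  have h0 : x + y ≠ 0 := by
    intro h
    exact hxy (h ▸ zero_mem _)
  refine ⟨h0, ?_⟩
  rw [mem_filtration_of_ne_zero _ h0] at hxy
  have : x + y ∈ P.filtration (P.val x) :=
    add_mem ((P.mem_filtration_of_ne_zero hx).2 le_rfl) (P.filtration_anti (by omega) hy)
  rw [mem_filtration_of_ne_zero _ h0] at this
  omega

/-- No ring lies strictly between a discrete valuation ring and its field, so the valuation rings of
distinct places are incomparable. The quotient of the two witnesses of non-inclusion has the
required signs. -/
theorem exists_val_pos_val_neg {P Q : Place K F} (h : P ≠ Q) :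
    ∃ y : F, y ≠ 0 ∧ 0 < P.val y ∧ Q.val y < 0 := by
  have key : ∀ P Q : Place K F, P ≠ Q → ∃ a : F, a ≠ 0 ∧ 0 ≤ P.val a ∧ Q.val a < 0 := by
    intro P Q h
    have hle : ¬ P.integers ≤ Q.integers := by
      intro hle
      have := ValuationSubring.eq_of_le_of_ne_top P.integers hle Q.ne_top
      apply h
      cases P
      cases Q
      simpa using this
    obtain ⟨a, haP, haQ⟩ := SetLike.not_le_iff_exists.1 hle
    rw [← mem_filtration_zero] at haP haQ
    have ha : a ≠ 0 := by rintro rfl; exact haQ (zero_mem _)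
    rw [mem_filtration_of_ne_zero _ ha] at haP haQ
    exact ⟨a, ha, haP, by omega⟩
  obtain ⟨a, ha, haP, haQ⟩ := key P Q h
  obtain ⟨c, hc, hcQ, hcP⟩ := key Q P h.symm
  refine ⟨a * c⁻¹, mul_ne_zero ha (inv_ne_zero hc), ?_, ?_⟩ <;>
  · rw [val_mul _ ha (inv_ne_zero hc), val_inv]
    omega

/-- For finitely many places `Q ≠ P` some `y` vanishes at `P` and has a pole at every `Q`. -/
theorem exists_zero_pole (S : Finset (Place K F)) (hS : P ∉ S) :
    ∃ y : F, y ≠ 0 ∧ 0 < P.val y ∧ ∀ Q ∈ S, Q.val y < 0 := by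
  classical
  induction S using Finset.induction_on with
  | empty => exact ⟨P.unif, P.unif_ne_zero, by simp, by simp⟩
  | insert Q S hQ ih =>
    rw [Finset.mem_insert, not_or] at hS
    obtain ⟨y, hy0, hyP, hyS⟩ := ih hS.2
    by_cases hyQ : Q.val y < 0
    · exact ⟨y, hy0, hyP, by simpa [hyQ] using hyS⟩
    obtain ⟨x, hx0, hxP, hxQ⟩ := exists_val_pos_val_neg hS.1
    -- With this exponent the pole of x ^ r at R is worse than that of y wherever x has a pole, so
    -- the two terms of y + x ^ r cannot cancel.
    obtain ⟨r, hr1, hr⟩ : ∃ r : ℕ, 1 ≤ r ∧ ∀ R ∈ S, R.val x < 0 → -R.val y + 1 ≤ r := by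
      refine ⟨1 + ∑ R ∈ S, (-R.val y + 1).toNat, by omega, fun R hR _ => ?_⟩
      have := Finset.single_le_sum (f := fun R : Place K F => (-R.val y + 1).toNat)
        (fun _ _ => Nat.zero_le _) hR
      omega
    have hxr : x ^ r ≠ 0 := pow_ne_zero _ hx0
    -- `y + x ^ r` works at every place whose values do not cancel
    have hQ' : y + x ^ r ≠ 0 ∧ Q.val (y + x ^ r) < 0 := by
      have h1 : Q.val (x ^ r) < 0 := by
        rw [val_pow]; exact mul_neg_of_pos_of_neg (by exact_mod_cast hr1) hxQ
      rw [add_comm]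
      have := Q.val_add_eq_left hxr (y := y) (by
        rw [mem_filtration_of_ne_zero _ hy0]; omega)
      exact ⟨this.1, by omega⟩
    refine ⟨y + x ^ r, hQ'.1, ?_, ?_⟩
    · rw [← Int.add_one_le_iff, zero_add, ← mem_filtration_of_ne_zero _ hQ'.1]
      refine add_mem ?_ ?_
      · rw [mem_filtration_of_ne_zero _ hy0]; omega
      · rw [mem_filtration_of_ne_zero _ hxr, val_pow]
        have : 0 < (r : ℤ) * P.val x := mul_pos (by exact_mod_cast hr1) hxP
        omega
    · intro R hR
      rw [Finset.mem_insert] at hR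
      rcases hR with rfl | hR
      · exact hQ'.2
      have hyR := hyS R hR
      by_cases hxR : R.val x < 0
      · have h1 : R.val (x ^ r) < R.val y := by
          rw [val_pow]
          have := hr R hR hxR
          nlinarith
        rw [add_comm]
        have := R.val_add_eq_left hxr (y := y) (by
          rw [mem_filtration_of_ne_zero _ hy0]; omega)
        omega
      · have := R.val_add_eq_left hy0 (y := x ^ r) (by
          rw [mem_filtration_of_ne_zero _ hxr, val_pow]
          have : 0 ≤ (r : ℤ) * R.val x := mul_nonneg (by omega) (by omega)
          omega)
        omega

/-- Weak approximation, in the form of approximate idempotents. -/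
theorem exists_approx_idempotent (S : Finset (Place K F)) (hS : P ∉ S) (r : ℕ) :
    ∃ e : F, e - 1 ∈ P.filtration r ∧ ∀ Q ∈ S, e ∈ Q.filtration r := by
  obtain ⟨y, hy0, hyP, hyS⟩ := P.exists_zero_pole S hS
  have hyr : y ^ (r + 1) ≠ 0 := pow_ne_zero _ hy0
  have hP : P.val (1 + y ^ (r + 1)) = 0 ∧ 1 + y ^ (r + 1) ≠ 0 := by
    have := P.val_add_eq_left (one_ne_zero (α := F)) (y := y ^ (r + 1)) (by
      rw [mem_filtration_of_ne_zero _ hyr, val_pow]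
      push_cast
      simp only [val_one]
      nlinarith)
    exact ⟨by simpa using this.2, this.1⟩
  -- Since y vanishes at P and has poles on S, this element is close to 1 at P and close to 0 on S.
  refine ⟨(1 + y ^ (r + 1))⁻¹, ?_, fun Q hQ => ?_⟩
  · have : (1 + y ^ (r + 1))⁻¹ - 1 = -(y ^ (r + 1) * (1 + y ^ (r + 1))⁻¹) := by
      field_simp [hP.2]
      ring
    rw [this, Submodule.neg_mem_iff, mem_filtration_of_ne_zero _ (mul_ne_zero hyr
      (inv_ne_zero hP.2)), val_mul _ hyr (inv_ne_zero hP.2), val_inv, hP.1, val_pow]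
    push_cast
    nlinarith
  · have h1 := hyS Q hQ
    have h2 : Q.val (y ^ (r + 1)) ≤ -(r + 1 : ℤ) := by
      rw [val_pow]
      push_cast
      nlinarith
    have := Q.val_add_eq_left hyr (y := 1) (by
      rw [mem_filtration_of_ne_zero _ one_ne_zero, val_one]
      omega)
    rw [mem_filtration_of_ne_zero _ (inv_ne_zero hP.2), val_inv, add_comm, this.2]
    omega

/-- Some `y` is close to a given `x` at `P` and close to zero at finitely many other places. -/
theorem exists_approx (S : Finset (Place K F)) (hS : P ∉ S) (x : F) (n : ℤ) :
    ∃ y : F, y - x ∈ P.filtration n ∧ ∀ Q ∈ S, y ∈ Q.filtration n := by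
  obtain ⟨r, hrP, hrS⟩ : ∃ r : ℕ, n - P.val x ≤ r ∧ ∀ Q ∈ S, n - Q.val x ≤ r := by
    refine ⟨(n - P.val x).toNat + ∑ Q ∈ S, (n - Q.val x).toNat, by omega, fun Q hQ => ?_⟩
    have := Finset.single_le_sum (f := fun R : Place K F => (n - R.val x).toNat)
        (fun _ _ => Nat.zero_le _) hQ
    omega
  by_cases hx : x = 0
  · exact ⟨0, by simp [hx], by simp⟩
  obtain ⟨e, heP, heS⟩ := P.exists_approx_idempotent S hS r
  refine ⟨x * e, ?_, fun Q hQ => ?_⟩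
  · rw [← mul_sub_one]
    exact P.filtration_anti (by omega)
      (P.mul_mem_filtration ((P.mem_filtration_of_ne_zero hx).2 le_rfl) heP)
  · have := hrS Q hQ
    exact Q.filtration_anti (by omega)
      (Q.mul_mem_filtration ((Q.mem_filtration_of_ne_zero hx).2 le_rfl) (heS Q hQ))

end Place

end FnField

end

/-! ### Zeros of a function are bounded by the degree [F : K(x)]. -/

noncomputable section

namespace FnField

open IntermediateField

section

variable {K F : Type*} [Field K] [Field F] [Algebra K F]

/-- Elements of a `K`-algebra `O ⊆ F` that are independent modulo `xO` satisfy no nontrivial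
relation over `K[x]`. -/
theorem X_pow_dvd_of_relation (O : Subalgebra K F) {x : F} (hx0 : x ≠ 0) (hx : x ∈ O)
    {ι : Type*} [Fintype ι] (v : ι → F) (hv : ∀ i, v i ∈ O)
    (hind : ∀ c : ι → K, (∃ y ∈ O, ∑ i, c i • v i = x * y) → c = 0) (n : ℕ) :
    ∀ p : ι → Polynomial K, ∑ i, Polynomial.aeval x (p i) * v i = 0 →
      ∀ i, Polynomial.X ^ n ∣ p i := by
  induction n with
  | zero => intro p _ i; simp
  | succ n ih =>
    intro p hp
    have hsum : ∑ i, (p i).coeff 0 • v i + x * ∑ i, Polynomial.aeval x (p i).divX * v i = 0 := by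
      rw [← hp, Finset.mul_sum, ← Finset.sum_add_distrib]
      refine Finset.sum_congr rfl fun i _ => ?_
      conv_rhs => rw [← Polynomial.X_mul_divX_add (p i)]
      simp only [map_add, map_mul, Polynomial.aeval_X, Polynomial.aeval_C, Algebra.smul_def]
      ring
    have h0 : (fun i => (p i).coeff 0) = 0 := by
      refine hind _ ⟨-∑ i, Polynomial.aeval x (p i).divX * v i, neg_mem (sum_mem fun i _ =>
        mul_mem ?_ (hv i)), by rw [mul_neg]; exact eq_neg_of_add_eq_zero_left hsum⟩
      exact Algebra.adjoin_le (Set.singleton_subset_iff.2 hx)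
        (Polynomial.aeval_mem_adjoin_singleton K x)
    have hX (i) : p i = Polynomial.X * (p i).divX := by
      conv_lhs => rw [← Polynomial.X_mul_divX_add (p i), show (p i).coeff 0 = 0 from congrFun h0 i]
      simp
    have h1 : ∑ i, Polynomial.aeval x (p i).divX * v i = 0 := by
      have hc : ∀ i, (p i).coeff 0 = 0 := congrFun h0
      simp only [hc, zero_smul, Finset.sum_const_zero, zero_add] at hsum
      exact (mul_eq_zero.1 hsum).resolve_left hx0
    intro i
    rw [hX i, pow_succ']
    exact mul_dvd_mul_left _ (ih _ h1 i)

/-- After clearing denominators, a relation over K(x) has coefficients in K[x]; these are divisible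
by every power of X, hence zero. -/
theorem linearIndependent_adjoin_of_independent_mod (O : Subalgebra K F) {x : F} (hx0 : x ≠ 0)
    (hx : x ∈ O) {ι : Type*} [Fintype ι] (v : ι → F) (hv : ∀ i, v i ∈ O)
    (hind : ∀ c : ι → K, (∃ y ∈ O, ∑ i, c i • v i = x * y) → c = 0) :
    LinearIndependent K⟮x⟯ v := by
  open scoped IntermediateField.algebraAdjoinAdjoin in
  rw [← LinearIndependent.iff_fractionRing (Algebra.adjoin K {x}), Fintype.linearIndependent_iff]
  intro g hg
  have hex (i) : ∃ p : Polynomial K, Polynomial.aeval x p = g i := by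
    have h := Algebra.adjoin_singleton_eq_range_aeval K x
    exact (h ▸ (g i).2 : (g i : F) ∈ (Polynomial.aeval (R := K) x).range)
  choose p hp using hex
  have hrel : ∑ i, Polynomial.aeval x (p i) * v i = 0 := by
    simp only [hp]
    exact hg
  intro i
  have hz : p i = 0 := by
    by_contra hne
    have := X_pow_dvd_of_relation O hx0 hx v hv hind ((p i).natDegree + 1) p hrel i
    have := Polynomial.natDegree_le_of_dvd this hne
    simp at this
  apply Subtype.ext
  rw [← hp i, hz]
  simp

variable [Algebra (RatFunc K) F] [IsScalarTower K (RatFunc K) F] [FunctionField K F]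

/-- This builds as many functions as the degree of the divisor M, independent modulo functions
vanishing to the orders prescribed by M. Each further copy of Q contributes deg Q functions whose
leading coefficients at Q form a basis of the residue field. -/
theorem exists_independent_family (S : Finset (Place K F)) (M : Multiset (Place K F))
    (hM : ∀ Q ∈ M, Q ∈ S) :
    ∃ (ι : Type) (_ : Fintype ι) (v : ι → F),
      open scoped Classical in
      Fintype.card ι = (M.map Place.degree).sum ∧ (∀ i, ∀ Q ∈ S, v i ∈ Q.filtration 0) ∧
      ∀ c : ι → K, (∀ Q ∈ S, ∑ i, c i • v i ∈ Q.filtration (M.count Q)) → c = 0 := by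
  classical
  induction M using Multiset.induction_on with
  | empty => exact ⟨Empty, inferInstance, Empty.elim, by simp, by simp, fun c _ => funext (by simp)⟩
  | cons Q M ih =>
    obtain ⟨ι, hι, v, hcard, hv, hind⟩ := ih fun R hR => hM R (Multiset.mem_cons_of_mem hR)
    let β := Module.finBasis K (IsLocalRing.ResidueField Q.integers)
    have hy (j) : ∃ y : F, (∃ h : y ∈ Q.filtration (M.count Q), Q.lead (M.count Q) ⟨y, h⟩ = β j) ∧
        ∀ R ∈ S, R ≠ Q → y ∈ R.filtration (M.card + 1) := by
      obtain ⟨x, hx⟩ := Q.lead_surjective (M.count Q) (β j)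
      -- The precision `M.card + 1` exceeds every multiplicity in M, so one bound serves all places.
      obtain ⟨y, hyQ, hyS⟩ := Q.exists_approx (S.erase Q) (S.notMem_erase Q) x (M.card + 1)
      have hle := M.count_le_card Q
      have h1 : y - x ∈ Q.filtration (M.count Q + 1) := Q.filtration_anti (by omega) hyQ
      have h2 : y ∈ Q.filtration (M.count Q) := by
        have := add_mem (Q.filtration_anti (show (M.count Q : ℤ) ≤ M.count Q + 1 by omega) h1) x.2
        rwa [sub_add_cancel] at this
      refine ⟨y, ⟨h2, ?_⟩, fun R hR hRQ => hyS R (Finset.mem_erase.2 ⟨hRQ, hR⟩)⟩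
      rw [← hx, ← sub_eq_zero, ← map_sub, Place.lead_eq_zero_iff]
      exact h1
    choose y hyQ hyS using hy
    choose hyQ hβ using hyQ
    refine ⟨ι ⊕ Fin _, inferInstance, Sum.elim v y, ?_, ?_, ?_⟩
    · simp [hcard, Place.degree, add_comm]
    · rintro (i | j) R hR
      · exact hv i R hR
      · by_cases hRQ : R = Q
        · subst hRQ
          exact R.filtration_anti (by omega) (hyQ j)
        · exact R.filtration_anti (by omega) (hyS j R hR hRQ)
    · intro c hc
      simp only [Fintype.sum_sum_type, Sum.elim_inl, Sum.elim_inr] at hc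
      have hyM : ∀ j, ∀ R ∈ S, y j ∈ R.filtration (M.count R) := fun j R hR => by
        by_cases hRQ : R = Q
        · subst hRQ
          exact hyQ j
        · have := M.count_le_card R
          exact R.filtration_anti (by omega) (hyS j R hR hRQ)
      -- The new functions already satisfy the conditions of M, so these conditions test only the
      -- old part of the combination.
      have h1 : (fun i => c (Sum.inl i)) = 0 := by
        refine hind _ fun R hR => ?_
        have h := hc R hR
        have h' : ∑ j, c (Sum.inr j) • y j ∈ R.filtration (M.count R) :=
          sum_mem fun j _ => Submodule.smul_mem _ _ (hyM j R hR)
        have := sub_mem (R.filtration_anti (by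
          exact_mod_cast Multiset.count_le_of_le R (Multiset.le_cons_self M Q)) h) h'
        rwa [add_sub_cancel_right] at this
      have h1' : ∀ i, c (Sum.inl i) = 0 := congrFun h1
      have h := hc Q (hM Q (Multiset.mem_cons_self Q M))
      simp only [h1', zero_smul, Finset.sum_const_zero, zero_add, Multiset.count_cons_self] at h
      have h2 : ∑ j, c (Sum.inr j) • β j = 0 := by
        simp only [← hβ, ← map_smul, ← map_sum]
        rw [Place.lead_eq_zero_iff]
        push_cast at h ⊢
        exact h
      have h3 := Fintype.linearIndependent_iff.1 β.linearIndependent _ h2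
      funext i
      rcases i with i | j
      · exact h1' i
      · exact h3 j

theorem transcendental_of_val_ne_zero (P : Place K F) {x : F} (hx : P.val x ≠ 0) :
    Transcendental K x := by
  have key : ∀ x : F, 0 < P.val x → Transcendental K x := fun x hx => by
    have hx0 : x ≠ 0 := by rintro rfl; simp [Place.val] at hx
    have hxP : x ∈ P.integers :=
      P.mem_filtration_zero.1 ((P.mem_filtration_of_ne_zero hx0).2 hx.le)
    refine P.transcendental_of_not_isUnit (y := ⟨x, hxP⟩) (by simpa [Subtype.ext_iff] using hx0) ?_
    rw [← mem_nonunits_iff, ← IsLocalRing.mem_maximalIdeal, ← P.mem_filtration_one,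
      P.mem_filtration_of_ne_zero hx0]
    omega
  rcases lt_or_gt_of_ne hx with h | h
  · have := key x⁻¹ (by simpa using h)
    intro hal
    exact this hal.inv
  · exact key x h

/-- The zeros of `x`, counted with multiplicity and degree, are at most `[F : K(x)]` many. -/
theorem sum_zeros_le_finrank {x : F} (S : Finset (Place K F)) (hS : ∀ Q ∈ S, 0 < Q.val x) :
    ∑ Q ∈ S, Q.val x * Q.degree ≤ Module.finrank K⟮x⟯ F := by
  classical
  rcases S.eq_empty_or_nonempty with rfl | ⟨Q₀, hQ₀⟩
  · simp
  have hx0 : x ≠ 0 := by rintro rfl; simpa [Place.val] using hS Q₀ hQ₀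
  have htr := transcendental_of_val_ne_zero Q₀ (hS Q₀ hQ₀).ne'
  -- Each zero is repeated according to its order, so elements of xO satisfy all conditions of M,
  -- where O is the intersection of the valuation rings over S.
  let M : Multiset (Place K F) := ∑ Q ∈ S, (Q.val x).toNat • {Q}
  have hcount : ∀ Q ∈ S, (M.count Q : ℤ) = Q.val x := fun Q hQ => by
    have : M.count Q = (Q.val x).toNat := by
      simp only [M, Multiset.count_sum', Multiset.count_nsmul, Multiset.count_singleton, mul_ite,
        mul_one, mul_zero]
      rw [Finset.sum_ite_eq S Q, if_pos hQ]
    rw [this, Int.toNat_of_nonneg (hS Q hQ).le]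
  obtain ⟨ι, hι, v, hcard, hv, hind⟩ := exists_independent_family S M (fun Q hQ => by
    obtain ⟨R, hR, hQR⟩ := Multiset.mem_sum.1 hQ
    have := Multiset.mem_of_mem_nsmul hQR
    rw [Multiset.mem_singleton] at this
    exact this ▸ hR)
  let O : Subalgebra K F :=
    { carrier := {y | ∀ Q ∈ S, y ∈ Q.integers}
      mul_mem' := fun ha hb Q hQ => mul_mem (ha Q hQ) (hb Q hQ)
      add_mem' := fun ha hb Q hQ => add_mem (ha Q hQ) (hb Q hQ)
      algebraMap_mem' := fun c Q _ => Q.algebraMap_mem c }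
  have hO : ∀ y, y ∈ O ↔ ∀ Q ∈ S, y ∈ Q.filtration 0 := fun y =>
    forall₂_congr fun Q _ => Q.mem_filtration_zero.symm
  have hli := linearIndependent_adjoin_of_independent_mod O hx0
    ((hO x).2 fun Q hQ => (Q.mem_filtration_of_ne_zero hx0).2 (hS Q hQ).le) v
    (fun i => (hO _).2 (hv i)) (fun c ⟨y, hy, hcy⟩ => hind c fun Q hQ => by
      rw [hcy]
      convert! Q.mul_mem_filtration ((Q.mem_filtration_of_ne_zero hx0).2 le_rfl)
        ((hO y).1 hy Q hQ) using 2
      rw [hcount Q hQ, add_zero])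
  have := Place.finite_adjoin htr
  have hle := hli.fintype_card_le_finrank
  rw [hcard] at hle
  have hM : ((M.map Place.degree).sum : ℤ) = ∑ Q ∈ S, Q.val x * Q.degree := by
    have h := map_sum ((Multiset.sumAddMonoidHom : Multiset ℕ →+ ℕ).comp
      (Multiset.mapAddMonoidHom (Place.degree (K := K) (F := F)))) (fun Q => (Q.val x).toNat • {Q}) S
    simp only [AddMonoidHom.comp_apply, map_nsmul, Multiset.coe_sumAddMonoidHom,
      Multiset.coe_mapAddMonoidHom, Multiset.map_singleton, Multiset.sum_singleton,
      smul_eq_mul] at h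
    rw [h]
    push_cast
    refine Finset.sum_congr rfl fun Q hQ => ?_
    rw [Int.toNat_of_nonneg (hS Q hQ).le]
  rw [← hM]
  exact_mod_cast hle

theorem finite_setOf_val_pos (x : F) : {Q : Place K F | 0 < Q.val x}.Finite := by
  by_contra h
  obtain ⟨S, hS, hcard⟩ := Set.Infinite.exists_subset_card_eq h (Module.finrank K⟮x⟯ F + 1)
  have h1 := sum_zeros_le_finrank S (fun Q hQ => hS hQ)
  have h2 : (S.card : ℤ) ≤ ∑ Q ∈ S, Q.val x * Q.degree := by
    rw [Finset.card_eq_sum_ones]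
    push_cast
    refine Finset.sum_le_sum fun Q hQ => ?_
    have h3 : 0 < Q.val x := hS hQ
    have h4 := Q.degree_pos
    nlinarith
  omega

theorem finite_support_val (x : F) : {Q : Place K F | Q.val x ≠ 0}.Finite := by
  refine ((finite_setOf_val_pos x).union (finite_setOf_val_pos x⁻¹)).subset fun Q hQ => ?_
  have hQ' : Q.val x ≠ 0 := hQ
  simp only [Set.mem_union, Set.mem_ofPred_eq, Place.val_inv]
  omega

variable (K) in
/-- The principal divisor of `x` (zero for `x = 0`). -/
def principal (x : F) : Divisor K F :=
  Finsupp.ofSupportFinite (fun Q => Q.val x) (finite_support_val x)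

@[simp] theorem principal_apply (x : F) (Q : Place K F) : principal K x Q = Q.val x := rfl

end

end FnField

end

/-! ### Dimension bounds for L(D) and the degree of a principal divisor. -/

noncomputable section

namespace FnField

open IntermediateField

variable {K F : Type*} [Field K] [Field F] [Algebra K F]

theorem Divisor.degree_add (D E : Divisor K F) : (D + E).degree = D.degree + E.degree :=
  Finsupp.sum_add_index' (by simp) (by intros; ring)

/-- The degree map as a group homomorphism. -/
def Divisor.degreeHom : Divisor K F →+ ℤ where
  toFun := Divisor.degree
  map_zero' := Finsupp.sum_zero_index
  map_add' := Divisor.degree_add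

@[simp] theorem Divisor.degree_zero : (0 : Divisor K F).degree = 0 := Finsupp.sum_zero_index

theorem Divisor.degree_sub (D E : Divisor K F) : (D - E).degree = D.degree - E.degree :=
  map_sub Divisor.degreeHom D E

theorem Divisor.degree_nsmul (n : ℕ) (D : Divisor K F) : (n • D).degree = n * D.degree := by
  rw [← nsmul_eq_mul]
  exact map_nsmul Divisor.degreeHom n D

theorem Divisor.degree_single (P : Place K F) (n : ℤ) :
    Divisor.degree (Finsupp.single P n) = n * P.degree :=
  Finsupp.sum_single_index (by simp)

variable [Algebra (RatFunc K) F] [IsScalarTower K (RatFunc K) F] [FunctionField K F]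

theorem mem_riemannRochSpace {D : Divisor K F} {y : F} :
    y ∈ riemannRochSpace D ↔ ∀ P : Place K F, y ∈ P.filtration (-D P) := Iff.rfl

theorem riemannRochSpace_mono {D E : Divisor K F} (h : D ≤ E) :
    riemannRochSpace D ≤ riemannRochSpace E := fun _ hy P =>
  P.filtration_anti (neg_le_neg (h P)) (hy P)

theorem mul_mem_riemannRochSpace {D E : Divisor K F} {x y : F} (hx : x ∈ riemannRochSpace D)
    (hy : y ∈ riemannRochSpace E) : x * y ∈ riemannRochSpace (D + E) := fun P =>
  P.filtration_anti (by rw [Finsupp.add_apply]; omega) (P.mul_mem_filtration (hx P) (hy P))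

theorem mem_riemannRochSpace_of_ne_zero {D : Divisor K F} {y : F} (hy : y ≠ 0) :
    y ∈ riemannRochSpace D ↔ 0 ≤ D + principal K y := by
  rw [mem_riemannRochSpace]
  refine forall_congr' fun P => ?_
  rw [P.mem_filtration_of_ne_zero hy]
  simp only [Finsupp.coe_zero, Pi.zero_apply, Finsupp.coe_add, Pi.add_apply, principal_apply]
  omega

theorem pow_mem_riemannRochSpace {D : Divisor K F} {x : F} (hx : x ∈ riemannRochSpace D) (n : ℕ) :
    x ^ n ∈ riemannRochSpace (n • D) := fun P => by
  refine P.filtration_anti ?_ (P.pow_mem_filtration (hx P) n)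
  simp

/-- Passing to the next step of the filtration at `P` costs at most `deg P` dimensions. -/
theorem finrank_le_of_filtration (P : Place K F) (n : ℤ) {V W : Submodule K F}
    (hW : W ≤ P.filtration n) (hV : V = W ⊓ P.filtration (n + 1)) [Module.Finite K V] :
    Module.Finite K W ∧ Module.finrank K W ≤ Module.finrank K V + P.degree := by
  let f : W →ₗ[K] IsLocalRing.ResidueField P.integers := P.lead n ∘ₗ Submodule.inclusion hW
  have hker : LinearMap.ker f = V.submoduleOf W := by
    ext ⟨x, hx⟩
    rw [LinearMap.mem_ker, LinearMap.comp_apply, Place.lead_eq_zero_iff, hV]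
    simp [Submodule.submoduleOf]
  have hVW : V ≤ W := hV.le.trans inf_le_left
  have e := Submodule.submoduleOfEquivOfLe hVW
  have hfk : Module.Finite K (LinearMap.ker f) := by
    rw [hker]
    exact Module.Finite.equiv e.symm
  have hfin : Module.Finite K W := by
    refine ⟨Submodule.fg_of_fg_map_of_fg_inf_ker f (IsNoetherian.noetherian _) ?_⟩
    rw [top_inf_eq]
    exact (Module.Finite.iff_fg).1 hfk
  refine ⟨hfin, ?_⟩
  have h1 := LinearMap.finrank_range_add_finrank_ker f
  have h2 : Module.finrank K (LinearMap.range f) ≤ P.degree := Submodule.finrank_le _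
  rw [hker, e.finrank_eq] at h1
  omega

theorem finrank_add_single_le (D : Divisor K F) (P : Place K F) (n : ℕ)
    [Module.Finite K (riemannRochSpace D)] :
    Module.Finite K (riemannRochSpace (D + Finsupp.single P (n : ℤ))) ∧
    Module.finrank K (riemannRochSpace (D + Finsupp.single P (n : ℤ))) ≤
      Module.finrank K (riemannRochSpace D) + n * P.degree := by
  classical
  induction n with
  | zero =>
    rw [Nat.cast_zero, Finsupp.single_zero, add_zero]
    exact ⟨inferInstance, by simp⟩
  | succ n ih =>
    obtain ⟨hfin, hle⟩ := ih
    have h := finrank_le_of_filtration P (-(D P + n + 1))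
      (V := riemannRochSpace (D + Finsupp.single P (n : ℤ)))
      (W := riemannRochSpace (D + Finsupp.single P ((n + 1 : ℕ) : ℤ)))
      (fun x hx => by
        refine P.filtration_anti ?_ (hx P)
        simp
        omega) (by
        ext x
        rw [Submodule.mem_inf, mem_riemannRochSpace, mem_riemannRochSpace]
        constructor
        · intro h
          refine ⟨fun Q => Q.filtration_anti ?_ (h Q), P.filtration_anti ?_ (h P)⟩
          · simp only [Finsupp.add_apply, Finsupp.single_apply]
            split_ifs <;> push_cast <;> omega
          · simp
        · rintro ⟨h, hP⟩ Q
          by_cases hQ : P = Q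
          · subst hQ
            refine P.filtration_anti ?_ hP
            simp
          · have := h Q
            simpa [Finsupp.single_apply, hQ] using this)
    refine ⟨h.1, h.2.trans ?_⟩
    rw [add_mul]
    omega

/-- Enlarging a divisor by `E ≥ 0` enlarges the dimension by at most `deg E`. -/
theorem finrank_add_le (E : Divisor K F) (hE : 0 ≤ E) (D : Divisor K F)
    [Module.Finite K (riemannRochSpace D)] :
    Module.Finite K (riemannRochSpace (D + E)) ∧
    (Module.finrank K (riemannRochSpace (D + E)) : ℤ) ≤
      Module.finrank K (riemannRochSpace D) + E.degree := by
  classical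
  induction E using Finsupp.induction with
  | zero =>
    rw [add_zero]
    exact ⟨inferInstance, by simp⟩
  | single_add P n E hP hn ih =>
    have hEP : E P = 0 := Finsupp.notMem_support_iff.1 hP
    have hn0 : 0 ≤ n := by simpa [hEP] using hE P
    have hE0 : 0 ≤ E := fun Q => by
      by_cases hQ : P = Q
      · subst hQ
        simp [hEP]
      · simpa [Finsupp.single_apply, hQ] using hE Q
    obtain ⟨h1, h2⟩ := ih hE0
    obtain ⟨k, rfl⟩ := Int.eq_ofNat_of_zero_le hn0
    have := finrank_add_single_le (D + E) P k
    rw [add_assoc, add_comm E] at this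
    refine ⟨this.1, ?_⟩
    rw [Divisor.degree_add, Divisor.degree_single]
    have h3 := this.2
    zify at h3
    linarith

theorem finite_riemannRochSpace [Module.Finite K (riemannRochSpace (0 : Divisor K F))]
    (D : Divisor K F) : Module.Finite K (riemannRochSpace D) := by
  have h := (finrank_add_le (D ⊔ 0) le_sup_right 0).1
  rw [zero_add] at h
  have hle : riemannRochSpace D ≤ riemannRochSpace (D ⊔ 0) := riemannRochSpace_mono le_sup_left
  exact Module.Finite.of_injective (Submodule.inclusion hle) (Submodule.inclusion_injective hle)

theorem finrank_le_add_degree_sub [Module.Finite K (riemannRochSpace (0 : Divisor K F))]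
    {D E : Divisor K F} (h : D ≤ E) :
    (Module.finrank K (riemannRochSpace E) : ℤ) ≤
      Module.finrank K (riemannRochSpace D) + (E.degree - D.degree) := by
  have := finite_riemannRochSpace D
  have := (finrank_add_le (E - D) (sub_nonneg.2 h) D).2
  rwa [add_sub_cancel, Divisor.degree_sub] at this

theorem degree_zeros_le (x : F) :
    (principal K x ⊔ 0).degree ≤ Module.finrank K⟮x⟯ F := by
  have hS : ∀ Q ∈ (principal K x ⊔ 0 : Divisor K F).support, 0 < Q.val x := fun Q hQ => by
    rw [Finsupp.mem_support_iff, Finsupp.sup_apply, principal_apply] at hQ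
    by_contra h
    exact hQ (sup_eq_right.2 (not_lt.1 h))
  refine le_trans (le_of_eq ?_) (sum_zeros_le_finrank _ hS)
  refine Finset.sum_congr rfl fun Q hQ => ?_
  rw [Finsupp.sup_apply, principal_apply, Finsupp.coe_zero, Pi.zero_apply,
    sup_eq_left.2 (hS Q hQ).le]

theorem mem_riemannRochSpace_poles (x : F) : x ∈ riemannRochSpace (principal K x⁻¹ ⊔ 0) := by
  by_cases hx : x = 0
  · rw [hx]
    exact zero_mem _
  intro P
  rw [← Place.mem_filtration, P.mem_filtration_of_ne_zero hx, Finsupp.sup_apply, principal_apply,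
    Place.val_inv]
  have : -P.val x ≤ -P.val x ⊔ (0 : Divisor K F) P := le_sup_left
  omega

/-- For a basis u_i of F over K(x), the n(l+1) products x^j u_i with j ≤ l are independent over K
and lie in L(lD + C), where D is the pole divisor of x and C bounds the poles of the u_i. That
dimension grows at most like l deg D, which forces n ≤ deg D. -/
theorem le_degree_poles [Module.Finite K (riemannRochSpace (0 : Divisor K F))] {x : F}
    (hx : Transcendental K x) :
    (Module.finrank K⟮x⟯ F : ℤ) ≤ (principal K x⁻¹ ⊔ 0).degree := by
  have := Place.finite_adjoin hx
  set n := Module.finrank K⟮x⟯ F with hn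
  let u := Module.finBasis K⟮x⟯ F
  let C : Divisor K F := ∑ i, (principal K (u i)⁻¹ ⊔ 0)
  let D : Divisor K F := principal K x⁻¹ ⊔ 0
  have hC : 0 ≤ C := Finset.sum_nonneg fun i _ => le_sup_right
  have hD : 0 ≤ D := le_sup_right
  have huC : ∀ i, u i ∈ riemannRochSpace C := fun i =>
    riemannRochSpace_mono (Finset.single_le_sum (f := fun i => (principal K (u i)⁻¹ ⊔ 0))
      (fun i _ => le_sup_right) (Finset.mem_univ i)) (mem_riemannRochSpace_poles (u i))
  let X : K⟮x⟯ := ⟨x, mem_adjoin_simple_self K x⟩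
  have hX : Transcendental K X := by
    intro h
    exact hx (h.algebraMap (A := F))
  have hpow : LinearIndependent K (fun j : ℕ => X ^ j) := by
    rw [transcendental_iff_injective] at hX
    have := (Polynomial.basisMonomials K).linearIndependent.map'
      (Polynomial.aeval X).toLinearMap (LinearMap.ker_eq_bot.2 hX)
    convert! this using 2 with j
    simp
  have hli := linearIndependent_smul hpow u.linearIndependent
  have key : ∀ l : ℕ, (n : ℤ) * (l + 1) ≤
      l * D.degree + C.degree + Module.finrank K (riemannRochSpace (0 : Divisor K F)) := by
    intro l
    have hfin := finite_riemannRochSpace (l • D + C)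
    let v : Fin (l + 1) × Fin n → riemannRochSpace (l • D + C) := fun p =>
      ⟨X ^ (p.1 : ℕ) • u p.2, by
        have h1 : x ^ (p.1 : ℕ) ∈ riemannRochSpace (l • D) :=
          riemannRochSpace_mono (nsmul_le_nsmul_left hD (by omega))
            (pow_mem_riemannRochSpace (mem_riemannRochSpace_poles x) p.1)
        exact mul_mem_riemannRochSpace h1 (huC p.2)⟩
    have hv : LinearIndependent K v := by
      refine LinearIndependent.of_comp (riemannRochSpace (l • D + C)).subtype ?_
      refine hli.comp (fun p : Fin (l + 1) × Fin n => ((p.1 : ℕ), p.2)) ?_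
      rintro ⟨a, b⟩ ⟨c, d⟩ h
      simpa [Fin.ext_iff] using h
    have h1 := hv.fintype_card_le_finrank
    have h2 := finrank_le_add_degree_sub (D := 0) (E := l • D + C)
      (add_nonneg (nsmul_nonneg hD l) hC)
    rw [Divisor.degree_add, Divisor.degree_nsmul, Divisor.degree_zero] at h2
    simp only [Fintype.card_prod, Fintype.card_fin] at h1
    zify at h1
    linarith
  by_contra hlt
  push Not at hlt
  -- Taking l at least the constant term of the estimate contradicts n ≥ deg D + 1.
  have h := key (C.degree + Module.finrank K (riemannRochSpace (0 : Divisor K F))).toNat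
  have h2 := Int.self_le_toNat (C.degree + Module.finrank K (riemannRochSpace (0 : Divisor K F)))
  set l : ℤ := ((C.degree + Module.finrank K (riemannRochSpace (0 : Divisor K F))).toNat : ℤ)
  have hl : 0 ≤ l := Int.natCast_nonneg _
  have h3 : 0 ≤ D.degree := Finsupp.sum_nonneg fun Q _ => mul_nonneg (hD Q) (by positivity)
  change D.degree < n at hlt
  nlinarith

/-- A principal divisor has degree zero. -/
theorem degree_principal [Module.Finite K (riemannRochSpace (0 : Divisor K F))] (x : F) :
    (principal K x).degree = 0 := by
  by_cases hx : Transcendental K x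
  · have hx' : Transcendental K x⁻¹ := fun h => hx (by simpa using h.inv)
    -- As x and x⁻¹ generate the same field, the zero and pole divisors both have degree [F : K(x)].
    have hadj : K⟮x⁻¹⟯ = K⟮x⟯ := by
      apply le_antisymm <;> rw [adjoin_simple_le_iff]
      · exact inv_mem (mem_adjoin_simple_self K x)
      · simpa using inv_mem (mem_adjoin_simple_self K x⁻¹)
    have h1 := degree_zeros_le (K := K) x
    have h2 := le_degree_poles hx
    have h3 := degree_zeros_le (K := K) x⁻¹
    have h4 := le_degree_poles hx'
    rw [hadj] at h3 h4
    rw [inv_inv] at h4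
    have h5 : principal K x = (principal K x ⊔ 0) - (principal K x⁻¹ ⊔ 0) := by
      ext Q
      simp only [principal_apply, Finsupp.sub_apply, Finsupp.sup_apply, Place.val_inv,
        Finsupp.coe_zero, Pi.zero_apply]
      omega
    rw [h5, Divisor.degree_sub]
    omega
  · have h : principal K x = (0 : Divisor K F) := by
      ext Q
      by_contra hQ
      exact hx (transcendental_of_val_ne_zero Q hQ)
    rw [h, Divisor.degree_zero]

end FnField

end

/-! ### Riemann's theorem from the dimensions of L(G + nP), and its consequences. -/

noncomputable section

namespace FnField

variable {K F : Type*} [Field K] [Field F] [Algebra K F]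
  [Algebra (RatFunc K) F] [IsScalarTower K (RatFunc K) F] [FunctionField K F]

theorem riemannRochSpace_inf (D E : Divisor K F) :
    riemannRochSpace (D ⊓ E) = riemannRochSpace D ⊓ riemannRochSpace E := by
  refine le_antisymm (le_inf (riemannRochSpace_mono inf_le_left)
    (riemannRochSpace_mono inf_le_right)) fun x hx P => ?_
  rw [Finsupp.inf_apply]
  rcases le_total (D P) (E P) with h | h
  · rw [inf_eq_left.2 h]
    exact hx.1 P
  · rw [inf_eq_right.2 h]
    exact hx.2 P

theorem finrank_add_principal (D : Divisor K F) {f : F} (hf : f ≠ 0) :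
    Module.finrank K (riemannRochSpace (D + principal K f)) =
      Module.finrank K (riemannRochSpace D) := by
  have hmem : ∀ (D : Divisor K F) (f : F), f ≠ 0 → ∀ x ∈ riemannRochSpace D,
      f * x ∈ riemannRochSpace (D - principal K f) := fun D f hf x hx P =>
    P.filtration_anti (by rw [Finsupp.sub_apply, principal_apply]; omega)
      (P.mul_mem_filtration ((P.mem_filtration_of_ne_zero hf).2 le_rfl) (hx P))
  have hinv : principal K f⁻¹ = -principal K f := by ext; simp
  refine LinearEquiv.finrank_eq
    { toFun := fun x => ⟨f * x, ?_⟩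
      invFun := fun x => ⟨f⁻¹ * x, ?_⟩
      map_add' := fun x y => Subtype.ext (by simp [mul_add])
      map_smul' := fun c x => Subtype.ext (by simp)
      left_inv := fun x => Subtype.ext (by simp [hf])
      right_inv := fun x => Subtype.ext (by simp [hf]) }
  · have := hmem _ f hf x x.2
    rwa [add_sub_cancel_right] at this
  · have := hmem _ f⁻¹ (inv_ne_zero hf) x x.2
    rwa [hinv, sub_neg_eq_add] at this

section RiemannTheorem

variable [Module.Finite K (riemannRochSpace (0 : Divisor K F))] {g : ℕ} {G : Divisor K F}
  (hG : G.degree = 2 * (g : ℤ)) (P : Place K F)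
  (hdim : ∀ n : ℕ, Module.finrank K (riemannRochSpace (G + Finsupp.single P (n : ℤ))) =
    g + 1 + n * P.degree)

include hG hdim

/-- Riemann's inequality, for a function field in which `L(G + nP)` has the expected dimension. -/
theorem degree_add_one_le_finrank_add (D : Divisor K F) :
    D.degree + 1 ≤ Module.finrank K (riemannRochSpace D) + (g : ℤ) := by
  have hD : 0 ≤ (D ⊔ 0).degree :=
    Finsupp.sum_nonneg fun Q _ => mul_nonneg ((le_sup_right : (0 : Divisor K F) ≤ D ⊔ 0) Q)
      (by positivity)
  obtain ⟨n, hn⟩ := Int.eq_ofNat_of_zero_le hD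
  -- With n the degree of D ⊔ 0, the space L(E − (D ⊔ 0)) is nonzero. An f in it gives D ≤ E + (f),
  -- and the dimension of L(E) is known.
  set E : Divisor K F := G + Finsupp.single P (n : ℤ) with hE
  have hEdeg : E.degree = 2 * g + n * P.degree := by
    rw [hE, Divisor.degree_add, hG, Divisor.degree_single]
  have h1 := finrank_le_add_degree_sub (D := E - (D ⊔ 0)) (E := E) (sub_le_self _ le_sup_right)
  rw [hdim n, Divisor.degree_sub, hn] at h1
  push_cast at h1
  have hpos : 0 < Module.finrank K (riemannRochSpace (E - (D ⊔ 0))) := by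
    have := P.degree_pos
    have : (n : ℤ) ≤ n * P.degree := by nlinarith
    omega
  have := finite_riemannRochSpace (E - (D ⊔ 0))
  obtain ⟨⟨f, hf⟩, hf0⟩ := Module.finrank_pos_iff_exists_ne_zero.1 hpos
  have hf0' : f ≠ 0 := by simpa [Subtype.ext_iff] using hf0
  rw [mem_riemannRochSpace_of_ne_zero hf0'] at hf
  have hle : D ≤ E + principal K f := by
    refine le_trans (le_sup_left (b := 0)) ?_
    rw [← sub_nonneg, add_sub_right_comm]
    exact hf
  have h2 := finrank_le_add_degree_sub hle
  rw [finrank_add_principal _ hf0', Divisor.degree_add, degree_principal, hEdeg, hdim n] at h2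
  push_cast at h2
  omega

/-- Riemann's theorem: the dimension of `L(D)` for divisors of large degree. -/
theorem finrank_add_eq_degree_add_one {D : Divisor K F} (hD : 3 * (g : ℤ) ≤ D.degree) :
    Module.finrank K (riemannRochSpace D) + (g : ℤ) = D.degree + 1 := by
  refine le_antisymm ?_ (degree_add_one_le_finrank_add hG P hdim D)
  -- The inequality for D − G yields f ≠ 0 with G ≤ D + (f); then dim L(G) = g + 1 bounds dim L(D)
  -- from above.
  have h1 := degree_add_one_le_finrank_add hG P hdim (D - G)
  rw [Divisor.degree_sub, hG] at h1
  have hpos : 0 < Module.finrank K (riemannRochSpace (D - G)) := by omega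
  have := finite_riemannRochSpace (D - G)
  obtain ⟨⟨f, hf⟩, hf0⟩ := Module.finrank_pos_iff_exists_ne_zero.1 hpos
  have hf0' : f ≠ 0 := by simpa [Subtype.ext_iff] using hf0
  rw [mem_riemannRochSpace_of_ne_zero hf0'] at hf
  have hle : G ≤ D + principal K f := by
    rw [← sub_nonneg, add_sub_right_comm]
    exact hf
  have h2 := finrank_le_add_degree_sub hle
  have h3 := hdim 0
  rw [Nat.cast_zero, Finsupp.single_zero, add_zero, zero_mul, add_zero] at h3
  rw [finrank_add_principal _ hf0', Divisor.degree_add, degree_principal, hG, h3] at h2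
  push_cast at h2
  omega

/-- There are functions regular outside `G` and `P` with prescribed order at another place. -/
theorem exists_mem_val_eq {Q : Place K F} (hQP : P ≠ Q) (hQG : G Q = 0) (r : ℕ) :
    ∃ (n : ℕ) (f : F), f ∈ riemannRochSpace (G + Finsupp.single P (n : ℤ)) ∧ f ≠ 0 ∧
      Q.val f = r := by
  classical
  -- This keeps the degrees of G + nP − rQ and G + nP − (r+1)Q at least 3g, so both dimensions are
  -- known and differ by deg Q. Any f in the difference has order exactly r at Q.
  set n : ℕ := g + (r + 1) * Q.degree with hn
  have hnP : (n : ℤ) ≤ n * P.degree := by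
    have := P.degree_pos
    nlinarith
  let D (k : ℕ) : Divisor K F := G + Finsupp.single P (n : ℤ) - Finsupp.single Q (k : ℤ)
  have hdeg : ∀ k, (D k).degree = 2 * g + n * P.degree - k * Q.degree := fun k => by
    simp only [D, Divisor.degree_sub, Divisor.degree_add, Divisor.degree_single, hG]
  have h1 := finrank_add_eq_degree_add_one hG P hdim (D := D r) (by
    rw [hdeg, hn] at *
    push_cast at *
    nlinarith [Q.degree_pos])
  have h2 := finrank_add_eq_degree_add_one hG P hdim (D := D (r + 1)) (by
    rw [hdeg, hn] at *
    push_cast at *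
    nlinarith [Q.degree_pos])
  rw [hdeg] at h1 h2
  have hlt : ¬ riemannRochSpace (D r) ≤ riemannRochSpace (D (r + 1)) := by
    intro hle
    have := finite_riemannRochSpace (D (r + 1))
    have := Submodule.finrank_mono hle
    push_cast at h2
    have := Q.degree_pos
    nlinarith
  obtain ⟨f, hf, hf'⟩ := SetLike.not_le_iff_exists.1 hlt
  have hf0 : f ≠ 0 := by rintro rfl; exact hf' (zero_mem _)
  have hDQ : ∀ k, D k Q = -(k : ℤ) := fun k => by
    simp [D, hQG, hQP]
  have hDR : ∀ k, ∀ R ≠ Q, D k R = (G + Finsupp.single P (n : ℤ)) R := fun k R hR => by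
    simp [D, Finsupp.single_apply, hR.symm]
  refine ⟨n, f, ?_, hf0, ?_⟩
  · exact riemannRochSpace_mono (sub_le_self _ (by simp)) hf
  · have h3 := hf Q
    rw [← Place.mem_filtration, Q.mem_filtration_of_ne_zero hf0, hDQ] at h3
    by_contra hne
    refine hf' fun R => ?_
    by_cases hR : R = Q
    · subst hR
      rw [← Place.mem_filtration, R.mem_filtration_of_ne_zero hf0, hDQ]
      push_cast
      omega
    · rw [hDR _ R hR, ← hDR r R hR]
      exact hf R

/-- Modulo `L(G + nP)`, every element of `L(G + (n+1)P)` has a zero of large order at `Q`. -/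
theorem exists_sub_mem_of_mem {Q : Place K F} (hQP : P ≠ Q) (n M : ℕ)
    (hM : M * Q.degree + g ≤ n * P.degree) {x : F}
    (hx : x ∈ riemannRochSpace (G + Finsupp.single P ((n + 1 : ℕ) : ℤ))) :
    ∃ f : F, f ∈ riemannRochSpace (G + Finsupp.single P ((n + 1 : ℕ) : ℤ) -
      Finsupp.single Q (M : ℤ)) ∧ x - f ∈ riemannRochSpace (G + Finsupp.single P (n : ℤ)) := by
  classical
  zify at hM
  set D := G + Finsupp.single P (n : ℤ) with hD
  set D' := G + Finsupp.single P ((n + 1 : ℕ) : ℤ) with hD'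
  set A := Finsupp.single Q (M : ℤ) with hA
  have hDD' : D ≤ D' := by
    rw [hD, hD']
    gcongr
    omega
  have hA0 : 0 ≤ A := by simp [hA]
  have hdeg : (D - A).degree = 2 * g + n * P.degree - M * Q.degree := by
    simp only [D, A, Divisor.degree_sub, Divisor.degree_add, Divisor.degree_single, hG]
  have hdeg' : (D' - A).degree = 2 * g + (n + 1) * P.degree - M * Q.degree := by
    simp only [D', A, Divisor.degree_sub, Divisor.degree_add, Divisor.degree_single, hG]
    push_cast
    ring
  have h1 := finrank_add_eq_degree_add_one hG P hdim (D := D - A) (by omega)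
  have h2 := finrank_add_eq_degree_add_one hG P hdim (D := D' - A) (by
    rw [hdeg']
    nlinarith [P.degree_pos])
  have hinf : (D' - A) ⊓ D = D - A := by
    ext R
    have hR := hDD' R
    have hR0 := hA0 R
    simp only [Finsupp.inf_apply, Finsupp.sub_apply]
    by_cases hRQ : Q = R
    · have : D' R = D R := by simp [D, D', hRQ ▸ hQP]
      rw [this]
      simp only [Finsupp.coe_zero, Pi.zero_apply] at hR0
      omega
    · have : A R = 0 := by simp [A, hRQ]
      rw [this]
      omega
  have f1 := finite_riemannRochSpace (D' - A)
  have f2 := finite_riemannRochSpace D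
  have f3 := finite_riemannRochSpace D'
  have h3 := Submodule.finrank_sup_add_finrank_inf_eq (riemannRochSpace (D' - A))
    (riemannRochSpace D)
  rw [← riemannRochSpace_inf, hinf] at h3
  -- The two spaces meet in L(D − A), and all four dimensions are known, so their sum is the whole
  -- space.
  have hsup : riemannRochSpace (D' - A) ⊔ riemannRochSpace D = riemannRochSpace D' := by
    refine Submodule.eq_of_le_of_finrank_le (sup_le (riemannRochSpace_mono (sub_le_self _ hA0))
      (riemannRochSpace_mono hDD')) ?_
    have h4 := hdim n
    have h5 := hdim (n + 1)
    rw [← hD] at h4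
    rw [← hD'] at h5
    rw [hdeg] at h1
    rw [hdeg'] at h2
    zify at h3 h4 h5 ⊢
    linarith
  rw [← hsup] at hx
  obtain ⟨f, hf, y, hy, rfl⟩ := Submodule.mem_sup.1 hx
  exact ⟨f, hf, by rwa [add_sub_cancel_left]⟩

end RiemannTheorem

/-! ### Local expansions at a rational place -/

section LocalExpansion

variable {Q : Place K F} (hQ : Q.degree = 1) {ζ : ℕ → F} (hζ0 : ∀ r, ζ r ≠ 0)
  (hζ : ∀ r : ℕ, Q.val (ζ r) = r)

theorem hasLocalExpansion_iff {a : ℕ → K} {x : F} : HasLocalExpansion Q ζ x a ↔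
    ∀ N : ℕ, x - ∑ r ∈ Finset.range N, a r • ζ r ∈ Q.filtration N := Iff.rfl

include hQ hζ0 hζ

/-- At a rational place the residue field is one-dimensional over K, so the leading coefficient of
ζ_n spans it. -/
theorem exists_sub_smul_mem {n : ℕ} {x : F} (hx : x ∈ Q.filtration n) :
    ∃ c : K, x - c • ζ n ∈ Q.filtration (n + 1) := by
  have hz : ζ n ∈ Q.filtration n := (Q.mem_filtration_of_ne_zero (hζ0 n)).2 (hζ n).ge
  have hne : Q.lead n ⟨ζ n, hz⟩ ≠ 0 := by
    rw [Ne, Place.lead_eq_zero_iff, Q.mem_filtration_of_ne_zero (hζ0 n), hζ n]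
    omega
  obtain ⟨c, hc⟩ := exists_smul_eq_of_finrank_eq_one (K := K)
    (V := IsLocalRing.ResidueField Q.integers) hQ hne (Q.lead n ⟨x, hx⟩)
  refine ⟨c, ?_⟩
  have : Q.lead n (⟨x, hx⟩ - c • ⟨ζ n, hz⟩) = 0 := by
    rw [map_sub, map_smul, hc, sub_self]
  rwa [Place.lead_eq_zero_iff] at this

theorem exists_hasLocalExpansion {x : F} (hx : x ∈ Q.filtration 0) :
    ∃ a : ℕ → K, HasLocalExpansion Q ζ x a := by
  classical
  let step (n : ℕ) (y : F) : K := if h : y ∈ Q.filtration n then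
    (exists_sub_smul_mem hQ hζ0 hζ h).choose else 0
  have hstep : ∀ (n : ℕ) (y : F), y ∈ Q.filtration n →
      y - step n y • ζ n ∈ Q.filtration (n + 1) := fun n y hy => by
    simp only [step, dif_pos hy]
    exact (exists_sub_smul_mem hQ hζ0 hζ hy).choose_spec
  let rem : ℕ → F := fun n : ℕ => Nat.rec x (fun n y => y - step n y • ζ n) n
  have hrem : ∀ n : ℕ, rem n ∈ Q.filtration n := by
    intro n
    induction n with
    | zero => exact hx
    | succ n ih => exact_mod_cast hstep n _ ih
  refine ⟨fun n => step n (rem n), hasLocalExpansion_iff.2 fun N => ?_⟩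
  have : x - ∑ r ∈ Finset.range N, step r (rem r) • ζ r = rem N := by
    induction N with
    | zero => simp [rem]
    | succ n ih =>
      rw [Finset.sum_range_succ, ← sub_sub, ih]
  rw [this]
  exact hrem N

omit hQ in
theorem hasLocalExpansion_unique {x : F} {a a' : ℕ → K} (ha : HasLocalExpansion Q ζ x a)
    (ha' : HasLocalExpansion Q ζ x a') : a = a' := by
  rw [hasLocalExpansion_iff] at ha ha'
  funext n
  induction n using Nat.strong_induction_on with
  | _ n ih =>
    have h := sub_mem (ha' (n + 1)) (ha (n + 1))
    have hcongr : ∑ r ∈ Finset.range n, a r • ζ r = ∑ r ∈ Finset.range n, a' r • ζ r :=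
      Finset.sum_congr rfl fun r hr => by rw [ih r (Finset.mem_range.1 hr)]
    rw [Finset.sum_range_succ, Finset.sum_range_succ, hcongr] at h
    have h1 : (a n - a' n) • ζ n ∈ Q.filtration ((n + 1 : ℕ) : ℤ) := by
      convert! h using 1
      rw [sub_smul]
      abel
    by_contra hne
    rw [Q.filtration_smul_mem_iff _ (sub_ne_zero.2 hne), Q.mem_filtration_of_ne_zero (hζ0 n),
      hζ n] at h1
    push_cast at h1
    omega

theorem hasLocalExpansion_localCoeff {x : F} (hx : x ∈ Q.filtration 0) :
    HasLocalExpansion Q ζ x (localCoeff Q ζ x) :=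
  Classical.epsilon_spec (exists_hasLocalExpansion hQ hζ0 hζ hx)

omit hQ in
theorem localCoeff_eq {x : F} {a : ℕ → K} (ha : HasLocalExpansion Q ζ x a) :
    localCoeff Q ζ x = a :=
  hasLocalExpansion_unique hζ0 hζ (Classical.epsilon_spec ⟨a, ha⟩) ha

theorem localCoeff_sum {ι : Type*} (s : Finset ι) (c : ι → K) (x : ι → F)
    (hx : ∀ i ∈ s, x i ∈ Q.filtration 0) :
    localCoeff Q ζ (∑ i ∈ s, c i • x i) = fun r => ∑ i ∈ s, c i * localCoeff Q ζ (x i) r := by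
  refine localCoeff_eq hζ0 hζ (hasLocalExpansion_iff.2 fun N => ?_)
  have : ∑ i ∈ s, c i • x i - ∑ r ∈ Finset.range N, (∑ i ∈ s, c i * localCoeff Q ζ (x i) r) • ζ r =
      ∑ i ∈ s, c i • (x i - ∑ r ∈ Finset.range N, localCoeff Q ζ (x i) r • ζ r) := by
    simp only [Finset.sum_smul, smul_sub, Finset.sum_sub_distrib, Finset.smul_sum, mul_smul]
    rw [Finset.sum_comm]
  rw [this]
  exact sum_mem fun i hi => Submodule.smul_mem _ _
    (hasLocalExpansion_iff.1 (hasLocalExpansion_localCoeff hQ hζ0 hζ (hx i hi)) N)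

omit hQ in
theorem localCoeff_self (n : ℕ) : localCoeff Q ζ (ζ n) = Pi.single n 1 := by
  refine localCoeff_eq hζ0 hζ (hasLocalExpansion_iff.2 fun N => ?_)
  by_cases h : n < N
  · rw [Finset.sum_eq_single n (fun r _ hr => by simp [hr])
      (fun hn => absurd (Finset.mem_range.2 h) hn)]
    simp
  · rw [Finset.sum_eq_zero (fun r hr => by
      have : r ≠ n := fun e => h (e ▸ Finset.mem_range.1 hr)
      simp [this]), sub_zero, Q.mem_filtration_of_ne_zero (hζ0 n), hζ n]
    omega

theorem localCoeff_eq_zero_of_mem {x : F} {n : ℕ} (hx : x ∈ Q.filtration n) {r : ℕ} (hr : r < n) :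
    localCoeff Q ζ x r = 0 := by
  have h := hasLocalExpansion_iff.1
    (hasLocalExpansion_localCoeff hQ hζ0 hζ (Q.filtration_anti (by omega) hx))
  induction r using Nat.strong_induction_on with
  | _ r ih =>
    have h1 := h (r + 1)
    rw [Finset.sum_range_succ, Finset.sum_eq_zero (fun k hk => by
      rw [ih k (Finset.mem_range.1 hk) (by rw [Finset.mem_range] at hk; omega), zero_smul]),
      zero_add] at h1
    have h2 := sub_mem (Q.filtration_anti (show ((r + 1 : ℕ) : ℤ) ≤ n by omega) hx) h1
    rw [sub_sub_cancel] at h2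
    by_contra hne
    rw [Q.filtration_smul_mem_iff _ hne, Q.mem_filtration_of_ne_zero (hζ0 r), hζ r] at h2
    push_cast at h2
    omega

theorem mem_filtration_of_localCoeff {x : F} (hx : x ∈ Q.filtration 0) {n : ℕ}
    (h : ∀ r < n, localCoeff Q ζ x r = 0) : x ∈ Q.filtration n := by
  have := hasLocalExpansion_iff.1 (hasLocalExpansion_localCoeff hQ hζ0 hζ hx) n
  rwa [Finset.sum_eq_zero (fun r hr => by rw [h r (Finset.mem_range.1 hr), zero_smul]),
    sub_zero] at this

theorem localCoeff_ne_zero {x : F} (hx : x ≠ 0) {n : ℕ} (hn : Q.val x = n) :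
    localCoeff Q ζ x n ≠ 0 := by
  intro h0
  have hxn : x ∈ Q.filtration n := (Q.mem_filtration_of_ne_zero hx).2 hn.ge
  have := mem_filtration_of_localCoeff hQ hζ0 hζ (Q.filtration_anti (by omega) hxn) (n := n + 1)
    (fun r hr => by
      rcases Nat.lt_succ_iff_lt_or_eq.1 hr with h | rfl
      · exact localCoeff_eq_zero_of_mem hQ hζ0 hζ hxn h
      · exact h0)
  rw [Q.mem_filtration_of_ne_zero hx] at this
  push_cast at this
  omega

/-- The difference has arbitrarily large order at Q, so it vanishes: a terminating expansion is an
identity in F. It thereby gives information at all other places. -/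
theorem eq_sum_of_localCoeff {x : F} (hx : x ∈ Q.filtration 0) {N : ℕ}
    (h : ∀ r, N ≤ r → localCoeff Q ζ x r = 0) :
    x = ∑ r ∈ Finset.range N, localCoeff Q ζ x r • ζ r := by
  by_contra hne
  have hne' := sub_ne_zero.2 hne
  have h1 := hasLocalExpansion_iff.1 (hasLocalExpansion_localCoeff hQ hζ0 hζ hx)
  set y := x - ∑ r ∈ Finset.range N, localCoeff Q ζ x r • ζ r with hy
  have h2 : y ∈ Q.filtration ((N + ((Q.val y).toNat + 1) : ℕ) : ℤ) := by
    have := h1 (N + ((Q.val y).toNat + 1))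
    rwa [Finset.sum_range_add, Finset.sum_eq_zero (s := Finset.range ((Q.val y).toNat + 1))
      (fun r _ => by rw [h _ (by omega), zero_smul]), add_zero] at this
  rw [Q.mem_filtration_of_ne_zero hne'] at h2
  push_cast at h2
  omega

end LocalExpansion

end FnField

end

/-! ### Rows, columns and row relations of the Xing–Niederreiter matrices. -/

noncomputable section

namespace FnField

variable {K F : Type*} [Field K] [Field F] [Algebra K F]
  [Algebra (RatFunc K) F] [IsScalarTower K (RatFunc K) F] [FunctionField K F]

section Basis

variable {g : ℕ} {G : Divisor K F} {w : Fin (g + 1) → F} (hw : IsBasisOf w (riemannRochSpace G))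
  {P : Place K F} {k : ℕ → F}
  (hk : ∀ n : ℕ, IsBasisOf (Sum.elim w fun j : Fin (n * P.degree) => k j)
    (riemannRochSpace (G + Finsupp.single P (n : ℤ))))

include hk

theorem exists_combination_of_mem {n : ℕ} {x : F}
    (hx : x ∈ riemannRochSpace (G + Finsupp.single P (n : ℤ))) :
    ∃ (c : Fin (g + 1) → K) (d : ℕ → K),
      x = ∑ u, c u • w u + ∑ j ∈ Finset.range (n * P.degree), d j • k j := by
  rw [← (hk n).2, Submodule.mem_span_range_iff_exists_fun] at hx
  obtain ⟨c, rfl⟩ := hx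
  refine ⟨fun u => c (Sum.inl u), fun j => if h : j < n * P.degree then c (Sum.inr ⟨j, h⟩) else 0, ?_⟩
  rw [Fintype.sum_sum_type, Finset.sum_range]
  simp

theorem basis_mem (j : ℕ) : k j ∈ riemannRochSpace (G + Finsupp.single P ((j + 1 : ℕ) : ℤ)) := by
  rw [← (hk (j + 1)).2]
  have : j < (j + 1) * P.degree := by
    have := P.degree_pos
    nlinarith
  exact Submodule.subset_span ⟨Sum.inr ⟨j, this⟩, rfl⟩

theorem basis_mem_filtration (j : ℕ) {R : Place K F} (hR : P ≠ R) :
    k j ∈ R.filtration (-G R) := by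
  classical
  have := basis_mem hk j R
  rwa [Finsupp.add_apply, Finsupp.single_apply, if_neg hR, add_zero] at this

include hw

theorem eq_zero_of_combination_mem {D : ℕ} {f : ℕ → K}
    (h : ∑ j ∈ Finset.range D, f j • k j ∈ riemannRochSpace G) : ∀ j < D, f j = 0 := by
  rw [← hw.2, Submodule.mem_span_range_iff_exists_fun] at h
  obtain ⟨c, hc⟩ := h
  have hD : D ≤ D * P.degree := Nat.le_mul_of_pos_right _ P.degree_pos
  have hli := Fintype.linearIndependent_iff.1 (hk D).1
    (Sum.elim (fun u => -c u) fun j => if (j : ℕ) < D then f j else 0) (by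
    rw [Fintype.sum_sum_type]
    simp only [Sum.elim_inl, Sum.elim_inr, neg_smul, Finset.sum_neg_distrib, ite_smul, zero_smul]
    rw [hc, ← Finset.sum_range fun j => if j < D then f j • k j else 0, ← Finset.sum_filter]
    have : (Finset.range (D * P.degree)).filter (· < D) = Finset.range D := by
      ext j
      simp only [Finset.mem_filter, Finset.mem_range]
      omega
    rw [this, neg_add_cancel])
  intro j hj
  have := hli (Sum.inr ⟨j, by omega⟩)
  simpa [hj] using this

omit hw in
theorem finrank_of_basis (n : ℕ) :
    Module.finrank K (riemannRochSpace (G + Finsupp.single P (n : ℤ))) = g + 1 + n * P.degree := by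
  rw [← (hk n).2, finrank_span_eq_card (hk n).1]
  simp

omit hk in
theorem finite_riemannRochSpace_zero_of_basis (hG : 0 ≤ G) :
    Module.Finite K (riemannRochSpace (0 : Divisor K F)) := by
  have : Module.Finite K (riemannRochSpace G) := by
    rw [← hw.2]
    exact Module.Finite.span_of_finite K (Set.finite_range w)
  exact Module.Finite.of_injective _ (Submodule.inclusion_injective (riemannRochSpace_mono hG))

end Basis

section Gaps

variable {g : ℕ} {m : Fin (g + 1) → ℕ} (hm : StrictMono m) (hmg : m (Fin.last _) ≤ 2 * g)

include hm hmg

theorem notMem_range_of_lt {n : ℕ} (hn : 2 * g < n) : n ∉ Set.range m := by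
  rintro ⟨u, rfl⟩
  have := hm.monotone (Fin.le_last u)
  omega

theorem infinite_setOf_notMem_range : {n | n ∉ Set.range m}.Infinite :=
  (Set.Ioi_infinite (2 * g)).mono fun _ hn => notMem_range_of_lt hm hmg hn

theorem nth_notMem_range (r : ℕ) : Nat.nth (fun n => n ∉ Set.range m) r ∉ Set.range m :=
  Nat.nth_mem_of_infinite (infinite_setOf_notMem_range hm hmg) r

theorem nth_notMem_range_strictMono : StrictMono (Nat.nth (fun n => n ∉ Set.range m)) :=
  Nat.nth_strictMono (infinite_setOf_notMem_range hm hmg)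

omit hm hmg in
theorem exists_nth_eq {n : ℕ} (hn : n ∉ Set.range m) :
    ∃ r, Nat.nth (fun n => n ∉ Set.range m) r = n := by
  classical
  exact ⟨_, Nat.nth_count (p := fun n => n ∉ Set.range m) hn⟩

/-- All integers above 2g are kept, so at most 2g + 1 integers are skipped. -/
theorem nth_notMem_range_le (r : ℕ) :
    Nat.nth (fun n => n ∉ Set.range m) r ≤ r + 2 * g + 1 := by
  classical
  have h : r < Nat.count (fun n => n ∉ Set.range m) (2 * g + 1 + (r + 1)) := by
    rw [Nat.count_add]
    have : Nat.count (fun k => 2 * g + 1 + k ∉ Set.range m) (r + 1) = r + 1 := by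
      rw [Nat.count_iff_forall]
      intro n _
      exact notMem_range_of_lt hm hmg (by omega)
    omega
  have := Nat.nth_lt_of_lt_count h
  omega

end Gaps

section XingNiederreiter

variable {g : ℕ} {Pinf P0 : Place K F} {G : Divisor K F} (hrat : Pinf.degree = 1)
  (hP0inf : P0 ≠ Pinf) (hG : 0 ≤ G) (hGdeg : G.degree = 2 * (g : ℤ))
  (hGinf : G Pinf = 0) (hGP0 : G P0 = 0) {w : Fin (g + 1) → F} {m : Fin (g + 1) → ℕ}
  (hw : IsBasisOf w (riemannRochSpace G))
  (hwm : ∀ u, Pinf.ord (w u) = ((m u : ℤ) : WithTop ℤ))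
  (hm : StrictMono m) (hmg : m (Fin.last _) ≤ 2 * g) {z : F}
  (hz : z ∈ riemannRochSpace (Finsupp.single P0 (2 * (g : ℤ) + 1) - Finsupp.single Pinf 1))
  (hz' : z ∉ riemannRochSpace (Finsupp.single P0 (2 * (g : ℤ) + 1) - Finsupp.single Pinf 2))

theorem ne_zero_and_val_eq_of_ord {P : Place K F} {x : F} {n : ℤ} (h : P.ord x = (n : WithTop ℤ)) :
    x ≠ 0 ∧ P.val x = n := by
  have hx : x ≠ 0 := by
    rintro rfl
    simp [Place.ord] at h
  rw [P.ord_of_ne_zero hx] at h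
  exact ⟨hx, by exact_mod_cast h⟩

include hP0inf hz hz' in
theorem local_parameter : z ≠ 0 ∧ Pinf.val z = 1 := by
  classical
  have hz0 : z ≠ 0 := by rintro rfl; exact hz' (zero_mem _)
  refine ⟨hz0, ?_⟩
  have h1 := hz Pinf
  rw [← Place.mem_filtration, Pinf.mem_filtration_of_ne_zero hz0] at h1
  simp [hP0inf] at h1
  by_contra hne
  refine hz' fun R => ?_
  by_cases hR : Pinf = R
  · subst hR
    rw [← Place.mem_filtration, Pinf.mem_filtration_of_ne_zero hz0]
    simp [hP0inf]
    omega
  · have := hz R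
    rw [Finsupp.sub_apply, Finsupp.single_eq_of_ne' hR] at this ⊢
    exact this

theorem expansionSeq_apply_of_notMem {r : ℕ} (hr : r ∉ Set.range m) :
    expansionSeq m w z r = z ^ r := by
  rw [expansionSeq, dif_neg]
  rintro ⟨u, rfl⟩
  exact hr ⟨u, rfl⟩

include hm in
theorem expansionSeq_apply (u : Fin (g + 1)) : expansionSeq m w z (m u) = w u := by
  have h : ∃ u', m u = m u' := ⟨u, rfl⟩
  rw [expansionSeq, dif_pos h, ← hm.injective h.choose_spec]

include hP0inf hwm hm hz hz' in
theorem expansionSeq_val (r : ℕ) :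
    expansionSeq m w z r ≠ 0 ∧ Pinf.val (expansionSeq m w z r) = r := by
  by_cases hr : r ∈ Set.range m
  · obtain ⟨u, rfl⟩ := hr
    rw [expansionSeq_apply hm]
    exact ne_zero_and_val_eq_of_ord (hwm u)
  · rw [expansionSeq_apply_of_notMem hr]
    obtain ⟨h0, h1⟩ := local_parameter hP0inf hz hz'
    exact ⟨pow_ne_zero r h0, by rw [Place.val_pow, h1, mul_one]⟩

include hG hw hm hz in
theorem expansionSeq_mem_filtration (r : ℕ) {R : Place K F} (hR : P0 ≠ R) :
    expansionSeq m w z r ∈ R.filtration (-G R) := by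
  classical
  by_cases hr : r ∈ Set.range m
  · obtain ⟨u, rfl⟩ := hr
    rw [expansionSeq_apply hm]
    have : w u ∈ riemannRochSpace G := by
      rw [← hw.2]
      exact Submodule.subset_span ⟨u, rfl⟩
    exact this R
  · rw [expansionSeq_apply_of_notMem hr]
    refine R.filtration_anti ?_ (R.pow_mem_filtration (hz R) r)
    have h1 : 0 ≤ G R := hG R
    have h2 : 0 ≤ (Finsupp.single Pinf (1 : ℤ)) R := by
      rw [Finsupp.single_apply]; split_ifs <;> simp
    rw [Finsupp.sub_apply, Finsupp.single_apply, if_neg hR]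
    have := mul_nonneg (Int.natCast_nonneg r) h2
    linarith

section Rows

variable {s : ℕ} {P : Fin s → Place K F} (hP : Function.Injective P)
  (hPinf : ∀ i, P i ≠ Pinf) (hP0 : ∀ i, P0 ≠ P i) {k : Fin s → ℕ → F}
  (hk : ∀ (i : Fin s) (n : ℕ),
      IsBasisOf (Sum.elim w fun j : Fin (n * (P i).degree) => k i j)
        (riemannRochSpace (G + Finsupp.single (P i) (n : ℤ))))

include hrat hP0inf hGinf hw hwm hm hmg hz hz' hPinf hk in
-- Each w_u is itself a member of the expansion sequence, at index n_u, so it has no coefficient at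
-- the retained indices. Elements of L(G) are thus invisible to the matrix.
theorem localCoeff_combination (i : Fin s) (c : Fin (g + 1) → K) (D : ℕ) (d : ℕ → K) (r : ℕ) :
    localCoeff Pinf (expansionSeq m w z) (∑ u, c u • w u + ∑ j ∈ Finset.range D, d j • k i j)
      (Nat.nth (fun n => n ∉ Set.range m) r) =
    ∑ j ∈ Finset.range D, d j * xnMatrix Pinf m w z k i j r := by
  have hζ := expansionSeq_val hP0inf hwm hm hz hz'
  have hk0 : ∀ j, k i j ∈ Pinf.filtration 0 := fun j => by
    simpa [hGinf] using basis_mem_filtration (hk i) j (hPinf i)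
  have hw0 : ∀ u, w u ∈ Pinf.filtration 0 := fun u => by
    have h : w u ∈ riemannRochSpace G := by
      rw [← hw.2]
      exact Submodule.subset_span ⟨u, rfl⟩
    simpa [hGinf] using (Pinf.mem_filtration.2 (h Pinf))
  have h1 := localCoeff_sum hrat (fun r => (hζ r).1) (fun r => (hζ r).2) Finset.univ c w
    (fun u _ => hw0 u)
  have h2 := localCoeff_sum hrat (fun r => (hζ r).1) (fun r => (hζ r).2) (Finset.range D) d (k i)
    (fun j _ => hk0 j)
  have h3 := localCoeff_sum hrat (fun r => (hζ r).1) (fun r => (hζ r).2) Finset.univ (fun _ => 1)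
    (fun b : Bool => cond b (∑ u, c u • w u) (∑ j ∈ Finset.range D, d j • k i j)) (fun b _ => by
      cases b
      · exact sum_mem fun j _ => Submodule.smul_mem _ _ (hk0 j)
      · exact sum_mem fun u _ => Submodule.smul_mem _ _ (hw0 u))
  simp only [Fintype.sum_bool, cond_true, cond_false, one_smul, one_mul] at h3
  rw [h3, h1, h2]
  have hzero : ∀ u, localCoeff Pinf (expansionSeq m w z) (w u)
      (Nat.nth (fun n => n ∉ Set.range m) r) = 0 := fun u => by
    rw [← expansionSeq_apply (w := w) (z := z) hm u,
      localCoeff_self (fun r => (hζ r).1) (fun r => (hζ r).2), Pi.single_apply, if_neg]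
    intro h
    exact nth_notMem_range hm hmg r ⟨u, h.symm⟩
  simp only [hzero, mul_zero, Finset.sum_const_zero, zero_add]
  rfl

include hw hP hk in
/-- The `k^{(i)}_j` are jointly independent modulo `L(G)`. -/
theorem eq_zero_of_joint_combination_mem (D : ℕ) (f : Fin s → ℕ → K)
    (h : ∑ i, ∑ j ∈ Finset.range D, f i j • k i j ∈ riemannRochSpace G) :
    ∀ i, ∀ j < D, f i j = 0 := by
  classical
  have hreg : ∀ i, ∀ R, P i ≠ R → ∑ j ∈ Finset.range D, f i j • k i j ∈ R.filtration (-G R) :=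
    fun i R hR => sum_mem fun j _ => Submodule.smul_mem _ _ (basis_mem_filtration (hk i) j hR)
  intro i
  refine eq_zero_of_combination_mem hw (hk i) fun R => ?_
  -- At P_i the sums belonging to the other places have no pole beyond G, so the i-th sum has none
  -- either; elsewhere this is automatic.
  by_cases hR : P i = R
  · have h1 := h R
    rw [← Finset.add_sum_erase _ _ (Finset.mem_univ i)] at h1
    have h2 : ∑ l ∈ Finset.univ.erase i, ∑ j ∈ Finset.range D, f l j • k l j ∈
        R.filtration (-G R) := sum_mem fun l hl => hreg l R fun hlR =>
      (Finset.mem_erase.1 hl).1 (hP (hlR.trans hR.symm))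
    have := sub_mem (Place.mem_filtration R |>.2 h1) h2
    rwa [add_sub_cancel_right] at this
  · exact hreg i R hR

include hrat hP0inf hG hGinf hw hwm hm hmg hz hz' hP hPinf hP0 hk in
/-- Any finite set of rows of the generating matrices stays independent after deleting finitely
many columns. -/
theorem xnMatrix_rows_independent (c D : ℕ) (f : Fin s → ℕ → K)
    (h : ∀ r, c ≤ r → ∑ i, ∑ j ∈ Finset.range D, f i j * xnMatrix Pinf m w z k i j r = 0) :
    ∀ i, ∀ j < D, f i j = 0 := by
  have hζ := expansionSeq_val hP0inf hwm hm hz hz'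
  refine eq_zero_of_joint_combination_mem hw hP hk D f ?_
  set x := ∑ i, ∑ j ∈ Finset.range D, f i j • k i j with hx
  have hk0 : ∀ i j, k i j ∈ Pinf.filtration 0 := fun i j => by
    simpa [hGinf] using basis_mem_filtration (hk i) j (hPinf i)
  have hcoeff : ∀ r, localCoeff Pinf (expansionSeq m w z) x
      (Nat.nth (fun n => n ∉ Set.range m) r) =
      ∑ i, ∑ j ∈ Finset.range D, f i j * xnMatrix Pinf m w z k i j r := fun r => by
    have h1 := localCoeff_sum hrat (fun r => (hζ r).1) (fun r => (hζ r).2)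
      (Finset.univ ×ˢ Finset.range D) (fun p : Fin s × ℕ => f p.1 p.2) (fun p => k p.1 p.2)
      (fun p _ => hk0 p.1 p.2)
    rw [Finset.sum_product] at h1
    rw [hx, h1]
    exact Finset.sum_product _ _ _
  have hx0 : x ∈ Pinf.filtration 0 :=
    sum_mem fun i _ => sum_mem fun j _ => Submodule.smul_mem _ _ (hk0 i j)
  -- Beyond 2g every index is a retained one, and beyond h(c) its column is among those where the
  -- combination vanishes.
  have hxsum := eq_sum_of_localCoeff hrat (fun r => (hζ r).1) (fun r => (hζ r).2) hx0
    (N := max (2 * g + 1) (Nat.nth (fun n => n ∉ Set.range m) c)) (fun r hr => by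
      obtain ⟨r', rfl⟩ := exists_nth_eq (notMem_range_of_lt hm hmg (n := r) (by omega))
      rw [hcoeff, h r']
      exact (nth_notMem_range_strictMono hm hmg).le_iff_le.1 (le_of_max_le_right hr))
  intro R
  -- At P_0 the regularity up to G is read off from the k^{(i)}_j, at all other places from the
  -- finite sum of the z_r.
  by_cases hR : P0 = R
  · exact sum_mem fun i _ => sum_mem fun j _ => Submodule.smul_mem (R.filtration (-G R)) _
      (basis_mem_filtration (hk i) j (hR ▸ (hP0 i).symm))
  · rw [hxsum]
    exact sum_mem fun r _ => Submodule.smul_mem (R.filtration (-G R)) _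
      (expansionSeq_mem_filtration hG hw hm hz r hR)

include hrat hP0inf hG hGdeg hGinf hw hwm hm hmg hz hz' hPinf hk in
/-- The columns of each generating matrix are independent. -/
theorem xnMatrix_columns_independent (i : Fin s) (v : ℕ → K) (R : ℕ)
    (h : ∀ j, ∑ r ∈ Finset.range R, v r * xnMatrix Pinf m w z k i j r = 0) :
    ∀ r < R, v r = 0 := by
  have hζ := expansionSeq_val hP0inf hwm hm hz hz'
  have hfin := finite_riemannRochSpace_zero_of_basis hw hG
  induction R with
  | zero => simp
  | succ R ih =>
    have hR : v R = 0 := by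
      -- A function of order exactly h(R) at P_∞ has coefficient 0 at h(r) for r < R and a nonzero
      -- one at h(R). Pairing it with the column relation isolates v_R.
      obtain ⟨n, f, hf, hf0, hfv⟩ := exists_mem_val_eq hGdeg (P i) (finrank_of_basis (hk i))
        (hPinf i) hGinf (Nat.nth (fun n => n ∉ Set.range m) R)
      obtain ⟨c, d, hcd⟩ := exists_combination_of_mem (hk i) hf
      have hcoeff := localCoeff_combination hrat hP0inf hGinf hw hwm hm hmg hz hz' hPinf hk i c
        (n * (P i).degree) d
      rw [← hcd] at hcoeff
      have hsum : ∑ r ∈ Finset.range (R + 1), v r * localCoeff Pinf (expansionSeq m w z) f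
          (Nat.nth (fun n => n ∉ Set.range m) r) = 0 := by
        simp only [hcoeff, Finset.mul_sum]
        rw [Finset.sum_comm]
        refine Finset.sum_eq_zero fun j _ => ?_
        have := congrArg (d j * ·) (h j)
        simp only [Finset.mul_sum, mul_zero] at this
        rw [← this]
        exact Finset.sum_congr rfl fun r _ => by ring
      have hfmem := (Pinf.mem_filtration_of_ne_zero hf0).2 hfv.ge
      rw [Finset.sum_range_succ, Finset.sum_eq_zero (fun r hr => by
        rw [localCoeff_eq_zero_of_mem hrat (fun r => (hζ r).1) (fun r => (hζ r).2) hfmem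
          (nth_notMem_range_strictMono hm hmg (Finset.mem_range.1 hr)), mul_zero]), zero_add] at hsum
      exact (mul_eq_zero.1 hsum).resolve_right
        (localCoeff_ne_zero hrat (fun r => (hζ r).1) (fun r => (hζ r).2) hf0 hfv)
    have hlt := ih fun j => by
      have := h j
      rwa [Finset.sum_range_succ, hR, zero_mul, add_zero] at this
    intro r hr
    rcases Nat.lt_succ_iff_lt_or_eq.1 hr with hr | rfl
    · exact hlt r hr
    · exact hR

include hrat hP0inf hG hGdeg hGinf hw hwm hm hmg hz hz' hPinf hk in
/-- Every row of a generating matrix agrees with a combination of earlier rows in all columns,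
up to a bounded number, of smaller index. -/
theorem xnMatrix_exists_row_relation (i : Fin s) : ∃ κ : ℕ, ∀ d : ℕ, ∃ f : ℕ → K, f d = 1 ∧
    ∀ r, r + κ < d → ∑ j ∈ Finset.range (d + 1), f j * xnMatrix Pinf m w z k i j r = 0 := by
  have hζ := expansionSeq_val hP0inf hwm hm hz hz'
  have hfin := finite_riemannRochSpace_zero_of_basis hw hG
  set e := (P i).degree with he
  have he0 : 0 < e := (P i).degree_pos
  -- The losses are e from rounding d down to a multiple of e, g in the attainable order of
  -- vanishing, and 2g + 1 from the skipped indices.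
  refine ⟨e + 3 * g + 2, fun d => ?_⟩
  by_cases hd : d < e + 3 * g + 2
  · exact ⟨fun _ => 1, rfl, fun r hr => by omega⟩
  set n := d / e with hn
  have hn1 : n * e ≤ d := Nat.div_mul_le_self d e
  have hn2 : d < (n + 1) * e := by
    have := Nat.lt_div_mul_add (a := d) he0
    rw [add_mul, one_mul]
    exact this
  have hn3 : (n + 1) * e = n * e + e := by ring
  have hkd : k i d ∈ riemannRochSpace (G + Finsupp.single (P i) ((n + 1 : ℕ) : ℤ)) := by
    rw [← (hk i (n + 1)).2]
    exact Submodule.subset_span ⟨Sum.inr ⟨d, hn2⟩, rfl⟩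
  -- Modulo L(G + nP_i), hence modulo earlier rows and the invisible w_u, k_d is replaced by a
  -- function vanishing to order n e − g at P_∞.
  obtain ⟨f, hf, hsub⟩ := exists_sub_mem_of_mem hGdeg (P i) (finrank_of_basis (hk i)) (hPinf i) n
    (n * e - g) (by rw [hrat, ← he]; omega) hkd
  obtain ⟨c, a, hca⟩ := exists_combination_of_mem (hk i) hsub
  rw [← he] at hca
  let b : ℕ → K := fun j => if j = d then 1 else if j < n * e then -a j else 0
  have hb : f = ∑ u, (-c u) • w u + ∑ j ∈ Finset.range (d + 1), b j • k i j := by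
    have h1 : ∑ j ∈ Finset.range (d + 1), b j • k i j =
        k i d - ∑ j ∈ Finset.range (n * e), a j • k i j := by
      rw [Finset.sum_range_succ, sub_eq_neg_add, ← Finset.sum_neg_distrib]
      congr 1
      · have hsubset : Finset.range (n * e) ⊆ Finset.range d := Finset.range_subset_range.2 hn1
        rw [← Finset.sum_subset hsubset fun j hj hj' => ?_]
        · refine Finset.sum_congr rfl fun j hj => ?_
          have := Finset.mem_range.1 hj
          simp only [b]
          rw [if_neg (by omega), if_pos this, neg_smul]
        · rw [Finset.mem_range] at hj hj'
          simp only [b]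
          rw [if_neg (by omega), if_neg hj', zero_smul]
      · simp [b]
    rw [h1]
    simp only [neg_smul, Finset.sum_neg_distrib]
    rw [sub_eq_iff_eq_add] at hca
    rw [hca]
    abel
  refine ⟨b, by simp [b], fun r hr => ?_⟩
  rw [← localCoeff_combination hrat hP0inf hGinf hw hwm hm hmg hz hz' hPinf hk i (fun u => -c u),
    ← hb]
  have hfmem : f ∈ Pinf.filtration ((n * e - g : ℕ) : ℤ) := by
    have := Pinf.mem_filtration.2 (hf Pinf)
    rw [Finsupp.sub_apply, Finsupp.add_apply, hGinf, Finsupp.single_eq_of_ne' (hPinf i),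
      Finsupp.single_eq_same] at this
    simpa using this
  have := nth_notMem_range_le hm hmg r
  exact localCoeff_eq_zero_of_mem hrat (fun r => (hζ r).1) (fun r => (hζ r).2) hfmem (by omega)

end Rows

end XingNiederreiter

end FnField

end

noncomputable section

namespace FnField

/-! ### Output vectors of digital sequences -/

section Output

variable {K : Type*} [Field K] {b : ℕ} [NeZero b] (φ : Fin b ≃ K) {s : ℕ}
  (C : Fin s → ℕ → ℕ → K)

/-- The digit of index `r` of `n`, as an element of `K`. -/
def digitVec (r n : ℕ) : K := φ (Fin.ofNat b (n / b ^ r))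

/-- The vectors of output digits of a digital sequence, before applying `φ⁻¹`. -/
def outVec (n : ℕ) (i : Fin s) (j : ℕ) : K := ∑ᶠ r : ℕ, digitVec φ r n * C i j r

theorem digitalSequence_eq (n : ℕ) (i : Fin s) :
    digitalSequence b φ C n i = Real.ofDigits fun j => φ.symm (outVec φ C n i j) := rfl

omit [NeZero b] [Field K] in
include φ in
theorem one_lt_card_of_equiv [Nontrivial K] : 1 < b := by
  have : Nontrivial (Fin b) := φ.nontrivial
  simpa using Fintype.one_lt_card (α := Fin b)

omit [Field K] in
theorem digitVec_mod (r n : ℕ) :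
    digitVec φ r n = φ ⟨n / b ^ r % b, Nat.mod_lt _ (NeZero.pos b)⟩ := rfl

omit [Field K] in
theorem digitVec_congr {r r' n n' : ℕ} (h : n / b ^ r % b = n' / b ^ r' % b) :
    digitVec φ r n = digitVec φ r' n' := by
  simp only [digitVec_mod, h]

variable {φ} (hφ : φ 0 = 0)

include hφ in
theorem digitVec_eq_zero {r n : ℕ} (h : n / b ^ r % b = 0) : digitVec φ r n = 0 := by
  rw [digitVec_mod, ← hφ]
  congr 1
  ext
  simpa using h

include hφ in
theorem digitVec_eq_zero_of_lt {r n : ℕ} (h : n < b ^ r) : digitVec φ r n = 0 :=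
  digitVec_eq_zero hφ (by rw [Nat.div_eq_of_lt h, Nat.zero_mod])

include hφ in
theorem digitVec_mul_pow_of_lt {r M : ℕ} (h : r < M) (k : ℕ) : digitVec φ r (k * b ^ M) = 0 := by
  refine digitVec_eq_zero hφ ?_
  obtain ⟨c, rfl⟩ := Nat.exists_eq_add_of_lt h
  rw [show k * b ^ (r + c + 1) = b ^ r * (b * (k * b ^ c)) by ring,
    Nat.mul_div_cancel_left _ (pow_pos (NeZero.pos b) r), Nat.mul_mod_right]

omit [Field K] in
theorem digitVec_add_mul_pow (M r k : ℕ) : digitVec φ (M + r) (k * b ^ M) = digitVec φ r k := by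
  refine digitVec_congr φ ?_
  rw [pow_add, ← Nat.div_div_eq_div_mul, Nat.mul_div_cancel _ (pow_pos (NeZero.pos b) M)]

include hφ in
-- The map φ need not be additive. Additivity holds here because the two numbers have disjoint digit
-- supports and φ(0) = 0.
theorem digitVec_add {M n : ℕ} (hn : n < b ^ M) (k r : ℕ) :
    digitVec φ r (k * b ^ M + n) = digitVec φ r (k * b ^ M) + digitVec φ r n := by
  have hb := NeZero.pos b
  rcases lt_or_ge r M with h | h
  · rw [digitVec_mul_pow_of_lt hφ h, zero_add]
    refine digitVec_congr φ ?_
    obtain ⟨c, rfl⟩ := Nat.exists_eq_add_of_lt h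
    rw [show k * b ^ (r + c + 1) + n = n + b ^ r * (b * (k * b ^ c)) by ring,
      Nat.add_mul_div_left _ _ (pow_pos hb r), Nat.add_mul_mod_self_left]
  · obtain ⟨c, rfl⟩ := Nat.exists_eq_add_of_le h
    rw [digitVec_eq_zero_of_lt hφ (n := n) (hn.trans_le (Nat.pow_le_pow_right hb h)), add_zero]
    refine digitVec_congr φ ?_
    rw [pow_add, ← Nat.div_div_eq_div_mul, ← Nat.div_div_eq_div_mul, add_comm,
      Nat.add_mul_div_right _ _ (pow_pos hb M), Nat.div_eq_of_lt hn, zero_add,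
      Nat.mul_div_cancel _ (pow_pos hb M)]

omit [Field K] in
/-- Summation over the digits of the integers below `b ^ L`. -/
theorem sum_range_pow_digitVec [Fintype K] (L : ℕ) {A : Type*} [AddCommMonoid A]
    (F : (Fin L → K) → A) :
    ∑ n ∈ Finset.range (b ^ L), F (fun r => digitVec φ r n) = ∑ v, F v := by
  rw [Finset.sum_range fun n => F (fun r => digitVec φ r n)]
  refine Fintype.sum_equiv (finFunctionFinEquiv.symm.trans (Equiv.arrowCongr (Equiv.refl _) φ)) _ _
    fun n => ?_
  congr 1

omit [Field K] in
theorem eq_of_digitVec_eq {L n n' : ℕ} (hn : n < b ^ L) (hn' : n' < b ^ L)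
    (h : ∀ r < L, digitVec φ r n = digitVec φ r n') : n = n' := by
  have : (finFunctionFinEquiv (m := b) (n := L)).symm ⟨n, hn⟩ =
      finFunctionFinEquiv.symm ⟨n', hn'⟩ := by
    funext r
    exact φ.injective (h r r.2)
  simpa using this

include hφ in
theorem outVec_eq_sum {L n : ℕ} (hn : n < b ^ L) (i : Fin s) (j : ℕ) :
    outVec φ C n i j = ∑ r ∈ Finset.range L, digitVec φ r n * C i j r := by
  refine finsum_eq_sum_of_support_subset _ fun r hr => ?_
  rw [Finset.coe_range, Set.mem_Iio]
  by_contra hle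
  refine hr ?_
  simp only
  rw [digitVec_eq_zero_of_lt hφ (hn.trans_le (Nat.pow_le_pow_right (NeZero.pos b) (not_lt.1 hle))),
    zero_mul]

include hφ in
theorem outVec_add {M n : ℕ} (hn : n < b ^ M) (k : ℕ) :
    outVec φ C (k * b ^ M + n) = outVec φ C (k * b ^ M) + outVec φ C n := by
  funext i j
  obtain ⟨L, hL⟩ : ∃ L, k * b ^ M + n < b ^ L := ⟨_, Nat.lt_pow_self (one_lt_card_of_equiv φ)⟩
  rw [Pi.add_apply, Pi.add_apply, outVec_eq_sum C hφ hL, outVec_eq_sum C hφ (L := L) (by omega),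
    outVec_eq_sum C hφ (L := L) (by omega), ← Finset.sum_add_distrib]
  refine Finset.sum_congr rfl fun r _ => ?_
  rw [digitVec_add hφ hn, add_mul]

include hφ in
theorem outVec_mul_pow {L k : ℕ} (hk : k < b ^ L) (M : ℕ) (i : Fin s) (j : ℕ) :
    outVec φ C (k * b ^ M) i j = ∑ r : Fin L, digitVec φ r k * C i j (M + r) := by
  rw [outVec_eq_sum C hφ (L := M + L), Finset.sum_range_add, Finset.sum_eq_zero, zero_add,
    Finset.sum_range]
  · exact Finset.sum_congr rfl fun r _ => by rw [digitVec_add_mul_pow]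
  · intro r hr
    rw [digitVec_mul_pow_of_lt hφ (Finset.mem_range.1 hr), zero_mul]
  · rw [pow_add, mul_comm]
    exact Nat.mul_lt_mul_of_pos_left hk (pow_pos (NeZero.pos b) M)

include hφ in
-- Used to show that an exceptional digit expansion is taken by at most one index n.
theorem outVec_injective (i : Fin s)
    (hcol : ∀ (v : ℕ → K) (R : ℕ), (∀ j, ∑ r ∈ Finset.range R, v r * C i j r = 0) →
      ∀ r < R, v r = 0) : Function.Injective fun n => outVec φ C n i := by
  intro n n' h
  obtain ⟨L, hL⟩ : ∃ L, n + n' < b ^ L := ⟨_, Nat.lt_pow_self (one_lt_card_of_equiv φ)⟩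
  refine eq_of_digitVec_eq (φ := φ) (L := L) (by omega) (by omega) fun r hr => ?_
  rw [← sub_eq_zero]
  refine hcol (fun r => digitVec φ r n - digitVec φ r n') L (fun j => ?_) r hr
  simp only [sub_mul, Finset.sum_sub_distrib]
  rw [← outVec_eq_sum C hφ (by omega), ← outVec_eq_sum C hφ (by omega), sub_eq_zero]
  exact congrFun h j

/-- Truncation of output vectors to `D` digits per coordinate. -/
def truncVec (D : ℕ) (y : Fin s → ℕ → K) : Fin s → Fin D → K := fun i j => y i j

omit [NeZero b] in
theorem truncVec_add (D : ℕ) (y y' : Fin s → ℕ → K) :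
    truncVec D (y + y') = truncVec D y + truncVec D y' := rfl

/-- If any finite set of rows is independent on the columns from `c` on, then the truncated output
vectors at multiples of `b ^ c` are equidistributed. -/
theorem sum_truncVec_outVec [Fintype K] [DecidableEq K] (hφ : φ 0 = 0) (c D : ℕ)
    (hrow : ∀ f : Fin s → ℕ → K, (∀ r, c ≤ r → ∑ i, ∑ j ∈ Finset.range D, f i j * C i j r = 0) →
      ∀ i, ∀ j < D, f i j = 0) :
    ∃ L N : ℕ, 0 < N ∧ ∀ F : (Fin s → Fin D → K) → ℝ,
      ∑ k ∈ Finset.range (b ^ L), F (truncVec D (outVec φ C (k * b ^ c))) = N * ∑ Y, F Y := by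
  have hex : ∀ f : Fin s → Fin D → K, f ≠ 0 → ∃ r, ∑ i, ∑ j, f i j * C i j (c + r) ≠ 0 := by
    intro f hf
    by_contra! hall
    refine hf ?_
    have := hrow (fun i j => if h : j < D then f i ⟨j, h⟩ else 0) (fun r hr => by
      obtain ⟨r', rfl⟩ := Nat.exists_eq_add_of_le hr
      rw [← hall r']
      refine Finset.sum_congr rfl fun i _ => ?_
      rw [Finset.sum_range]
      exact Finset.sum_congr rfl fun j _ => by simp)
    funext i j
    simpa using this i j j.2
  choose! ρ hρ using hex
  -- Since K is finite there are finitely many f, so one L covers a nonzero column for each of them.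
  obtain ⟨L, hL⟩ : ∃ L, ∀ f : Fin s → Fin D → K, ρ f < L :=
    ⟨∑ f : Fin s → Fin D → K, ρ f + 1, fun f =>
      Nat.lt_succ_of_le (Finset.single_le_sum (f := ρ) (fun _ _ => Nat.zero_le _) (Finset.mem_univ f))⟩
  let T : (Fin L → K) →ₗ[K] (Fin s → Fin D → K) :=
    { toFun := fun v i j => ∑ r, v r * C i j (c + r)
      map_add' := fun v v' => by
        funext i j
        simp [add_mul, Finset.sum_add_distrib]
      map_smul' := fun a v => by
        funext i j
        simp [Finset.mul_sum, mul_assoc] }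
  have hT : Function.Surjective T := by
    rw [← LinearMap.range_eq_top]
    -- A proper range lies in the kernel of a nonzero functional Λ, that is, in a relation among the
    -- rows on the columns from c on.
    by_contra hne
    obtain ⟨Λ, hΛ0, hΛ⟩ := Submodule.exists_le_ker_of_lt_top _ (lt_top_iff_ne_top.2 hne)
    let f : Fin s → Fin D → K := fun i j => Λ (Pi.single i (Pi.single j 1))
    have hΛf : ∀ Y, Λ Y = ∑ i, ∑ j, f i j * Y i j := fun Y => by
      have hY : Y = ∑ i, ∑ j, Y i j • Pi.single i (Pi.single j (1 : K)) := by
        funext i j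
        simp [Finset.sum_apply, Pi.single_apply, ite_apply]
      conv_lhs => rw [hY]
      simp only [map_sum, map_smul, smul_eq_mul, f]
      exact Finset.sum_congr rfl fun i _ => Finset.sum_congr rfl fun j _ => mul_comm _ _
    have hf0 : f ≠ 0 := by
      intro h
      refine hΛ0 (LinearMap.ext fun Y => ?_)
      rw [hΛf, h]
      simp
    refine hρ f hf0 ?_
    have h1 : Λ (T (Pi.single ⟨ρ f, hL f⟩ 1)) = 0 := hΛ (LinearMap.mem_range_self _ _)
    rw [hΛf] at h1
    rw [← h1]
    refine Finset.sum_congr rfl fun i _ => Finset.sum_congr rfl fun j _ => ?_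
    congr 1
    change _ = ∑ r, (Pi.single ⟨ρ f, hL f⟩ 1 : Fin L → K) r * C i j (c + r)
    rw [Finset.sum_eq_single ⟨ρ f, hL f⟩ (fun r _ hr => by simp [hr]) (by simp)]
    simp
  refine ⟨L, (Finset.univ.filter fun v => T v = 0).card,
    Finset.card_pos.2 ⟨0, by simp⟩, fun F => ?_⟩
  have h1 : ∀ k ∈ Finset.range (b ^ L), F (truncVec D (outVec φ C (k * b ^ c))) =
      F (T fun r => digitVec φ r k) := fun k hk => by
    congr 1
    funext i j
    exact outVec_mul_pow C hφ (Finset.mem_range.1 hk) c i j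
  rw [Finset.sum_congr rfl h1, sum_range_pow_digitVec L fun v => F (T v),
    ← Finset.sum_fiberwise Finset.univ T, Finset.mul_sum]
  refine Finset.sum_congr rfl fun Y _ => ?_
  rw [Finset.sum_congr rfl (g := fun _ => F Y) (fun v hv => by rw [(Finset.mem_filter.1 hv).2]),
    Finset.sum_const, nsmul_eq_mul]
  congr 2
  -- The fibres of a surjective linear map are cosets of its kernel and so have equal size.
  exact AddMonoidHom.card_fiber_eq_of_mem_range T (hT Y) (hT 0)

end Output

/-! ### Integer parts of digit expansions -/

section IntPart

variable {b : ℕ}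

/-- The integer with base `b` digits `a_0, …, a_{D-1}`, the leading one first. -/
def intPart (a : ℕ → Fin b) : ℕ → ℕ
  | 0 => 0
  | D + 1 => b * intPart a D + a D

theorem intPart_lt (a : ℕ → Fin b) (D : ℕ) : intPart a D < b ^ D := by
  induction D with
  | zero => simp [intPart]
  | succ D ih =>
    rw [intPart, pow_succ']
    have := (a D).2
    calc b * intPart a D + a D < b * intPart a D + b := by omega
      _ = b * (intPart a D + 1) := by ring
      _ ≤ b * b ^ D := Nat.mul_le_mul_left _ ih

theorem intPart_congr {a a' : ℕ → Fin b} {D : ℕ} (h : ∀ j < D, a j = a' j) :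
    intPart a D = intPart a' D := by
  induction D with
  | zero => rfl
  | succ D ih => rw [intPart, intPart, ih fun j hj => h j (by omega), h D (by omega)]

theorem intPart_succ_div (a : ℕ → Fin b) (D : ℕ) : intPart a (D + 1) / b = intPart a D := by
  rw [intPart, Nat.mul_add_div (Fin.pos (a 0)), Nat.div_eq_of_lt (a D).2, add_zero]

theorem intPart_succ_mod (a : ℕ → Fin b) (D : ℕ) : intPart a (D + 1) % b = a D := by
  rw [intPart, Nat.mul_add_mod, Nat.mod_eq_of_lt (a D).2]

theorem intPart_add_div (a : ℕ → Fin b) (D E : ℕ) : intPart a (D + E) / b ^ E = intPart a D := by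
  induction E with
  | zero => simp
  | succ E ih =>
    rw [← add_assoc, pow_succ', ← Nat.div_div_eq_div_mul, intPart_succ_div, ih]

theorem digit_intPart (a : ℕ → Fin b) {D j : ℕ} (hj : j < D) :
    intPart a D / b ^ (D - 1 - j) % b = a j := by
  obtain ⟨E, rfl⟩ := Nat.exists_eq_add_of_lt hj
  rw [show j + E + 1 - 1 - j = E by omega, show j + E + 1 = j + 1 + E by ring, intPart_add_div,
    intPart_succ_mod]

theorem eq_of_intPart_eq {a a' : ℕ → Fin b} {D : ℕ} (h : intPart a D = intPart a' D) :
    ∀ j < D, a j = a' j := fun j hj => by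
  have h1 := digit_intPart a hj
  rw [h, digit_intPart a' hj] at h1
  exact Fin.ext h1.symm

theorem ofDigits_mul_pow (a : ℕ → Fin b) (D : ℕ) :
    Real.ofDigits a * b ^ D = intPart a D + Real.ofDigits fun j => a (j + D) := by
  have hb : (b : ℝ) ≠ 0 := by exact_mod_cast (Fin.pos (a 0)).ne'
  have hsum : ∀ D, (∑ i ∈ Finset.range D, Real.ofDigitsTerm a i) * b ^ D = intPart a D := by
    intro D
    induction D with
    | zero => simp [intPart]
    | succ D ih =>
      rw [Finset.sum_range_succ, add_mul, pow_succ, ← mul_assoc, ih, Real.ofDigitsTerm, intPart]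
      push_cast
      field_simp
      ring
  rw [Real.ofDigits_eq_sum_add_ofDigits a D, add_mul, hsum]
  field_simp

theorem intPart_le_ofDigits (a : ℕ → Fin b) (D : ℕ) : (intPart a D : ℝ) ≤ Real.ofDigits a * b ^ D := by
  rw [ofDigits_mul_pow]
  linarith [Real.ofDigits_nonneg fun j => a (j + D)]

theorem ofDigits_le_intPart (a : ℕ → Fin b) (D : ℕ) :
    Real.ofDigits a * b ^ D ≤ intPart a D + 1 := by
  rw [ofDigits_mul_pow]
  linarith [Real.ofDigits_le_one fun j => a (j + D)]

variable {K : Type*} [Field K] [Fintype K] [NeZero b] (φ : Fin b ≃ K)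

/-- Extension by zero. -/
def zeroExtend {D : ℕ} (y : Fin D → K) (j : ℕ) : K := if h : j < D then y ⟨j, h⟩ else 0

omit [Fintype K] in
theorem zeroExtend_apply {D : ℕ} (y : Fin D → K) {j : ℕ} (h : j < D) :
    zeroExtend y j = y ⟨j, h⟩ := dif_pos h

omit [Fintype K] in
theorem zeroExtend_truncVec {s D : ℕ} (y : Fin s → ℕ → K) (i : Fin s) {j : ℕ} (h : j < D) :
    zeroExtend (truncVec D y i) j = y i j := zeroExtend_apply _ h

/-- The integer whose digits are given by a vector of elements of `K`. -/
def vecInt {D : ℕ} (y : Fin D → K) : ℕ := intPart (fun j => φ.symm (zeroExtend y j)) D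

omit [Fintype K] [NeZero b] in
theorem vecInt_lt {D : ℕ} (y : Fin D → K) : vecInt φ y < b ^ D := intPart_lt _ D

omit [Fintype K] [NeZero b] in
theorem vecInt_truncVec {s D : ℕ} (y : Fin s → ℕ → K) (i : Fin s) :
    vecInt φ (truncVec D y i) = intPart (fun j => φ.symm (y i j)) D :=
  intPart_congr fun j hj => by rw [zeroExtend_truncVec y i hj]

omit [Fintype K] in
theorem zeroExtend_eq_digitVec {D : ℕ} (y : Fin D → K) {j : ℕ} (hj : j < D) :
    zeroExtend y j = digitVec φ (D - 1 - j) (vecInt φ y) := by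
  rw [digitVec_mod, ← Equiv.symm_apply_eq]
  ext
  exact (digit_intPart (fun j => φ.symm (zeroExtend y j)) hj).symm

omit [NeZero b] in
/-- Summation over vectors, transported to integers. -/
theorem sum_vecInt {D : ℕ} {A : Type*} [AddCommMonoid A] (F : ℕ → A) :
    ∑ y : Fin D → K, F (vecInt φ y) = ∑ n ∈ Finset.range (b ^ D), F n := by
  rw [Finset.sum_range F]
  have hinj : Function.Injective fun y : Fin D → K => (⟨vecInt φ y, vecInt_lt φ y⟩ : Fin (b ^ D)) := by
    intro y y' h
    have h1 := eq_of_intPart_eq (congrArg Fin.val h)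
    funext j
    have := φ.symm.injective (h1 j j.2)
    rwa [zeroExtend_apply _ j.2, zeroExtend_apply _ j.2] at this
  have hbij := (Fintype.bijective_iff_injective_and_card _).2 ⟨hinj, by
    simp [← Fintype.card_congr φ]⟩
  exact Fintype.sum_bijective _ hbij _ _ fun y => rfl

end IntPart

end FnField

end

/-! ### Counting in boxes, and boundedness for sides with finite expansions. -/

noncomputable section

namespace FnField

theorem sum_translate {A : Type*} [AddGroup A] [Fintype A] (a : A) (F : A → ℝ) :
    ∑ x, F (a + x) = ∑ x, F x :=
  Fintype.sum_equiv (Equiv.addLeft a) _ _ fun _ => rfl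

section Box

variable {K : Type*} [Field K] {b : ℕ} (φ : Fin b ≃ K) {s : ℕ}

/-- The indicator function of a box with corner at the origin, on vectors of digits. -/
def boxIndicator {D : ℕ} (Γ : Fin s → ℕ) (Y : Fin s → Fin D → K) : ℝ :=
  ∏ i, if vecInt φ (Y i) < Γ i then 1 else 0

theorem boxIndicator_eq_ite {D : ℕ} (Γ : Fin s → ℕ) (Y : Fin s → Fin D → K) :
    boxIndicator φ Γ Y = if ∀ i, vecInt φ (Y i) < Γ i then 1 else 0 := by
  rw [boxIndicator, Finset.prod_ite_zero]
  simp

theorem boxIndicator_nonneg {D : ℕ} (Γ : Fin s → ℕ) (Y : Fin s → Fin D → K) :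
    0 ≤ boxIndicator φ Γ Y := by
  rw [boxIndicator_eq_ite]
  positivity

theorem boxIndicator_le_one {D : ℕ} (Γ : Fin s → ℕ) (Y : Fin s → Fin D → K) :
    boxIndicator φ Γ Y ≤ 1 := by
  rw [boxIndicator_eq_ite]
  split_ifs <;> norm_num

omit [Field K] in
theorem sum_prod_coordinates [Fintype K] {D : ℕ} (h : Fin s → (Fin D → K) → ℝ) :
    ∑ Y : Fin s → Fin D → K, ∏ i, h i (Y i) = ∏ i, ∑ y, h i y := by
  classical
  rw [Finset.prod_univ_sum, Fintype.piFinset_univ]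

theorem sum_ite_lt {N Γ : ℕ} (h : Γ ≤ N) :
    ∑ n ∈ Finset.range N, (if n < Γ then (1 : ℝ) else 0) = Γ := by
  rw [Finset.sum_boole]
  have : (Finset.range N).filter (· < Γ) = Finset.range Γ := by
    ext n
    simp only [Finset.mem_filter, Finset.mem_range]
    omega
  rw [this, Finset.card_range]

theorem sum_boxIndicator [Fintype K] {D : ℕ} {Γ : Fin s → ℕ} (hΓ : ∀ i, Γ i ≤ b ^ D) :
    ∑ Y : Fin s → Fin D → K, boxIndicator φ Γ Y = ∏ i, (Γ i : ℝ) := by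
  simp only [boxIndicator]
  rw [sum_prod_coordinates fun i y => if vecInt φ y < Γ i then (1 : ℝ) else 0]
  refine Finset.prod_congr rfl fun i _ => ?_
  rw [sum_vecInt φ fun n => if n < Γ i then (1 : ℝ) else 0, sum_ite_lt (hΓ i)]

include φ in
omit [Field K] in
theorem card_vectors [Fintype K] (D : ℕ) :
    (Fintype.card (Fin s → Fin D → K) : ℝ) = ∏ _i : Fin s, (b : ℝ) ^ D := by
  simp [← Fintype.card_congr φ]

theorem volume_real_box {γ : Fin s → ℝ} (hγ : ∀ i, 0 ≤ γ i) :
    MeasureTheory.volume.real (Set.univ.pi fun i => Set.Ico 0 (γ i)) = ∏ i, γ i := by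
  have := Real.volume_pi_Ico_toReal (a := fun _ : Fin s => (0 : ℝ)) (b := γ) hγ
  simpa [MeasureTheory.Measure.real] using this

theorem indicator_box {γ x : Fin s → ℝ} (hx : ∀ i, 0 ≤ x i) :
    (Set.univ.pi fun i => Set.Ico 0 (γ i)).indicator (fun _ => (1 : ℝ)) x =
      if ∀ i, x i < γ i then 1 else 0 := by
  classical
  rw [Set.indicator_apply]
  refine if_congr ?_ rfl rfl
  simp [hx]

end Box

section FiniteExpansion

theorem exists_intPart_of_finite_digits {b : ℕ} [NeZero b] (hb : 1 < b) {γ : ℝ}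
    (hγ : γ ∈ Set.Ico (0 : ℝ) 1) (hfin : {j : ℕ | Real.digits γ b j ≠ 0}.Finite) :
    ∃ D₀, ∀ D, D₀ ≤ D → γ * b ^ D = intPart (Real.digits γ b) D := by
  obtain ⟨B, hB⟩ := hfin.bddAbove
  refine ⟨B + 1, fun D hD => ?_⟩
  have h := ofDigits_mul_pow (Real.digits γ b) D
  rw [Real.ofDigits_digits hb hγ] at h
  have h0 : (fun j => Real.digits γ b (j + D)) = fun _ => 0 := by
    funext j
    by_contra hne
    have : j + D ≤ B := hB hne
    omega
  rw [h, h0]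
  simp [Real.ofDigits, Real.ofDigitsTerm]

/-- At most one digit expansion represents a given number without having the digits of the
truncations of that number. -/
theorem eq_of_ofDigits_eq_of_intPart_lt {b : ℕ} {a a' : ℕ → Fin b} {D Γ : ℕ}
    (ha : Real.ofDigits a * b ^ D = Γ) (ha' : Real.ofDigits a' * b ^ D = Γ)
    (hlt : intPart a D < Γ) (hlt' : intPart a' D < Γ) : a = a' := by
  have hb : 0 < b := Fin.pos (a 0)
  -- Such an expansion has every digit from index D on equal to b − 1, so its longer truncations are
  -- determined as well.
  have key : ∀ (a : ℕ → Fin b), Real.ofDigits a * b ^ D = Γ → intPart a D < Γ → ∀ E,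
      intPart a (D + E) + 1 = Γ * b ^ E := by
    intro a ha hlt E
    have h1 : intPart a (D + E) < Γ * b ^ E := by
      have := intPart_add_div a D E
      rw [← this, Nat.div_lt_iff_lt_mul (pow_pos hb E)] at hlt
      exact hlt
    have h2 := ofDigits_le_intPart a (D + E)
    rw [pow_add, ← mul_assoc, ha] at h2
    have h3 : Γ * b ^ E ≤ intPart a (D + E) + 1 := by exact_mod_cast h2
    omega
  funext j
  have h1 := key a ha hlt (j + 1)
  have h2 := key a' ha' hlt' (j + 1)
  exact eq_of_intPart_eq (D := D + (j + 1)) (by omega) j (by omega)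

theorem abs_sum_range_le_of_block_sum_zero {f : ℕ → ℝ} {B : ℕ} (hB : 0 < B) (hf : ∀ n, |f n| ≤ 1)
    (hblock : ∀ k, ∑ n ∈ Finset.range B, f (k * B + n) = 0) (N : ℕ) :
    |∑ n ∈ Finset.range N, f n| ≤ B := by
  have hq : ∀ q, ∑ n ∈ Finset.range (q * B), f n = 0 := by
    intro q
    induction q with
    | zero => simp
    | succ q ih => rw [add_mul, one_mul, Finset.sum_range_add, ih, hblock, add_zero]
  rw [← Nat.div_add_mod' N B, Finset.sum_range_add, hq, zero_add]
  refine (Finset.abs_sum_le_sum_abs _ _).trans ((Finset.sum_le_sum fun n _ => hf _).trans ?_)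
  simpa using (Nat.mod_lt N hB).le

variable {K : Type*} [Field K] {b : ℕ} [NeZero b] {φ : Fin b ≃ K} (hφ : φ 0 = 0) {s : ℕ}
  {C : Fin s → ℕ → ℕ → K}

include hφ in
/-- Boxes whose sides have finite expansions are bounded remainder sets. -/
theorem isBoundedRemainderSet_of_finite_digits
    (hrow : ∀ D (f : Fin s → ℕ → K),
      (∀ r, ∑ i, ∑ j ∈ Finset.range D, f i j * C i j r = 0) → ∀ i, ∀ j < D, f i j = 0)
    (hcol : ∀ (i : Fin s) (v : ℕ → K) (R : ℕ),
      (∀ j, ∑ r ∈ Finset.range R, v r * C i j r = 0) → ∀ r < R, v r = 0)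
    {γ : Fin s → ℝ} (hγ : ∀ i, γ i ∈ Set.Ioo (0 : ℝ) 1)
    (hfin : ∀ i, {j : ℕ | Real.digits (γ i) b j ≠ 0}.Finite) :
    IsBoundedRemainderSet (Set.univ.pi fun i => Set.Ico 0 (γ i)) (digitalSequence b φ C) := by
  classical
  have hb := one_lt_card_of_equiv φ
  have : Fintype K := Fintype.ofEquiv _ φ
  choose D₀ hD₀ using fun i => exists_intPart_of_finite_digits hb
    (Set.Ioo_subset_Ico_self (hγ i)) (hfin i)
  set D := ∑ i, D₀ i with hD
  let Γ : Fin s → ℕ := fun i => intPart (Real.digits (γ i) b) D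
  have hΓ : ∀ i, γ i * b ^ D = Γ i := fun i =>
    hD₀ i D (Finset.single_le_sum (f := D₀) (fun _ _ => Nat.zero_le _) (Finset.mem_univ i))
  have hbD : (0 : ℝ) < (b : ℝ) ^ D := by positivity
  obtain ⟨L, N₀, hN₀, hequi⟩ := sum_truncVec_outVec C hφ 0 D fun f hf =>
    hrow D f fun r => hf r (Nat.zero_le r)
  simp only [pow_zero, mul_one] at hequi
  set lam : ℝ := ∏ i, γ i with hlam
  have hlam0 : 0 ≤ lam := Finset.prod_nonneg fun i _ => (hγ i).1.le
  have hlam1 : lam ≤ 1 := Finset.prod_le_one (fun i _ => (hγ i).1.le) fun i _ => (hγ i).2.le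
  let f : ℕ → ℝ := fun n => boxIndicator φ Γ (truncVec D (outVec φ C n)) - lam
  have hf1 : ∀ n, |f n| ≤ 1 := fun n => by
    have h1 := boxIndicator_nonneg φ Γ (truncVec D (outVec φ C n))
    have h2 := boxIndicator_le_one φ Γ (truncVec D (outVec φ C n))
    rw [abs_le]
    constructor <;> simp only [f] <;> linarith
  -- The high digits of the index merely translate the output vectors, and translation preserves
  -- equidistribution.
  have hblock : ∀ k, ∑ n ∈ Finset.range (b ^ L), f (k * b ^ L + n) = 0 := by
    intro k
    have h1 : ∀ n ∈ Finset.range (b ^ L), f (k * b ^ L + n) =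
        boxIndicator φ Γ (truncVec D (outVec φ C (k * b ^ L)) + truncVec D (outVec φ C n)) - lam :=
      fun n hn => by
        simp only [f]
        rw [outVec_add C hφ (Finset.mem_range.1 hn), truncVec_add]
    rw [Finset.sum_congr rfl h1,
      hequi fun Y => boxIndicator φ Γ (truncVec D (outVec φ C (k * b ^ L)) + Y) - lam]
    rw [sum_translate _ fun Y => boxIndicator φ Γ Y - lam, Finset.sum_sub_distrib,
      sum_boxIndicator φ fun i => (intPart_lt _ D).le, Finset.sum_const, nsmul_eq_mul,
      Finset.card_univ, card_vectors φ, hlam, ← Finset.prod_mul_distrib]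
    rw [Finset.prod_congr rfl fun i _ => (hΓ i).symm]
    simp only [mul_comm, sub_self, mul_zero]
  -- Truncation to D digits misjudges a point only if its value lies exactly on the face while its
  -- truncation lies below it.
  have hbad : ∀ i, {n | intPart (fun j => φ.symm (outVec φ C n i j)) D < Γ i ∧
      Real.ofDigits (fun j => φ.symm (outVec φ C n i j)) * b ^ D = Γ i}.Subsingleton := by
    rintro i n ⟨h1, h2⟩ n' ⟨h1', h2'⟩
    refine outVec_injective C hφ i (hcol i) (funext fun j => ?_)
    exact φ.symm.injective (congrFun (eq_of_ofDigits_eq_of_intPart_lt h2 h2' h1 h1') j)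
  let Bad : Finset ℕ := (Set.finite_iUnion fun i => (hbad i).finite).toFinset
  have hgood : ∀ n ∉ Bad, (Set.univ.pi fun i => Set.Ico 0 (γ i)).indicator (fun _ => (1 : ℝ))
      (digitalSequence b φ C n) - lam = f n := by
    intro n hn
    rw [indicator_box (x := digitalSequence b φ C n) fun i => Real.ofDigits_nonneg _]
    simp only [f]
    rw [boxIndicator_eq_ite]
    congr 1
    refine if_congr (forall_congr' fun i => ?_) rfl rfl
    rw [vecInt_truncVec, digitalSequence_eq]
    have h1 := intPart_le_ofDigits (fun j => φ.symm (outVec φ C n i j)) D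
    have h2 := ofDigits_le_intPart (fun j => φ.symm (outVec φ C n i j)) D
    rw [← mul_lt_mul_iff_left₀ hbD, hΓ i]
    constructor
    · intro h
      exact_mod_cast h1.trans_lt h
    · intro h
      refine lt_of_le_of_ne (h2.trans (by exact_mod_cast h)) fun heq => hn ?_
      rw [Set.Finite.mem_toFinset, Set.mem_iUnion]
      exact ⟨i, h, heq⟩
  refine ⟨b ^ L + Bad.card, fun N => ?_⟩
  rw [volume_real_box fun i => (hγ i).1.le, ← hlam]
  have h1 := abs_sum_range_le_of_block_sum_zero (pow_pos (NeZero.pos b) L) hf1 hblock N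
  set h : ℕ → ℝ := fun n => (Set.univ.pi fun i => Set.Ico 0 (γ i)).indicator (fun _ => (1 : ℝ))
      (digitalSequence b φ C n) - lam with hh
  have h2 : |∑ n ∈ Finset.range N, (h n - f n)| ≤ Bad.card := by
    have hle : ∀ n, |h n - f n| ≤ if n ∈ Bad then 1 else 0 := fun n => by
      split_ifs with hn
      · simp only [hh, f, sub_sub_sub_cancel_right]
        have h3 := boxIndicator_nonneg φ Γ (truncVec D (outVec φ C n))
        have h4 := boxIndicator_le_one φ Γ (truncVec D (outVec φ C n))
        rw [indicator_box (x := digitalSequence b φ C n) fun i => Real.ofDigits_nonneg _, abs_le]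
        split_ifs <;> constructor <;> linarith
      · have : h n - f n = 0 := sub_eq_zero.2 (hgood n hn)
        rw [this, abs_zero]
    refine (Finset.abs_sum_le_sum_abs _ _).trans ((Finset.sum_le_sum fun n _ => hle n).trans ?_)
    rw [Finset.sum_boole]
    exact_mod_cast Finset.card_le_card fun n hn => (Finset.mem_filter.1 hn).2
  rw [Finset.sum_sub_distrib] at h2
  calc |∑ n ∈ Finset.range N, h n|
      = |(∑ n ∈ Finset.range N, h n - ∑ n ∈ Finset.range N, f n) + ∑ n ∈ Finset.range N, f n| := by
        rw [sub_add_cancel]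
    _ ≤ Bad.card + (b ^ L : ℕ) := (abs_add_le _ _).trans (add_le_add h2 h1)
    _ = b ^ L + Bad.card := by push_cast; ring

end FiniteExpansion

end FnField

end

noncomputable section

namespace FnField

/-! ### Positions where an infinite expansion is not close to terminating -/

section Positions

variable {b : ℕ} [NeZero b] (hb : 1 < b) {γ : ℝ} (hγ : 0 ≤ γ)

include hγ in
theorem digits_eq_zero_of_fract_eq_zero {n j : ℕ} (h : Int.fract (γ * b ^ n) = 0) (hj : n ≤ j) :
    Real.digits γ b j = 0 := by
  obtain ⟨c, rfl⟩ := Nat.exists_eq_add_of_le hj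
  have hfl : γ * b ^ n = ⌊γ * b ^ n⌋₊ := by
    rw [natCast_floor_eq_intCast_floor (by positivity)]
    have := Int.floor_add_fract (γ * b ^ n)
    rw [h, add_zero] at this
    exact this.symm
  have h1 : γ * b ^ (n + c + 1) = ((b * (⌊γ * b ^ n⌋₊ * b ^ c) : ℕ) : ℝ) := by
    push_cast
    rw [← hfl]
    ring
  ext
  rw [Real.digits, h1, Nat.floor_natCast]
  simp

omit [NeZero b] in
theorem fract_mul_natCast_fract (x : ℝ) : Int.fract (x * b) = Int.fract (Int.fract x * b) := by
  conv_lhs => rw [← Int.floor_add_fract x]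
  rw [add_mul]
  have : ((⌊x⌋ : ℝ) * b) = ((⌊x⌋ * b : ℤ) : ℝ) := by push_cast; rfl
  rw [this, Int.fract_intCast_add]

omit [NeZero b] in
include hb in
theorem eq_zero_of_forall_mul_pow_lt {x : ℝ} (hx : 0 ≤ x) (h : ∀ j : ℕ, x * b ^ j < 1) : x = 0 := by
  by_contra hne
  have hx0 : 0 < x := lt_of_le_of_ne hx (Ne.symm hne)
  obtain ⟨j, hj⟩ := pow_unbounded_of_one_lt x⁻¹ (show (1 : ℝ) < b by exact_mod_cast hb)
  have := h j
  rw [inv_lt_iff_one_lt_mul₀ hx0] at hj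
  linarith [mul_comm x ((b : ℝ) ^ j)]

include hb hγ in
/-- If the expansion of `γ` is infinite, then the fractional part of `γ b^d` is bounded away from
the integers for infinitely many `d`. -/
theorem exists_fract_mem_Icc (hinf : {j : ℕ | Real.digits γ b j ≠ 0}.Infinite) (n : ℕ) :
    ∃ d, n ≤ d ∧ 1 / (b : ℝ) ^ 2 ≤ Int.fract (γ * b ^ d) ∧
      Int.fract (γ * b ^ d) ≤ 1 - 1 / (b : ℝ) ^ 2 := by
  by_contra! hcon
  have hb2 : (2 : ℝ) ≤ b := by exact_mod_cast hb
  have hb0 : (0 : ℝ) < b := by linarith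
  -- With δ = b⁻², one multiplication by b carries a distance less than δ to less than 1/b ≤ 1/2, so
  -- the orbit cannot pass from the neighbourhood of 0 to that of 1 or back.
  set δ : ℝ := 1 / (b : ℝ) ^ 2 with hδ
  have hδb : b * δ = 1 / b := by rw [hδ]; field_simp
  have h1b : 1 / (b : ℝ) ≤ 1 / 2 := by
    apply one_div_le_one_div_of_le <;> linarith
  have hδ4 : δ ≤ 1 / 4 := by
    rw [hδ]
    apply one_div_le_one_div_of_le <;> nlinarith
  let θ : ℕ → ℝ := fun j => Int.fract (γ * b ^ (n + j))
  have hstep : ∀ j, θ (j + 1) = Int.fract (θ j * b) := fun j => by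
    simp only [θ]
    rw [← add_assoc, pow_succ, ← mul_assoc, fract_mul_natCast_fract]
  have hθ : ∀ j, θ j < δ ∨ 1 - δ < θ j := fun j => by
    by_cases h : θ j < δ
    · exact Or.inl h
    · exact Or.inr (hcon (n + j) (by omega) (not_lt.1 h))
  have hθ0 : ∀ j, 0 ≤ θ j := fun j => Int.fract_nonneg _
  have hθ1 : ∀ j, θ j < 1 := fun j => Int.fract_lt_one _
  rcases hθ 0 with h0 | h0
  -- Near 0 there is no wrap-around; a bounded geometric growth forces θ_0 = 0, so the expansion
  -- terminates.
  · have key : ∀ j, θ j = θ 0 * b ^ j ∧ θ j < δ := by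
      intro j
      induction j with
      | zero => simpa using h0
      | succ j ih =>
        have hlt : θ j * b < 1 / b := by
          rw [← hδb, mul_comm]
          exact mul_lt_mul_of_pos_left ih.2 hb0
        have heq : θ (j + 1) = θ j * b := by
          rw [hstep, Int.fract_eq_self]
          exact ⟨mul_nonneg (hθ0 j) hb0.le, by linarith⟩
        refine ⟨by rw [heq, ih.1, pow_succ]; ring, ?_⟩
        rcases hθ (j + 1) with h | h
        · exact h
        · linarith
    have hz : θ 0 = 0 := eq_zero_of_forall_mul_pow_lt hb (hθ0 0) fun j => by
      rw [← (key j).1]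
      exact hθ1 j
    refine hinf ((Set.finite_Iio n).subset fun j hj => ?_)
    by_contra hle
    exact hj (digits_eq_zero_of_fract_eq_zero hγ hz (not_lt.1 hle))
  -- Near 1 the same growth applies to 1 − θ, giving θ_0 = 1, which a fractional part never equals.
  · have key : ∀ j, 1 - θ j = (1 - θ 0) * b ^ j ∧ 1 - θ j < δ := by
      intro j
      induction j with
      | zero => exact ⟨by simp, by linarith⟩
      | succ j ih =>
        have hlt : (1 - θ j) * b < 1 / b := by
          rw [← hδb, mul_comm]
          exact mul_lt_mul_of_pos_left ih.2 hb0
        have hpos : 0 < (1 - θ j) * b := mul_pos (by linarith [hθ1 j]) hb0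
        have heq : θ (j + 1) = 1 - (1 - θ j) * b := by
          rw [hstep, Int.fract_eq_iff]
          exact ⟨by linarith, by linarith, (b : ℤ) - 1, by push_cast; ring⟩
        refine ⟨by rw [heq, sub_sub_cancel, ih.1, pow_succ]; ring, ?_⟩
        rcases hθ (j + 1) with h | h
        · linarith
        · linarith
    have hz : 1 - θ 0 = 0 := eq_zero_of_forall_mul_pow_lt hb (by linarith [hθ1 0]) fun j => by
      rw [← (key j).1]
      linarith [(key j).2]
    linarith [hθ1 0]

include hγ in
-- In units of b^{−(d+E+2)}, the last incomplete block of length b^{E+2} below γ is neither nearly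
-- empty nor nearly full. This is the input for `exists_digitCount_gap`.
theorem floor_eq_of_fract_mem_Icc {d E : ℕ} (h1 : 1 / (b : ℝ) ^ 2 ≤ Int.fract (γ * b ^ d))
    (h2 : Int.fract (γ * b ^ d) ≤ 1 - 1 / (b : ℝ) ^ 2) :
    ∃ q rem, ⌊γ * b ^ (d + E + 2)⌋₊ = q * b ^ (E + 2) + rem ∧ b ^ E ≤ rem ∧
      rem + b ^ E ≤ b ^ (E + 2) := by
  have hb0 : (0 : ℝ) < b := by exact_mod_cast NeZero.pos b
  set θ := Int.fract (γ * b ^ d) with hθ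
  have hsplit : γ * b ^ (d + E + 2) = θ * b ^ (E + 2) + ((⌊γ * b ^ d⌋₊ * b ^ (E + 2) : ℕ) : ℝ) := by
    push_cast
    rw [natCast_floor_eq_intCast_floor (by positivity)]
    rw [← add_mul, hθ, Int.fract_add_floor]
    ring
  have hbE : 1 / (b : ℝ) ^ 2 * b ^ (E + 2) = b ^ E := by
    field_simp
    ring
  have hθ0 : 0 ≤ θ * b ^ (E + 2) := mul_nonneg (Int.fract_nonneg _) (by positivity)
  refine ⟨⌊γ * b ^ d⌋₊, ⌊θ * b ^ (E + 2)⌋₊, ?_, ?_, ?_⟩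
  · rw [hsplit, Nat.floor_add_natCast hθ0, add_comm]
  · refine Nat.le_floor ?_
    push_cast
    rw [← hbE]
    gcongr
  · have h3 : θ * b ^ (E + 2) ≤ b ^ (E + 2) - b ^ E := by
      rw [← hbE, ← one_sub_mul]
      gcongr
    have h4 := Nat.floor_le hθ0
    have h5 : ((⌊θ * b ^ (E + 2)⌋₊ + b ^ E : ℕ) : ℝ) ≤ (b ^ (E + 2) : ℕ) := by
      push_cast
      linarith
    exact_mod_cast h5

end Positions

/-! ### Counting integers with a prescribed digit condition -/

section Count

variable {K : Type*} [Field K] [Fintype K] [DecidableEq K] {b : ℕ} [NeZero b] (φ : Fin b ≃ K)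

theorem sum_range_mul_eq {A : Type*} [AddCommMonoid A] (f : ℕ → A) (q B : ℕ) :
    ∑ n ∈ Finset.range (q * B), f n = ∑ a ∈ Finset.range q, ∑ r ∈ Finset.range B, f (a * B + r) := by
  induction q with
  | zero => simp
  | succ q ih => rw [add_mul, one_mul, Finset.sum_range_add, ih, Finset.sum_range_succ]

/-- Number of `X < Γ` with `p(⌊X / b^(E+1)⌋) + φ(digit of index E of X) = c`. -/
def digitCount (p : ℕ → K) (E Γ : ℕ) (c : K) : ℝ :=
  ∑ X ∈ Finset.range Γ, if p (X / b ^ (E + 1)) + digitVec φ E X = c then 1 else 0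

omit [Field K] [Fintype K] [DecidableEq K] in
theorem digitVec_mul_add {E a r : ℕ} (ha : a < b) (hr : r < b ^ E) :
    digitVec φ E (a * b ^ E + r) = φ ⟨a, ha⟩ := by
  rw [digitVec_mod]
  congr 1
  ext
  simp only
  rw [mul_comm, Nat.mul_add_div (pow_pos (NeZero.pos b) E), Nat.div_eq_of_lt hr, add_zero,
    Nat.mod_eq_of_lt ha]

omit [Fintype K] in
theorem sum_block_digit (E : ℕ) (c₀ c : K) :
    ∑ X ∈ Finset.range (b ^ (E + 1)), (if c₀ + digitVec φ E X = c then (1 : ℝ) else 0) = b ^ E := by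
  rw [pow_succ', sum_range_mul_eq, Finset.sum_range]
  have h : ∀ a : Fin b, ∑ r ∈ Finset.range (b ^ E),
      (if c₀ + digitVec φ E (a * b ^ E + r) = c then (1 : ℝ) else 0) =
      if a = φ.symm (c - c₀) then (b : ℝ) ^ E else 0 := fun a => by
    rw [Finset.sum_congr rfl (g := fun _ => if a = φ.symm (c - c₀) then (1 : ℝ) else 0)]
    · simp
    · intro r hr
      rw [digitVec_mul_add φ a.2 (Finset.mem_range.1 hr)]
      refine if_congr ?_ rfl rfl
      rw [Equiv.eq_symm_apply, eq_sub_iff_add_eq, add_comm]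
  rw [Finset.sum_congr rfl fun a _ => h a]
  simp

omit [Fintype K] in
-- In a full block of length b^{E+1} the term p is constant and the digit takes each value b^E
-- times. Only the incomplete block depends on c.
theorem digitCount_eq (p : ℕ → K) (E q : ℕ) {rem : ℕ} (hrem : rem ≤ b ^ (E + 1)) (c : K) :
    digitCount φ p E (q * b ^ (E + 1) + rem) c = q * b ^ E +
      ∑ X ∈ Finset.range rem, if p q + digitVec φ E X = c then (1 : ℝ) else 0 := by
  have hdig : ∀ a, ∀ X < b ^ (E + 1), p ((a * b ^ (E + 1) + X) / b ^ (E + 1)) +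
      digitVec φ E (a * b ^ (E + 1) + X) = p a + digitVec φ E X := fun a X hX => by
    have hpos := pow_pos (NeZero.pos b) (E + 1)
    congr 1
    · rw [mul_comm, Nat.mul_add_div hpos, Nat.div_eq_of_lt hX, add_zero]
    · refine digitVec_congr φ ?_
      rw [show a * b ^ (E + 1) + X = X + b ^ E * (b * a) by ring,
        Nat.add_mul_div_left _ _ (pow_pos (NeZero.pos b) E), Nat.add_mul_mod_self_left]
  rw [digitCount, Finset.sum_range_add, sum_range_mul_eq]
  congr 1
  · have : ∀ a ∈ Finset.range q, ∑ r ∈ Finset.range (b ^ (E + 1)),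
        (if p ((a * b ^ (E + 1) + r) / b ^ (E + 1)) + digitVec φ E (a * b ^ (E + 1) + r) = c
          then (1 : ℝ) else 0) = b ^ E := fun a _ => by
      rw [← sum_block_digit φ E (p a) c]
      exact Finset.sum_congr rfl fun X hX => by rw [hdig a X (Finset.mem_range.1 hX)]
    rw [Finset.sum_congr rfl this]
    simp
  · exact Finset.sum_congr rfl fun X hX => by
      rw [hdig q X ((Finset.mem_range.1 hX).trans_le hrem)]

omit [Fintype K] in
theorem partial_sum_nonneg (c₀ c : K) (E rem : ℕ) :
    0 ≤ ∑ X ∈ Finset.range rem, (if c₀ + digitVec φ E X = c then (1 : ℝ) else 0) :=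
  Finset.sum_nonneg fun _ _ => by positivity

omit [Fintype K] in
theorem abs_digitCount_sub_le (p : ℕ → K) (E q : ℕ) {rem : ℕ} (hrem : rem ≤ b ^ (E + 1))
    (c c' : K) : |digitCount φ p E (q * b ^ (E + 1) + rem) c -
      digitCount φ p E (q * b ^ (E + 1) + rem) c'| ≤ b ^ E := by
  rw [digitCount_eq φ p E q hrem, digitCount_eq φ p E q hrem, add_sub_add_left_eq_sub]
  have hle : ∀ c, ∑ X ∈ Finset.range rem, (if p q + digitVec φ E X = c then (1 : ℝ) else 0) ≤
      b ^ E := fun c => by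
    rw [← sum_block_digit φ E (p q) c]
    exact Finset.sum_le_sum_of_subset_of_nonneg (Finset.range_subset_range.2 hrem)
      fun _ _ _ => by positivity
  rw [abs_le]
  have h1 := hle c
  have h2 := hle c'
  have h3 := partial_sum_nonneg φ (p q) c E rem
  have h4 := partial_sum_nonneg φ (p q) c' E rem
  constructor <;> linarith

omit [Fintype K] in
-- In the incomplete block digits are filled in increasing order, so digit 0 is ahead of digit b − 1
-- by at least the margin b^E.
theorem exists_digitCount_gap (p : ℕ → K) (E q : ℕ) {rem : ℕ} (hrem₁ : b ^ E ≤ rem)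
    (hrem₂ : rem + b ^ E ≤ b ^ (E + 2)) :
    ∃ α β : K, (b : ℝ) ^ E ≤ digitCount φ p (E + 1) (q * b ^ (E + 2) + rem) α -
      digitCount φ p (E + 1) (q * b ^ (E + 2) + rem) β := by
  have hb := one_lt_card_of_equiv φ
  have hpos := pow_pos (NeZero.pos b) (E + 1)
  refine ⟨p q + φ 0, p q + φ ⟨b - 1, by omega⟩, ?_⟩
  have hrem : rem ≤ b ^ (E + 1 + 1) := (Nat.le_add_right _ _).trans hrem₂
  have hEE : b ^ (E + 2) = b ^ (E + 1 + 1) := rfl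
  rw [hEE, digitCount_eq φ p (E + 1) q hrem, digitCount_eq φ p (E + 1) q hrem,
    add_sub_add_left_eq_sub]
  have hlow : ((min rem (b ^ (E + 1)) : ℕ) : ℝ) ≤
      ∑ X ∈ Finset.range rem, (if p q + digitVec φ (E + 1) X = p q + φ 0 then (1 : ℝ) else 0) := by
    calc ((min rem (b ^ (E + 1)) : ℕ) : ℝ) = ∑ X ∈ Finset.range (min rem (b ^ (E + 1))), (1 : ℝ) := by
          simp
      _ = ∑ X ∈ Finset.range (min rem (b ^ (E + 1))),
          (if p q + digitVec φ (E + 1) X = p q + φ 0 then (1 : ℝ) else 0) := by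
          refine Finset.sum_congr rfl fun X hX => ?_
          rw [if_pos]
          have hX' : X < b ^ (E + 1) := (Finset.mem_range.1 hX).trans_le (min_le_right _ _)
          have := digitVec_mul_add φ (E := E + 1) (NeZero.pos b) hX'
          rw [zero_mul, zero_add] at this
          rw [this]
          rfl
      _ ≤ _ := Finset.sum_le_sum_of_subset_of_nonneg
          (Finset.range_subset_range.2 (min_le_left _ _)) fun _ _ _ => by positivity
  have hup : ∑ X ∈ Finset.range rem,
      (if p q + digitVec φ (E + 1) X = p q + φ ⟨b - 1, by omega⟩ then (1 : ℝ) else 0) ≤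
      ((rem - (b - 1) * b ^ (E + 1) : ℕ) : ℝ) := by
    rw [Finset.sum_boole]
    have hsub : (Finset.range rem).filter
        (fun X => p q + digitVec φ (E + 1) X = p q + φ ⟨b - 1, by omega⟩) ⊆
        Finset.Ico ((b - 1) * b ^ (E + 1)) rem := by
      intro X hX
      rw [Finset.mem_filter, Finset.mem_range] at hX
      have h1 := φ.injective (add_left_cancel hX.2)
      rw [Fin.ext_iff] at h1
      have h2 : X / b ^ (E + 1) % b = b - 1 := h1
      have h3 : b - 1 ≤ X / b ^ (E + 1) := h2 ▸ Nat.mod_le _ _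
      rw [Nat.le_div_iff_mul_le hpos] at h3
      exact Finset.mem_Ico.2 ⟨h3, hX.1⟩
    have := Finset.card_le_card hsub
    rw [Nat.card_Ico] at this
    exact_mod_cast this
  have hfin : b ^ E + (rem - (b - 1) * b ^ (E + 1)) ≤ min rem (b ^ (E + 1)) := by
    have h1 : (b - 1) * b ^ (E + 1) + b ^ (E + 1) = b ^ (E + 2) := by
      rw [← Nat.succ_mul, Nat.succ_eq_add_one, Nat.sub_add_cancel (by omega), pow_succ' b (E + 1)]
    have h2 : b ^ E ≤ b ^ (E + 1) := Nat.pow_le_pow_right (by omega) (by omega)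
    have h3 : b ^ (E + 1) ≤ (b - 1) * b ^ (E + 1) := Nat.le_mul_of_pos_left _ (by omega)
    omega
  have hfin' : (b : ℝ) ^ E + ((rem - (b - 1) * b ^ (E + 1) : ℕ) : ℝ) ≤
      ((min rem (b ^ (E + 1)) : ℕ) : ℝ) := by exact_mod_cast hfin
  linarith

end Count

/-! ### Linear functionals on digit vectors -/

section Functional

variable {K : Type*} [Field K] {b : ℕ} [NeZero b] (φ : Fin b ≃ K) {s : ℕ}

/-- The functional `y ↦ ∑_{j ≤ d} f_j y_j`. -/
def rowFunctional (f : ℕ → K) (d : ℕ) (y : ℕ → K) : K := ∑ j ∈ Finset.range (d + 1), f j * y j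

theorem rowFunctional_add (f : ℕ → K) (d : ℕ) (y y' : ℕ → K) :
    rowFunctional f d (y + y') = rowFunctional f d y + rowFunctional f d y' := by
  simp [rowFunctional, mul_add, Finset.sum_add_distrib]

theorem rowFunctional_congr (f : ℕ → K) {d : ℕ} {y y' : ℕ → K} (h : ∀ j ≤ d, y j = y' j) :
    rowFunctional f d y = rowFunctional f d y' :=
  Finset.sum_congr rfl fun j hj => by rw [h j (Nat.lt_succ_iff.1 (Finset.mem_range.1 hj))]

theorem zeroExtend_add {D : ℕ} (y y' : Fin D → K) :
    zeroExtend (y + y') = zeroExtend y + zeroExtend y' := by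
  funext j
  by_cases h : j < D <;> simp [zeroExtend, h]

theorem zeroExtend_single {D d : ℕ} (h : d < D) (t : K) :
    zeroExtend (Pi.single (⟨d, h⟩ : Fin D) t) = Pi.single d t := by
  funext j
  by_cases hj : j < D
  · rw [zeroExtend_apply _ hj]
    simp [Pi.single_apply, Fin.ext_iff]
  · rw [zeroExtend, dif_neg hj, Pi.single_eq_of_ne (by omega)]

theorem rowFunctional_single_self {f : ℕ → K} {d : ℕ} (hf : f d = 1) (t : K) :
    rowFunctional f d (Pi.single d t) = t := by
  rw [rowFunctional, Finset.sum_eq_single d (fun j _ hj => by simp [hj]) (by simp)]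
  simp [hf]

theorem rowFunctional_single_of_lt (f : ℕ → K) {d d' : ℕ} (h : d < d') (t : K) :
    rowFunctional f d (Pi.single d' t) = 0 :=
  Finset.sum_eq_zero fun j hj => by
    rw [Pi.single_eq_of_ne (by rw [Finset.mem_range] at hj; omega), mul_zero]

/-- As f_d = 1, the functional is the digit of index d shifted by a function of the more significant
digits. This is the condition counted by `digitCount`. -/
theorem rowFunctional_eq_digit {f : ℕ → K} {d E : ℕ} (hf : f d = 1) (y : Fin (d + E + 1) → K) :
    rowFunctional f d (zeroExtend y) =
      (fun Q => ∑ j ∈ Finset.range d, f j * digitVec φ (d - 1 - j) Q) (vecInt φ y / b ^ (E + 1)) +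
        digitVec φ E (vecInt φ y) := by
  rw [rowFunctional, Finset.sum_range_succ, hf, one_mul, zeroExtend_eq_digitVec φ y (by omega),
    show d + E + 1 - 1 - d = E by omega]
  congr 1
  refine Finset.sum_congr rfl fun j hj => ?_
  rw [Finset.mem_range] at hj
  rw [zeroExtend_eq_digitVec φ y (by omega)]
  congr 1
  refine digitVec_congr φ ?_
  rw [Nat.div_div_eq_div_mul, ← pow_add, show E + 1 + (d - 1 - j) = d + E + 1 - 1 - j by omega]

variable [Fintype K] [DecidableEq K]

theorem sum_ite_mul_rowFunctional {f : ℕ → K} {d E Γ : ℕ} (hf : f d = 1)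
    (hΓ : Γ ≤ b ^ (d + E + 1)) (c : K) :
    ∑ y : Fin (d + E + 1) → K, (if vecInt φ y < Γ then (1 : ℝ) else 0) *
      (if rowFunctional f d (zeroExtend y) = c then 1 else 0) =
    digitCount φ (fun Q => ∑ j ∈ Finset.range d, f j * digitVec φ (d - 1 - j) Q) E Γ c := by
  simp only [rowFunctional_eq_digit φ hf]
  rw [sum_vecInt φ fun X => (if X < Γ then (1 : ℝ) else 0) *
    (if (∑ j ∈ Finset.range d, f j * digitVec φ (d - 1 - j) (X / b ^ (E + 1))) + digitVec φ E X = c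
      then 1 else 0), digitCount]
  obtain ⟨e, he⟩ := Nat.exists_eq_add_of_le hΓ
  rw [he, Finset.sum_range_add, Finset.sum_eq_zero (s := Finset.range e) fun X _ => by
    rw [if_neg (by omega), zero_mul], add_zero]
  exact Finset.sum_congr rfl fun X hX => by rw [if_pos (Finset.mem_range.1 hX), one_mul]

/-- The correlation of a box with a linear functional of the digits in one coordinate. -/
theorem sum_boxIndicator_mul_ite (i₀ : Fin s) {f : ℕ → K} {d E : ℕ} (hf : f d = 1) {Γ : Fin s → ℕ}
    (hΓ : ∀ i, Γ i ≤ b ^ (d + E + 1)) (c : K) :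
    ∑ Y : Fin s → Fin (d + E + 1) → K, boxIndicator φ Γ Y *
      (if rowFunctional f d (zeroExtend (Y i₀)) = c then 1 else 0) =
    (∏ i ∈ Finset.univ.erase i₀, (Γ i : ℝ)) *
      digitCount φ (fun Q => ∑ j ∈ Finset.range d, f j * digitVec φ (d - 1 - j) Q) E (Γ i₀) c := by
  let h : Fin s → (Fin (d + E + 1) → K) → ℝ := fun i y => (if vecInt φ y < Γ i then (1 : ℝ) else 0) *
    (if i = i₀ then (if rowFunctional f d (zeroExtend y) = c then 1 else 0) else 1)
  have h1 : ∀ Y : Fin s → Fin (d + E + 1) → K, boxIndicator φ Γ Y *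
      (if rowFunctional f d (zeroExtend (Y i₀)) = c then 1 else 0) = ∏ i, h i (Y i) := fun Y => by
    simp only [h]
    rw [Finset.prod_mul_distrib, Finset.prod_ite_eq' Finset.univ i₀ fun i =>
      if rowFunctional f d (zeroExtend (Y i)) = c then (1 : ℝ) else 0, if_pos (Finset.mem_univ _)]
    rfl
  rw [Finset.sum_congr rfl fun Y _ => h1 Y, sum_prod_coordinates h,
    ← Finset.mul_prod_erase _ _ (Finset.mem_univ i₀), mul_comm]
  congr 1
  · refine Finset.prod_congr rfl fun i hi => ?_
    simp only [h, if_neg (Finset.ne_of_mem_erase hi), mul_one]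
    rw [sum_vecInt φ fun n => if n < Γ i then (1 : ℝ) else 0, sum_ite_lt (hΓ i)]
  · simp only [h, if_true]
    exact sum_ite_mul_rowFunctional φ hf (hΓ i₀) c

omit [DecidableEq K] in
/-- Orthogonality to functions that do not depend on the digit of index `d`. -/
theorem sum_rowFunctional_mul_eq_zero (i₀ : Fin s) {f : ℕ → K} {d D : ℕ} (hd : d < D) (hf : f d = 1)
    {ρ : K → ℝ} (hρ : ∑ x, ρ x = 0) (H : (Fin s → Fin D → K) → ℝ)
    (hH : ∀ (t : K) Y, H (Pi.single i₀ (Pi.single ⟨d, hd⟩ t) + Y) = H Y) :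
    ∑ Y, ρ (rowFunctional f d (zeroExtend (Y i₀))) * H Y = 0 := by
  -- Translating the digit of index d by t shifts the functional by t and leaves H fixed; averaging
  -- over t then brings in the vanishing sum of ρ.
  have h1 : ∀ t : K, ∑ Y : Fin s → Fin D → K, ρ (t + rowFunctional f d (zeroExtend (Y i₀))) * H Y =
      ∑ Y, ρ (rowFunctional f d (zeroExtend (Y i₀))) * H Y := fun t => by
    rw [← sum_translate (Pi.single i₀ (Pi.single ⟨d, hd⟩ t)) fun Y : Fin s → Fin D → K =>
      ρ (rowFunctional f d (zeroExtend (Y i₀))) * H Y]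
    refine Finset.sum_congr rfl fun Y _ => ?_
    rw [hH, Pi.add_apply, Pi.single_eq_same, zeroExtend_add, zeroExtend_single, rowFunctional_add,
      rowFunctional_single_self hf]
  have h2 : ∑ t : K, ∑ Y : Fin s → Fin D → K,
      ρ (t + rowFunctional f d (zeroExtend (Y i₀))) * H Y = 0 := by
    rw [Finset.sum_comm]
    refine Finset.sum_eq_zero fun Y _ => ?_
    rw [← Finset.sum_mul]
    have := sum_translate (rowFunctional f d (zeroExtend (Y i₀))) ρ
    simp only [add_comm _ (rowFunctional f d (zeroExtend (Y i₀)))]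
    rw [this, hρ, zero_mul]
  rw [Finset.sum_congr rfl fun t _ => h1 t, Finset.sum_const, nsmul_eq_mul] at h2
  exact (mul_eq_zero.1 h2).resolve_left (by simp)

end Functional

end FnField

end

/-! ### Correlation of the box with a single functional along the sequence. -/

noncomputable section

namespace FnField

section RowCombination

variable {K : Type*} [Field K] {b : ℕ} [NeZero b] {φ : Fin b ≃ K} (hφ : φ 0 = 0) {s : ℕ}
  (C : Fin s → ℕ → ℕ → K) (f : ℕ → K) (d : ℕ) (i : Fin s)

include hφ in
theorem rowFunctional_outVec {L n : ℕ} (hn : n < b ^ L) :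
    rowFunctional f d (outVec φ C n i) =
      ∑ r ∈ Finset.range L, digitVec φ r n * rowFunctional f d fun j => C i j r := by
  simp only [rowFunctional, Finset.mul_sum]
  rw [Finset.sum_comm]
  refine Finset.sum_congr rfl fun j _ => ?_
  rw [outVec_eq_sum C hφ hn, Finset.mul_sum]
  exact Finset.sum_congr rfl fun r _ => by ring

include hφ in
theorem rowFunctional_outVec_add {M n : ℕ} (hn : n < b ^ M) (k : ℕ) :
    rowFunctional f d (outVec φ C (k * b ^ M + n) i) =
      rowFunctional f d (outVec φ C (k * b ^ M) i) + rowFunctional f d (outVec φ C n i) := by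
  rw [outVec_add C hφ hn, Pi.add_apply, rowFunctional_add]

variable {f d i} {t : ℕ} (h0 : ∀ r < t, rowFunctional f d (fun j => C i j r) = 0)

include hφ h0 in
theorem rowFunctional_outVec_eq_zero {n : ℕ} (hn : n < b ^ t) :
    rowFunctional f d (outVec φ C n i) = 0 := by
  rw [rowFunctional_outVec hφ C f d i hn]
  exact Finset.sum_eq_zero fun r hr => by rw [h0 r (Finset.mem_range.1 hr), mul_zero]

include hφ h0 in
theorem rowFunctional_outVec_digit {a r : ℕ} (ha : a < b) (hr : r < b ^ t) :
    rowFunctional f d (outVec φ C (a * b ^ t + r) i) =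
      φ ⟨a, ha⟩ * rowFunctional f d fun j => C i j t := by
  have hn : a * b ^ t + r < b ^ (t + 1) := by
    rw [pow_succ']
    calc a * b ^ t + r < (a + 1) * b ^ t := by rw [add_mul, one_mul]; omega
      _ ≤ b * b ^ t := Nat.mul_le_mul_right _ ha
  rw [rowFunctional_outVec hφ C f d i hn, Finset.sum_range_succ, digitVec_mul_add φ ha hr,
    Finset.sum_eq_zero fun r hr => by rw [h0 r (Finset.mem_range.1 hr), mul_zero], zero_add]

variable [Fintype K] (ht : rowFunctional f d (fun j => C i j t) ≠ 0) {h : K → ℝ}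
  (hh : ∑ x, h x = 0)

include hφ h0 ht hh in
-- The input digits below t do not affect the functional, while the digit of index t enters with a
-- nonzero factor. Over an aligned block each value in K is therefore taken b^t times.
theorem sum_block_rowFunctional (k : ℕ) :
    ∑ n ∈ Finset.range (b ^ (t + 1)),
      h (rowFunctional f d (outVec φ C (k * b ^ (t + 1) + n) i)) = 0 := by
  set c := rowFunctional f d (outVec φ C (k * b ^ (t + 1)) i)
  have h1 : ∀ n ∈ Finset.range (b ^ (t + 1)),
      h (rowFunctional f d (outVec φ C (k * b ^ (t + 1) + n) i)) =
      h (c + rowFunctional f d (outVec φ C n i)) := fun n hn => by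
    rw [rowFunctional_outVec_add hφ C f d i (Finset.mem_range.1 hn)]
  rw [Finset.sum_congr rfl h1, pow_succ', sum_range_mul_eq, Finset.sum_range]
  have h2 : ∀ a : Fin b, ∑ r ∈ Finset.range (b ^ t),
      h (c + rowFunctional f d (outVec φ C (a * b ^ t + r) i)) =
      b ^ t * h (c + φ a * rowFunctional f d fun j => C i j t) := fun a => by
    rw [Finset.sum_congr rfl fun r hr => by
      rw [rowFunctional_outVec_digit hφ C h0 a.2 (Finset.mem_range.1 hr)]]
    simp
  rw [Finset.sum_congr rfl fun a _ => h2 a, ← Finset.mul_sum,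
    Fintype.sum_equiv ((φ.trans (Equiv.mulRight₀ _ ht)).trans (Equiv.addLeft c))
      (fun a => h (c + φ a * rowFunctional f d fun j => C i j t)) h fun a => rfl, hh, mul_zero]

include hφ h0 ht hh in
/-- The sum over an initial segment is dominated by a block on which the functional is constant. -/
theorem le_sum_rowFunctional {H : ℝ} (hH : ∀ x, |h x| ≤ H) {M : ℕ} (hM : M ≤ t) (m r : ℕ) :
    b ^ M * h (rowFunctional f d (outVec φ C (m * b ^ (t + 1)) i)) - r * H ≤
      ∑ n ∈ Finset.range (m * b ^ (t + 1) + b ^ M + r), h (rowFunctional f d (outVec φ C n i)) := by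
  -- Complete blocks cancel, the functional is constant on the next b^M ≤ b^t indices, and the last
  -- r terms are estimated trivially.
  rw [Finset.sum_range_add, Finset.sum_range_add, sum_range_mul_eq,
    Finset.sum_eq_zero fun k _ => sum_block_rowFunctional hφ C h0 ht hh k, zero_add]
  have hle : b ^ M ≤ b ^ t := Nat.pow_le_pow_right (NeZero.pos b) hM
  have h1 : ∀ n ∈ Finset.range (b ^ M),
      h (rowFunctional f d (outVec φ C (m * b ^ (t + 1) + n) i)) =
      h (rowFunctional f d (outVec φ C (m * b ^ (t + 1)) i)) := fun n hn => by
    have hn' : n < b ^ t := (Finset.mem_range.1 hn).trans_le hle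
    rw [rowFunctional_outVec_add hφ C f d i
        (hn'.trans_le (Nat.pow_le_pow_right (NeZero.pos b) (Nat.le_succ t))),
      rowFunctional_outVec_eq_zero hφ C h0 hn', add_zero]
  rw [Finset.sum_congr rfl h1, Finset.sum_const, Finset.card_range, nsmul_eq_mul]
  have h2 : -(r * H) ≤ ∑ n ∈ Finset.range r,
      h (rowFunctional f d (outVec φ C (m * b ^ (t + 1) + b ^ M + n) i)) := by
    have := Finset.sum_le_sum fun n (_ : n ∈ Finset.range r) =>
      neg_le_of_abs_le (hH (rowFunctional f d (outVec φ C (m * b ^ (t + 1) + b ^ M + n) i)))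
    simpa using this
  push_cast
  linarith

include hφ h0 ht in
/-- Correlation of the local discrepancy of a box with a function of one functional of the
output digits. -/
theorem exists_correlation [DecidableEq K] (hf : f d = 1) {M : ℕ} (hM : M ≤ t) (m : ℕ) {r : ℕ}
    (hr : 2 * b * r ≤ b ^ M) {D E : ℕ} (hD : D = d + E + 2) {Γ : Fin s → ℕ}
    (hΓ : ∀ i, Γ i ≤ b ^ D) {q rem : ℕ} (hΓi : Γ i = q * b ^ (E + 2) + rem) (hrem₁ : b ^ E ≤ rem)
    (hrem₂ : rem + b ^ E ≤ b ^ (E + 2)) :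
    ∃ ρ : K → ℝ, ∑ x, ρ x = 0 ∧ (∀ x, |ρ x| ≤ 1) ∧
      (∏ i' ∈ Finset.univ.erase i, (Γ i' : ℝ)) * b ^ (M + E) / 2 ≤
      ∑ n ∈ Finset.range (m * b ^ (t + 1) + b ^ M + r), ∑ Y : Fin s → Fin D → K,
        boxIndicator φ Γ (Y + truncVec D (outVec φ C n)) *
          ρ (rowFunctional f d (zeroExtend (Y i))) := by
  subst hD
  set p : ℕ → K := fun Q => ∑ j ∈ Finset.range d, f j * digitVec φ (d - 1 - j) Q
  set Λ : ℝ := ∏ i' ∈ Finset.univ.erase i, (Γ i' : ℝ) with hΛdef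
  have hΛ : 0 ≤ Λ := Finset.prod_nonneg fun _ _ => Nat.cast_nonneg _
  obtain ⟨α, β, hgap⟩ := exists_digitCount_gap φ p E q hrem₁ hrem₂
  rw [← hΓi] at hgap
  set T := digitCount φ p (E + 1) (Γ i) with hT
  set e : ℕ → K := fun n => rowFunctional f d (outVec φ C n i) with he
  set σ := e (m * b ^ (t + 1)) with hσ
  -- The difference of two point masses at the values α and β with unequal counts, recentred by the
  -- value σ of the functional on the decisive block. The sum against it is τ, which has mean zero
  -- and is large at σ.
  let ρ : K → ℝ := fun x => (if x = α - σ then 1 else 0) - (if x = β - σ then 1 else 0)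
  let τ : K → ℝ := fun x => Λ * (T (α - σ + x) - T (β - σ + x))
  have hρ1 : ∀ x, |ρ x| ≤ 1 := fun x => by
    simp only [ρ]
    split_ifs <;> norm_num
  have hτ0 : ∑ x, τ x = 0 := by
    simp only [τ]
    rw [← Finset.mul_sum, Finset.sum_sub_distrib, sum_translate, sum_translate, sub_self, mul_zero]
  have hτ1 : ∀ x, |τ x| ≤ Λ * b ^ (E + 1) := fun x => by
    simp only [τ]
    rw [abs_mul, abs_of_nonneg hΛ, hT, hΓi]
    exact mul_le_mul_of_nonneg_left (abs_digitCount_sub_le φ p (E + 1) q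
      ((Nat.le_add_right _ _).trans hrem₂) _ _) hΛ
  have hτσ : Λ * b ^ E ≤ τ σ := by
    simp only [τ, sub_add_cancel]
    exact mul_le_mul_of_nonneg_left hgap hΛ
  -- Translating Y by the n-th output vector turns the correlation into a function of the functional
  -- at n alone.
  have hcorr : ∀ n, ∑ Y : Fin s → Fin (d + E + 2) → K,
      boxIndicator φ Γ (Y + truncVec (d + E + 2) (outVec φ C n)) *
        ρ (rowFunctional f d (zeroExtend (Y i))) = τ (e n) := fun n => by
    set v : Fin s → Fin (d + E + 2) → K := truncVec (d + E + 2) (outVec φ C n) with hv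
    have hvi : rowFunctional f d (zeroExtend (v i)) = e n :=
      rowFunctional_congr f fun j hj => zeroExtend_truncVec _ _ (by omega)
    let F : (Fin s → Fin (d + E + 2) → K) → ℝ := fun Z =>
      boxIndicator φ Γ Z * ρ (rowFunctional f d (zeroExtend (Z i)) - e n)
    have h1 : ∀ Y : Fin s → Fin (d + E + 2) → K, boxIndicator φ Γ (Y + v) *
        ρ (rowFunctional f d (zeroExtend (Y i))) = F (v + Y) := fun Y => by
      simp only [F]
      rw [Pi.add_apply, zeroExtend_add, rowFunctional_add, hvi, add_sub_cancel_left, add_comm Y]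
    rw [Finset.sum_congr rfl fun Y _ => h1 Y, sum_translate v F]
    simp only [F, ρ, mul_sub, Finset.sum_sub_distrib, sub_eq_iff_eq_add (b := e n), τ]
    exact congrArg₂ (· - ·) (sum_boxIndicator_mul_ite φ i (E := E + 1) hf hΓ _)
      (sum_boxIndicator_mul_ite φ i (E := E + 1) hf hΓ _)
  refine ⟨ρ, ?_, hρ1, ?_⟩
  · simp [ρ]
  rw [Finset.sum_congr rfl fun n _ => hcorr n]
  refine le_trans ?_ (le_sum_rowFunctional hφ C h0 ht hτ0 hτ1 hM m r)
  -- The r trailing terms cost at most r Λ b^{E+1}, half of the main term b^M Λ b^E.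
  have hr' : (2 * b * r : ℝ) ≤ b ^ M := by exact_mod_cast hr
  have h1 : (b : ℝ) ^ M * (Λ * b ^ E) ≤ b ^ M * τ σ := mul_le_mul_of_nonneg_left hτσ (by positivity)
  have h2 : (2 * b * r : ℝ) * (Λ * b ^ E) ≤ b ^ M * (Λ * b ^ E) :=
    mul_le_mul_of_nonneg_right hr' (by positivity)
  have h3 : (b : ℝ) ^ M * τ (rowFunctional f d (outVec φ C (m * b ^ (t + 1)) i)) = b ^ M * τ σ := rfl
  rw [h3, pow_succ, pow_add]
  nlinarith

end RowCombination

end FnField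

end

noncomputable section

namespace FnField

/-! ### Combinatorics of the block structure -/

section Blocks

theorem exists_sequence {P : ℕ → Prop} (hP : ∀ n, ∃ d, n ≤ d ∧ P d) (u : ℕ → ℕ) (κ : ℕ) :
    ∃ d : ℕ → ℕ, κ ≤ d 0 ∧ ∀ q, P (d q) ∧ u (d q) ≤ d (q + 1) := by
  choose next hle hnext using hP
  refine ⟨fun q => Nat.rec (next κ) (fun _ x => next (u x)) q, hle κ, fun q => ⟨?_, hle _⟩⟩
  cases q <;> exact hnext _

variable {b : ℕ} (hb : 1 < b) {M t : ℕ → ℕ} (hM : ∀ q, M q + 3 ≤ M (q + 1))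

include hb hM in
theorem two_mul_sum_pow_le (q : ℕ) :
    2 * b * ∑ p ∈ Finset.range q, b ^ M p ≤ b ^ M q := by
  induction q with
  | zero => simp
  | succ q ih =>
    rw [Finset.sum_range_succ, mul_add]
    calc 2 * b * ∑ p ∈ Finset.range q, b ^ M p + 2 * b * b ^ M q
        ≤ b ^ M q + 2 * b * b ^ M q := Nat.add_le_add_right ih _
      _ = (1 + 2 * b) * b ^ M q := by ring
      _ ≤ b ^ 3 * b ^ M q := Nat.mul_le_mul_right _ (by nlinarith [Nat.mul_le_mul hb hb])
      _ = b ^ (M q + 3) := by ring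
      _ ≤ b ^ M (q + 1) := Nat.pow_le_pow_right (by omega) (hM q)

include hM in
-- The terms with p > q are multiples of b^{t_q + 1}, so they form complete blocks; those with p < q
-- form a short tail.
theorem exists_eq_blocks (ht : ∀ q, t q + 1 ≤ M (q + 1)) {q R : ℕ} (hq : q < R) :
    ∃ m, ∑ p ∈ Finset.range R, b ^ M p =
      m * b ^ (t q + 1) + b ^ M q + ∑ p ∈ Finset.range q, b ^ M p := by
  have hmono : StrictMono M := strictMono_nat_of_lt_succ fun q => by have := hM q; omega
  induction R, hq using Nat.le_induction with
  | base =>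
    refine ⟨0, ?_⟩
    rw [Finset.sum_range_succ]
    ring
  | succ R hR ih =>
    obtain ⟨m, hm⟩ := ih
    obtain ⟨e, he⟩ := Nat.exists_eq_add_of_le ((ht q).trans (hmono.monotone hR))
    refine ⟨m + b ^ e, ?_⟩
    rw [Finset.sum_range_succ, hm, he, pow_add]
    ring

end Blocks

/-! ### Sums over vectors of digits -/

section Vectors

variable {K : Type*} [Field K] [Fintype K] {b : ℕ} (φ : Fin b ≃ K) {s : ℕ}

include φ in
-- Both sides come from summing g(a + Y_i) over all a and Y in the two orders.
theorem pow_mul_sum_coordinate {D : ℕ} (i : Fin s) (g : (Fin D → K) → ℝ) :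
    (b : ℝ) ^ D * ∑ Y : Fin s → Fin D → K, g (Y i) =
      (∏ _i : Fin s, (b : ℝ) ^ D) * ∑ y, g y := by
  have h1 : ∀ a : Fin D → K, ∑ Y : Fin s → Fin D → K, g (a + Y i) =
      ∑ Y : Fin s → Fin D → K, g (Y i) := fun a => by
    rw [← sum_translate (Pi.single i a) fun Y : Fin s → Fin D → K => g (Y i)]
    simp
  have h2 : ∑ a : Fin D → K, ∑ Y : Fin s → Fin D → K, g (a + Y i) =
      Fintype.card (Fin s → Fin D → K) * ∑ y, g y := by
    rw [Finset.sum_comm]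
    simp only [add_comm _ ((_ : Fin s → Fin D → K) i)]
    simp [sum_translate]
  rw [Finset.sum_congr rfl fun a _ => h1 a, card_vectors φ, Finset.sum_const, Finset.card_univ,
    nsmul_eq_mul] at h2
  rw [← h2]
  simp [← Fintype.card_congr φ]

/-- Number of coordinates in which a vector of digits is next to the boundary of a box. -/
def boundaryCount {D : ℕ} (Γ : Fin s → ℕ) (Y : Fin s → Fin D → K) : ℝ :=
  ∑ i, if Γ i ≤ vecInt φ (Y i) + 1 ∧ vecInt φ (Y i) ≤ Γ i then 1 else 0

/-- In each coordinate only the two values Γ_i − 1 and Γ_i count, a proportion of at most 2 b^{−D}.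
-/
theorem pow_mul_sum_boundaryCount_le {D : ℕ} (Γ : Fin s → ℕ) :
    (b : ℝ) ^ D * ∑ Y : Fin s → Fin D → K, boundaryCount φ Γ Y ≤
      2 * s * ∏ _i : Fin s, (b : ℝ) ^ D := by
  simp only [boundaryCount]
  rw [Finset.sum_comm, Finset.mul_sum]
  have h1 : ∀ i, (b : ℝ) ^ D * ∑ Y : Fin s → Fin D → K,
      (if Γ i ≤ vecInt φ (Y i) + 1 ∧ vecInt φ (Y i) ≤ Γ i then (1 : ℝ) else 0) ≤
      2 * ∏ _i : Fin s, (b : ℝ) ^ D := fun i => by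
    rw [pow_mul_sum_coordinate φ i fun y =>
      if Γ i ≤ vecInt φ y + 1 ∧ vecInt φ y ≤ Γ i then (1 : ℝ) else 0, mul_comm]
    refine mul_le_mul_of_nonneg_right ?_ (by positivity)
    rw [sum_vecInt φ fun n => if Γ i ≤ n + 1 ∧ n ≤ Γ i then (1 : ℝ) else 0, Finset.sum_boole]
    have hsub : (Finset.range (b ^ D)).filter (fun n => Γ i ≤ n + 1 ∧ n ≤ Γ i) ⊆
        Finset.Icc (Γ i - 1) (Γ i) := fun n hn => by
      rw [Finset.mem_filter] at hn
      rw [Finset.mem_Icc]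
      omega
    have := (Finset.card_le_card hsub).trans_eq (Nat.card_Icc _ _)
    exact_mod_cast this.trans (by omega)
  refine (Finset.sum_le_sum fun i _ => h1 i).trans_eq ?_
  simp
  ring

variable [NeZero b]

omit [Fintype K] in
-- The point and the side are each within one unit of their integer parts, so a wrong decision in
-- some coordinate needs a truncation next to the face.
theorem abs_indicator_sub_boxIndicator_le {C : Fin s → ℕ → ℕ → K} {γ : Fin s → ℝ}
    (hγ : ∀ i, 0 ≤ γ i) (D n : ℕ) :
    |(Set.univ.pi fun i => Set.Ico 0 (γ i)).indicator (fun _ => (1 : ℝ)) (digitalSequence b φ C n) -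
        boxIndicator φ (fun i => ⌊γ i * b ^ D⌋₊) (truncVec D (outVec φ C n))| ≤
      boundaryCount φ (fun i => ⌊γ i * b ^ D⌋₊) (truncVec D (outVec φ C n)) := by
  have hbD : (0 : ℝ) < (b : ℝ) ^ D := by have := NeZero.pos b; positivity
  rw [indicator_box (x := digitalSequence b φ C n) fun i => Real.ofDigits_nonneg _,
    boxIndicator_eq_ite]
  rw [boundaryCount]
  set X : Fin s → ℕ := fun i => vecInt φ (truncVec D (outVec φ C n) i) with hX
  set x : Fin s → ℝ := digitalSequence b φ C n with hx
  have h1 : ∀ i, (X i : ℝ) ≤ x i * b ^ D := fun i => by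
    simp only [hX, hx, vecInt_truncVec, digitalSequence_eq]
    exact intPart_le_ofDigits _ D
  have h2 : ∀ i, x i * b ^ D ≤ X i + 1 := fun i => by
    simp only [hX, hx, vecInt_truncVec, digitalSequence_eq]
    exact ofDigits_le_intPart _ D
  have h3 : ∀ i, (⌊γ i * b ^ D⌋₊ : ℝ) ≤ γ i * b ^ D := fun i =>
    Nat.floor_le (mul_nonneg (hγ i) hbD.le)
  have h4 : ∀ i, γ i * b ^ D < ⌊γ i * b ^ D⌋₊ + 1 := fun i => Nat.lt_floor_add_one _
  by_cases hall : ∀ i, x i < γ i ↔ X i < ⌊γ i * b ^ D⌋₊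
  · rw [if_congr (forall_congr' hall) rfl rfl, sub_self, abs_zero]
    exact Finset.sum_nonneg fun i _ => by positivity
  · push Not at hall
    obtain ⟨i, hi⟩ := hall
    have hone : (1 : ℝ) ≤ if ⌊γ i * b ^ D⌋₊ ≤ X i + 1 ∧ X i ≤ ⌊γ i * b ^ D⌋₊ then 1 else 0 := by
      rw [if_pos]
      rcases hi with ⟨hxi, hXi⟩ | ⟨hxi, hXi⟩
      · refine ⟨by omega, ?_⟩
        have h5 : x i * b ^ D < γ i * b ^ D := mul_lt_mul_of_pos_right hxi hbD
        have h6 : (X i : ℝ) < ⌊γ i * b ^ D⌋₊ + 1 := by linarith [h1 i, h4 i]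
        exact Nat.lt_succ_iff.1 (by exact_mod_cast h6)
      · refine ⟨?_, by omega⟩
        have h5 : γ i * b ^ D ≤ x i * b ^ D := mul_le_mul_of_nonneg_right hxi hbD.le
        have h6 : (⌊γ i * b ^ D⌋₊ : ℝ) ≤ X i + 1 := by linarith [h2 i, h3 i]
        exact_mod_cast h6
    refine le_trans ?_ (hone.trans (Finset.single_le_sum
      (f := fun i => if ⌊γ i * b ^ D⌋₊ ≤ X i + 1 ∧ X i ≤ ⌊γ i * b ^ D⌋₊ then (1 : ℝ) else 0)
      (fun i _ => by positivity) (Finset.mem_univ i)))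
    split_ifs <;> norm_num

omit [NeZero b] in
/-- Functions of functionals with different leading positions are orthogonal, which bounds the
mean of the absolute value of their sum. -/
theorem sq_sum_abs_sum_rowFunctional_le (i : Fin s) {D R : ℕ} {d : ℕ → ℕ} (hd : StrictMono d)
    (hdD : ∀ q < R, d q < D) {f : ℕ → ℕ → K} (hf : ∀ q, f q (d q) = 1) {ρ : ℕ → K → ℝ}
    (hρ : ∀ q < R, ∑ x, ρ q x = 0) (hρ1 : ∀ q < R, ∀ x, |ρ q x| ≤ 1) :
    (∑ Y : Fin s → Fin D → K,
      |∑ q ∈ Finset.range R, ρ q (rowFunctional (f q) (d q) (zeroExtend (Y i)))|) ^ 2 ≤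
      R * (Fintype.card (Fin s → Fin D → K) : ℝ) ^ 2 := by
  set g : ℕ → (Fin s → Fin D → K) → ℝ := fun q Y =>
    ρ q (rowFunctional (f q) (d q) (zeroExtend (Y i))) with hg
  -- The functional with leading position d_p does not see the digit of larger index d_q.
  have horth : ∀ p q, p < q → q < R → ∑ Y, g q Y * g p Y = 0 := fun p q hpq hq => by
    refine sum_rowFunctional_mul_eq_zero i (hdD q hq) (hf q) (hρ q hq) (g p) fun t Y => ?_
    simp only [hg]
    rw [Pi.add_apply, Pi.single_eq_same, zeroExtend_add, zeroExtend_single, rowFunctional_add,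
      rowFunctional_single_of_lt _ (hd hpq), zero_add]
  have hsq : ∑ Y, (∑ q ∈ Finset.range R, g q Y) ^ 2 ≤
      R * (Fintype.card (Fin s → Fin D → K) : ℝ) := by
    simp only [pow_two, Finset.sum_mul_sum]
    rw [Finset.sum_comm]
    have h1 : ∀ q ∈ Finset.range R, ∑ Y, ∑ p ∈ Finset.range R, g q Y * g p Y ≤
        (Fintype.card (Fin s → Fin D → K) : ℝ) := fun q hq => by
      rw [Finset.sum_comm, Finset.sum_eq_single q]
      · have h2 : ∀ Y ∈ Finset.univ, g q Y * g q Y ≤ 1 := fun Y _ => by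
          rw [← abs_mul_abs_self]
          exact mul_le_one₀ (hρ1 q (Finset.mem_range.1 hq) _) (abs_nonneg _)
            (hρ1 q (Finset.mem_range.1 hq) _)
        simpa using Finset.sum_le_sum h2
      · intro p hp hpq
        rcases lt_or_gt_of_ne hpq with h | h
        · exact horth p q h (Finset.mem_range.1 hq)
        · simp only [mul_comm (g q _)]
          exact horth q p h (Finset.mem_range.1 hp)
      · exact fun h => absurd hq h
    simpa using Finset.sum_le_sum h1
  -- Cauchy–Schwarz passes from the quadratic mean, where orthogonality leaves only R diagonal
  -- terms, to the mean absolute value.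
  have hcs := sq_sum_le_card_mul_sum_sq (s := Finset.univ)
    (f := fun Y : Fin s → Fin D → K => |∑ q ∈ Finset.range R, g q Y|)
  simp only [sq_abs, Finset.card_univ] at hcs
  refine hcs.trans ?_
  rw [pow_two, ← mul_assoc, mul_comm]
  exact mul_le_mul_of_nonneg_right hsq (Nat.cast_nonneg _)

end Vectors

end FnField

end

/-! ### Bounded remainder boxes have sides with finite expansions. -/

noncomputable section

namespace FnField

open Filter Topology

section OnlyIf

variable {K : Type*} [Field K] {b : ℕ} [NeZero b] {φ : Fin b ≃ K} (hφ : φ 0 = 0) {s : ℕ}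
  {C : Fin s → ℕ → ℕ → K}

include hφ in
/-- A correlation on all vectors of digits is realized by the sequence, up to a boundary term. -/
theorem le_sum_discrepancy [Fintype K] {γ : Fin s → ℝ} (hγ : ∀ i, 0 ≤ γ i) (lam : ℝ) {c D L N₀ N : ℕ}
    (hequi : ∀ F : (Fin s → Fin D → K) → ℝ,
      ∑ k ∈ Finset.range (b ^ L), F (truncVec D (outVec φ C (k * b ^ c))) = N₀ * ∑ Y, F Y)
    (hN : N ≤ b ^ c) (i : Fin s) {f : ℕ → K} {d : ℕ} (hd : d < D) (hf : f d = 1) {ρ : K → ℝ}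
    (hρ : ∑ x, ρ x = 0) (hρ1 : ∀ x, |ρ x| ≤ 1) {V : ℝ}
    (hV : V ≤ ∑ n ∈ Finset.range N, ∑ Y : Fin s → Fin D → K,
      boxIndicator φ (fun i => ⌊γ i * b ^ D⌋₊) (Y + truncVec D (outVec φ C n)) *
        ρ (rowFunctional f d (zeroExtend (Y i)))) :
    N₀ * (V - N * ∑ Y : Fin s → Fin D → K, boundaryCount φ (fun i => ⌊γ i * b ^ D⌋₊) Y) ≤
      ∑ k ∈ Finset.range (b ^ L), (∑ n ∈ Finset.range N,
        ((Set.univ.pi fun i => Set.Ico 0 (γ i)).indicator (fun _ => (1 : ℝ))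
          (digitalSequence b φ C (k * b ^ c + n)) - lam)) *
        ρ (rowFunctional f d (zeroExtend (truncVec D (outVec φ C (k * b ^ c)) i))) := by
  set Γ : Fin s → ℕ := fun i => ⌊γ i * b ^ D⌋₊ with hΓ
  let g : (Fin s → Fin D → K) → ℝ := fun Y => ρ (rowFunctional f d (zeroExtend (Y i)))
  -- The box on D digits, minus the boundary term, is a pointwise lower bound for the true
  -- discrepancy and depends only on Y, so equidistribution applies to it.
  let F : (Fin s → Fin D → K) → ℝ := fun Y => ∑ n ∈ Finset.range N,
    ((boxIndicator φ Γ (Y + truncVec D (outVec φ C n)) - lam) * g Y -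
      boundaryCount φ Γ (Y + truncVec D (outVec φ C n)))
  -- Mean zero of g removes the constant `lam` from the correlation.
  have hg : ∑ Y, g Y = 0 := by
    have := sum_rowFunctional_mul_eq_zero i hd hf hρ (fun _ => 1) fun _ _ => rfl
    simpa using this
  have hF : ∑ Y, F Y = ∑ n ∈ Finset.range N, ∑ Y : Fin s → Fin D → K,
      boxIndicator φ Γ (Y + truncVec D (outVec φ C n)) * g Y -
      N * ∑ Y : Fin s → Fin D → K, boundaryCount φ Γ Y := by
    simp only [F]
    rw [Finset.sum_comm]
    have h1 : ∀ n ∈ Finset.range N, ∑ Y : Fin s → Fin D → K,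
        ((boxIndicator φ Γ (Y + truncVec D (outVec φ C n)) - lam) * g Y -
          boundaryCount φ Γ (Y + truncVec D (outVec φ C n))) =
        ∑ Y : Fin s → Fin D → K, boxIndicator φ Γ (Y + truncVec D (outVec φ C n)) * g Y -
          ∑ Y : Fin s → Fin D → K, boundaryCount φ Γ Y := fun n _ => by
      rw [Finset.sum_sub_distrib]
      simp only [sub_mul, Finset.sum_sub_distrib]
      rw [← Finset.mul_sum, hg, mul_zero, sub_zero]
      congr 1
      simp only [add_comm _ (truncVec D (outVec φ C n))]
      exact sum_translate _ _
    rw [Finset.sum_congr rfl h1, Finset.sum_sub_distrib]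
    simp
  have hle : (N₀ : ℝ) * (V - N * ∑ Y : Fin s → Fin D → K, boundaryCount φ Γ Y) ≤
      N₀ * ∑ Y, F Y := by
    rw [hF]
    exact mul_le_mul_of_nonneg_left (sub_le_sub_right hV _) (Nat.cast_nonneg _)
  refine hle.trans ?_
  rw [← hequi F]
  refine Finset.sum_le_sum fun k _ => ?_
  rw [Finset.sum_mul]
  refine Finset.sum_le_sum fun n hn => ?_
  have hsplit : truncVec D (outVec φ C (k * b ^ c)) + truncVec D (outVec φ C n) =
      truncVec D (outVec φ C (k * b ^ c + n)) := by
    rw [outVec_add C hφ ((Finset.mem_range.1 hn).trans_le hN), truncVec_add]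
  rw [hsplit]
  have h1 := abs_indicator_sub_boxIndicator_le φ (C := C) hγ D (k * b ^ c + n)
  set x := (Set.univ.pi fun i => Set.Ico 0 (γ i)).indicator (fun _ => (1 : ℝ))
    (digitalSequence b φ C (k * b ^ c + n))
  set y := boxIndicator φ Γ (truncVec D (outVec φ C (k * b ^ c + n)))
  set w := g (truncVec D (outVec φ C (k * b ^ c)))
  have h2 : |(x - y) * w| ≤ |x - y| := by
    rw [abs_mul]
    exact mul_le_of_le_one_right (abs_nonneg _) (hρ1 _)
  have h3 := neg_le_of_abs_le (h2.trans h1)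
  change _ ≤ (x - lam) * w
  linarith

/-- The combined row is nonzero because f_d = 1 and rows are independent; t is its first nonzero
column. -/
theorem exists_leading_column (hrow : ∀ (c D : ℕ) (f : Fin s → ℕ → K),
      (∀ r, c ≤ r → ∑ i, ∑ j ∈ Finset.range D, f i j * C i j r = 0) → ∀ i, ∀ j < D, f i j = 0)
    (i : Fin s) {f : ℕ → K} {d : ℕ} (hf : f d = 1) :
    ∃ t, (∀ r < t, rowFunctional f d (fun j => C i j r) = 0) ∧
      rowFunctional f d (fun j => C i j t) ≠ 0 := by
  classical
  have hex : ∃ t, rowFunctional f d (fun j => C i j t) ≠ 0 := by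
    by_contra! hall
    have := hrow 0 (d + 1) (Pi.single i f) (fun r _ => by
      rw [Finset.sum_eq_single i (fun i' _ hi' => by simp [hi']) (by simp)]
      simpa [rowFunctional] using hall r) i d (Nat.lt_succ_self d)
    rw [Pi.single_eq_same, hf] at this
    exact one_ne_zero this
  exact ⟨Nat.find hex, fun r hr => not_not.1 (Nat.find_min hex hr), Nat.find_spec hex⟩

omit [NeZero b] in
theorem tendsto_floor_mul_pow_div (hb : 1 < b) {γ : ℝ} (hγ : 0 ≤ γ) :
    Tendsto (fun D : ℕ => (⌊γ * b ^ D⌋₊ : ℝ) / b ^ D) atTop (𝓝 γ) :=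
  (tendsto_nat_floor_mul_div_atTop hγ).comp
    (tendsto_pow_atTop_atTop_of_one_lt (by exact_mod_cast hb))

include hφ in
/-- The sides of a bounded remainder box have finite expansions. -/
theorem finite_digits_of_isBoundedRemainderSet
    (hrow : ∀ (c D : ℕ) (f : Fin s → ℕ → K),
      (∀ r, c ≤ r → ∑ i, ∑ j ∈ Finset.range D, f i j * C i j r = 0) → ∀ i, ∀ j < D, f i j = 0)
    (hrel : ∀ i, ∃ κ, ∀ d, ∃ f : ℕ → K, f d = 1 ∧
      ∀ r, r + κ < d → ∑ j ∈ Finset.range (d + 1), f j * C i j r = 0)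
    {γ : Fin s → ℝ} (hγ : ∀ i, γ i ∈ Set.Ioo (0 : ℝ) 1)
    (hbr : IsBoundedRemainderSet (Set.univ.pi fun i => Set.Ico 0 (γ i)) (digitalSequence b φ C))
    (i : Fin s) : {j : ℕ | Real.digits (γ i) b j ≠ 0}.Finite := by
  classical
  have hb := one_lt_card_of_equiv φ
  have : Fintype K := Fintype.ofEquiv _ φ
  have hγ0 : ∀ i, 0 ≤ γ i := fun i => (hγ i).1.le
  by_contra hinf
  obtain ⟨C₀, hC₀⟩ := hbr
  set lam := MeasureTheory.volume.real (Set.univ.pi fun i => Set.Ico 0 (γ i)) with hlam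
  set δ : ℕ → ℝ := fun n => (Set.univ.pi fun i => Set.Ico 0 (γ i)).indicator (fun _ => (1 : ℝ))
    (digitalSequence b φ C n) - lam with hδ
  have hblock : ∀ a N, |∑ n ∈ Finset.range N, δ (a + n)| ≤ 2 * C₀ := fun a N => by
    have h1 : ∑ n ∈ Finset.range N, δ (a + n) =
        ∑ n ∈ Finset.range (a + N), δ n - ∑ n ∈ Finset.range a, δ n := by
      rw [Finset.sum_range_add, add_sub_cancel_left]
    rw [h1, two_mul]
    exact (abs_sub _ _).trans (add_le_add (hC₀ _) (hC₀ _))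
  have hC₀0 : 0 ≤ C₀ := (abs_nonneg _).trans (hC₀ 0)
  obtain ⟨κ, hκ⟩ := hrel i
  choose f hf hfrel using hκ
  choose t ht0 ht using fun d => exists_leading_column hrow i (hf d)
  have hdt : ∀ d, d ≤ t d + κ := fun d => by
    by_contra hlt
    exact ht d (hfrel d (t d) (not_le.1 hlt))
  -- Gaps of 3 make the sum of the smaller blocks negligible; passing t(d) + κ makes later blocks
  -- multiples of b^{t+1}; starting at κ allows M_q = d_q − κ.
  obtain ⟨d, hd0, hd⟩ := exists_sequence (exists_fract_mem_Icc hb (hγ0 i) hinf)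
    (fun x => max (x + 3) (t x + κ + 1)) κ
  have hd3 : ∀ q, d q + 3 ≤ d (q + 1) := fun q => (le_max_left _ _).trans (hd q).2
  have hdt1 : ∀ q, t (d q) + κ + 1 ≤ d (q + 1) := fun q => (le_max_right _ _).trans (hd q).2
  have hdmono : StrictMono d := strictMono_nat_of_lt_succ fun q => by have := hd3 q; omega
  have hdκ : ∀ q, κ ≤ d q := fun q => hd0.trans (hdmono.monotone (Nat.zero_le q))
  set M : ℕ → ℕ := fun q => d q - κ with hMdef
  have hMd : ∀ q, M q + κ = d q := fun q => Nat.sub_add_cancel (hdκ q)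
  have hM3 : ∀ q, M q + 3 ≤ M (q + 1) := fun q => by
    have := hd3 q; have := hMd q; have := hMd (q + 1); omega
  have hMt1 : ∀ q, t (d q) + 1 ≤ M (q + 1) := fun q => by
    have := hdt1 q; have := hMd (q + 1); omega
  have hMt : ∀ q, M q ≤ t (d q) := fun q => by
    have := hdt (d q); have := hMd q; omega
  set Λ : ℝ := ∏ i' ∈ Finset.univ.erase i, γ i' with hΛ
  have hΛ0 : 0 < Λ := Finset.prod_pos fun i' _ => (hγ i').1
  have hb0 : (0 : ℝ) < b := by exact_mod_cast NeZero.pos b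
  -- Three factors 2 are lost: in replacing the γ by floors, in the trailing terms, and for the
  -- boundary. The power is b^D / b^{M+E}, independent of q.
  set ε : ℝ := Λ / (8 * b ^ (κ + 2)) with hε
  have hε0 : 0 < ε := by positivity
  obtain ⟨R, hR⟩ := exists_nat_gt (4 * C₀ ^ 2 / ε ^ 2)
  have hR0 : 0 < R := by
    have : (0 : ℝ) < R := lt_of_le_of_lt (by positivity) hR
    exact_mod_cast this
  set N := ∑ p ∈ Finset.range R, b ^ M p with hN
  have hNc : N ≤ b ^ M R := by
    have := two_mul_sum_pow_le hb hM3 R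
    rw [← hN] at this
    nlinarith [Nat.zero_le N]
  -- R and N are fixed before D, so D can be so large that the boundary term, of proportion N
  -- b^{−D}, falls below ε.
  obtain ⟨D, hDd, hDΛ, hDN⟩ : ∃ D, d R + 2 ≤ D ∧
      Λ / 2 ≤ ∏ i' ∈ Finset.univ.erase i, ((⌊γ i' * b ^ D⌋₊ : ℝ) / b ^ D) ∧
      2 * s * N / ε ≤ (b : ℝ) ^ D := by
    have h1 := (tendsto_finsetProd (Finset.univ.erase i) fun i' _ =>
      tendsto_floor_mul_pow_div hb (hγ0 i')).eventually (eventually_ge_nhds (half_lt_self hΛ0))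
    have h2 := (tendsto_pow_atTop_atTop_of_one_lt (r := (b : ℝ)) (by exact_mod_cast hb)).eventually
      (eventually_ge_atTop (2 * s * N / ε))
    obtain ⟨D, h3, h4, h5⟩ := ((eventually_ge_atTop (d R + 2)).and (h1.and h2)).exists
    exact ⟨D, h3, h4, h5⟩
  have hbD : (0 : ℝ) < (b : ℝ) ^ D := by positivity
  set Ω : ℝ := ∏ _i : Fin s, (b : ℝ) ^ D with hΩ
  have hΩ0 : 0 < Ω := Finset.prod_pos fun _ _ => hbD
  have hdD : ∀ q < R, d q + 2 ≤ D := fun q hq => by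
    have := hdmono hq; omega
  obtain ⟨L, N₀, hN₀, hequi⟩ := sum_truncVec_outVec C hφ (M R) D (hrow (M R) D)
  set Γ : Fin s → ℕ := fun i => ⌊γ i * b ^ D⌋₊ with hΓdef
  have hΓ : ∀ i, Γ i ≤ b ^ D := fun i => by
    refine Nat.floor_le_of_le ?_
    push_cast
    exact mul_le_of_le_one_left hbD.le (hγ i).2.le
  have hbd : (N : ℝ) * ∑ Y : Fin s → Fin D → K, boundaryCount φ Γ Y ≤ ε * Ω := by
    have h1 := pow_mul_sum_boundaryCount_le φ (D := D) Γ
    rw [div_le_iff₀ hε0] at hDN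
    refine le_of_mul_le_mul_left ?_ hbD
    calc (b : ℝ) ^ D * (N * ∑ Y : Fin s → Fin D → K, boundaryCount φ Γ Y)
        = N * (b ^ D * ∑ Y : Fin s → Fin D → K, boundaryCount φ Γ Y) := by ring
      _ ≤ N * (2 * s * Ω) := mul_le_mul_of_nonneg_left h1 (Nat.cast_nonneg _)
      _ = (2 * s * N) * Ω := by ring
      _ ≤ (b ^ D * ε) * Ω := mul_le_mul_of_nonneg_right hDN hΩ0.le
      _ = _ := by ring
  have hmain : ∀ q, q < R → ∃ ρ : K → ℝ, ∑ x, ρ x = 0 ∧ (∀ x, |ρ x| ≤ 1) ∧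
      N₀ * (ε * Ω) ≤ ∑ k ∈ Finset.range (b ^ L), (∑ n ∈ Finset.range N, δ (k * b ^ M R + n)) *
        ρ (rowFunctional (f (d q)) (d q)
          (zeroExtend (truncVec D (outVec φ C (k * b ^ M R)) i))) := fun q hq => by
    obtain ⟨E, hE⟩ := Nat.exists_eq_add_of_le (hdD q hq)
    have hE' : D = d q + E + 2 := by omega
    obtain ⟨m, hm⟩ := exists_eq_blocks (t := fun q => t (d q)) hM3 hMt1 hq
    obtain ⟨Q, rem, hQ, hrem₁, hrem₂⟩ := floor_eq_of_fract_mem_Icc (hγ0 i) (E := E)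
      (hd q).1.1 (hd q).1.2
    rw [← hE'] at hQ
    obtain ⟨ρ, hρ0, hρ1, hρ⟩ := exists_correlation hφ C (ht0 (d q)) (ht (d q)) (hf (d q)) (hMt q) m
      (two_mul_sum_pow_le hb hM3 q) hE' hΓ hQ hrem₁ hrem₂
    refine ⟨ρ, hρ0, hρ1, ?_⟩
    rw [← hm] at hρ
    refine le_trans ?_ (le_sum_discrepancy hφ hγ0 lam hequi hNc i (by omega) (hf (d q)) hρ0 hρ1 hρ)
    refine mul_le_mul_of_nonneg_left ?_ (Nat.cast_nonneg _)
    -- Twice the target: one half is absorbed by the boundary term.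
    have hV : 2 * (ε * Ω) ≤ (∏ i' ∈ Finset.univ.erase i, (Γ i' : ℝ)) * b ^ (M q + E) / 2 := by
      rw [Finset.prod_div_distrib] at hDΛ
      have hP : (0 : ℝ) < ∏ _i ∈ Finset.univ.erase i, (b : ℝ) ^ D :=
        Finset.prod_pos fun _ _ => hbD
      rw [le_div_iff₀ hP] at hDΛ
      have hDe : (b : ℝ) ^ D = b ^ (M q + E) * b ^ (κ + 2) := by
        rw [← pow_add]
        congr 1
        have := hMd q
        omega
      have hΩe : Ω = b ^ (M q + E) * b ^ (κ + 2) * ∏ _i ∈ Finset.univ.erase i, (b : ℝ) ^ D := by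
        rw [hΩ, ← Finset.mul_prod_erase _ _ (Finset.mem_univ i), ← hDe]
      rw [hΩe, hε]
      set P := ∏ _i ∈ Finset.univ.erase i, (b : ℝ) ^ D
      have h1 : 2 * (Λ / (8 * (b : ℝ) ^ (κ + 2)) * (b ^ (M q + E) * b ^ (κ + 2) * P)) =
          (Λ / 2 * P) * b ^ (M q + E) / 2 := by
        field_simp
        ring
      rw [h1]
      gcongr
    linarith
  choose! ρ hρ0 hρ1 hρ using hmain
  -- Tested against W, the block discrepancies give at least R N₀ ε Ω, whereas their bound 2 C₀ and
  -- orthogonality allow only 2 C₀ N₀ √R Ω.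
  let W : (Fin s → Fin D → K) → ℝ := fun Y =>
    ∑ q ∈ Finset.range R, ρ q (rowFunctional (f (d q)) (d q) (zeroExtend (Y i)))
  have hlow : R * (N₀ * (ε * Ω)) ≤ ∑ k ∈ Finset.range (b ^ L),
      (∑ n ∈ Finset.range N, δ (k * b ^ M R + n)) * W (truncVec D (outVec φ C (k * b ^ M R))) := by
    simp only [W, Finset.mul_sum]
    rw [Finset.sum_comm]
    have := Finset.sum_le_sum fun q (hq : q ∈ Finset.range R) => hρ q (Finset.mem_range.1 hq)
    simpa using this
  have hup : ∑ k ∈ Finset.range (b ^ L), (∑ n ∈ Finset.range N, δ (k * b ^ M R + n)) *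
      W (truncVec D (outVec φ C (k * b ^ M R))) ≤ 2 * C₀ * (N₀ * ∑ Y, |W Y|) := by
    rw [← hequi fun Y => |W Y|, Finset.mul_sum]
    refine Finset.sum_le_sum fun k _ => (le_abs_self _).trans ?_
    rw [abs_mul]
    exact mul_le_mul_of_nonneg_right (hblock _ _) (abs_nonneg _)
  have hW := sq_sum_abs_sum_rowFunctional_le (K := K) i (D := D) (f := fun q => f (d q)) hdmono
    (fun q hq => by have := hdD q hq; omega) (fun q => hf (d q)) hρ0 hρ1
  rw [card_vectors φ] at hW
  have hN₀' : (0 : ℝ) < N₀ := by exact_mod_cast hN₀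
  have hR0' : (0 : ℝ) < R := by exact_mod_cast hR0
  have h1 : R * (ε * Ω) ≤ 2 * C₀ * ∑ Y, |W Y| := by
    refine le_of_mul_le_mul_left ?_ hN₀'
    linarith [hlow.trans hup]
  have h2 : (R * (ε * Ω)) ^ 2 ≤ (2 * C₀) ^ 2 * (R * Ω ^ 2) := by
    refine (pow_le_pow_left₀ (by positivity) h1 2).trans ?_
    rw [mul_pow]
    exact mul_le_mul_of_nonneg_left hW (by positivity)
  rw [div_lt_iff₀ (by positivity)] at hR
  have h3 : (4 * C₀ ^ 2) * (R * Ω ^ 2) < (R * ε ^ 2) * (R * Ω ^ 2) :=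
    mul_lt_mul_of_pos_right hR (by positivity)
  nlinarith

end OnlyIf

end FnField

end

/-- Bounded remainder boxes for Xing-Niederreiter sequences. -/
theorem theorem2 {K F : Type*} [Field K] [Field F] [Algebra K F]
    [Algebra (RatFunc K) F] [IsScalarTower K (RatFunc K) F] [FunctionField K F]
    -- `K` is the full constant field of `F`
    (hK : ∀ x : F, IsAlgebraic K x → x ∈ (algebraMap K F).range)
    -- `K` has `b` elements; `φ` is the bijection between digits and elements of `K`
    (b : ℕ) [NeZero b] (φ : Fin b ≃ K) (hφ : φ 0 = 0)
    -- the places `P_∞`, `P_0`, `P_1, …, P_s` and the divisor `G`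
    {s : ℕ} (Pinf P0 : Place K F) (P : Fin s → Place K F) (G : Divisor K F)
    (hrat : Pinf.degree = 1) (hP : Function.Injective P)
    (hPinf : ∀ i, P i ≠ Pinf) (hP0 : ∀ i, P0 ≠ P i) (hP0inf : P0 ≠ Pinf)
    (hG : 0 ≤ G) (hGdeg : G.degree = 2 * (genus K F : ℤ))
    (hGinf : G Pinf = 0) (hGP0 : G P0 = 0)
    -- the basis `w_0, …, w_g` of `L(G)` with `ν(w_u) = n_u` at `P_∞`
    (w : Fin (genus K F + 1) → F) (m : Fin (genus K F + 1) → ℕ)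
    (hw : IsBasisOf w (riemannRochSpace G))
    (hwm : ∀ u, Pinf.ord (w u) = ((m u : ℤ) : WithTop ℤ))
    (hm : StrictMono m) (hm0 : m 0 = 0) (hmg : m (Fin.last _) ≤ 2 * genus K F)
    -- `w_0, …, w_g` and the first `n e_i` of the `k^{(i)}_j` form a basis of `L(G + n P_i)`
    (k : Fin s → ℕ → F)
    (hk : ∀ (i : Fin s) (n : ℕ),
      IsBasisOf (Sum.elim w fun j : Fin (n * (P i).degree) => k i j)
        (riemannRochSpace (G + Finsupp.single (P i) (n : ℤ))))
    -- the special local parameter `z` at `P_∞`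
    (z : F)
    (hz : z ∈ riemannRochSpace
      (Finsupp.single P0 (2 * (genus K F : ℤ) + 1) - Finsupp.single Pinf 1))
    (hz' : z ∉ riemannRochSpace
      (Finsupp.single P0 (2 * (genus K F : ℤ) + 1) - Finsupp.single Pinf 2))
    (γ : Fin s → ℝ) (hγ : ∀ i, γ i ∈ Set.Ioo (0 : ℝ) 1) :
    IsBoundedRemainderSet (Set.univ.pi fun i => Set.Ico 0 (γ i))
        (digitalSequence b φ (xnMatrix Pinf m w z k)) ↔
      ∀ i, {j : ℕ | Real.digits (γ i) b j ≠ 0}.Finite := by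
  have hrow := xnMatrix_rows_independent hrat hP0inf hG hGinf hw hwm hm hmg hz hz' hP hPinf hP0 hk
  have hcol :=
    xnMatrix_columns_independent hrat hP0inf hG hGdeg hGinf hw hwm hm hmg hz hz' hPinf hk
  have hrel :=
    xnMatrix_exists_row_relation hrat hP0inf hG hGdeg hGinf hw hwm hm hmg hz hz' hPinf hk
  exact ⟨fun h i => finite_digits_of_isBoundedRemainderSet hφ hrow hrel hγ h i, fun h =>
    isBoundedRemainderSet_of_finite_digits hφ
      (fun D f hf => hrow 0 D f fun r _ => hf r) hcol hγ h⟩
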